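/- **Setting.** Let $m,n\ge 1$, $N=mn$, and $P(x)=\frac1N\sum_{\tau=1}^n\sum_{i=1}^m\phi_{i\tau}(A_{i\tau}^\top x)+g(x)$ on $\mathbb R^d$, with $A_{i\tau}\in\mathbb R^{d\times t}$, each $\phi_{i\tau}:\mathbb R^t\to\mathbb R$ convex, $\frac1\gamma$-smooth and bounded below, and $g:\mathbb R^d\to\mathbb R$ $\lambda$-strongly convex ($\lambda,\gamma>0$). Let $Q$ be a randomized map with $\mathbb E\|x-Q(x)\|^2\le(1-\delta)\|x\|^2$ for all $x$, where $0<\delta<1$. Put $R_m=\max\|A_{i\tau}\|$, $\bar R^2=\max_\tau\frac1m\lambda_{\max}(\sum_iA_{i\tau}A_{i\tau}^\top)$, $R^2=\frac1N\lambda_{\max}(\sum_{\tau,i}A_{i\tau}A_{i\tau}^\top)$. Let $\kappa\ge0$, $\tilde\lambda=\lambda+\kappa$, $q=\lambda/\tilde\lambda$, $\rho_0<\sqrt q$, $P(x^0)>P^*=\min P$, and $\epsilon_k=\frac29(P(x^0)-P^*)(1-\rho_0)^k$. **Outer loop (Catalyst).** $y^0=x^0$, $\alpha_0=\sqrt q$.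 For $k\ge1$, $x^k$ is an approximate minimizer of $G_k(x)=P(x)+\frac\kappa2\|x-y^{k-1}\|^2$ produced as below; $\alpha_k>0$ solves $\alpha_k^2=(1-\alpha_k)\alpha_{k-1}^2+q\alpha_k$, $\beta_k=\frac{\alpha_{k-1}(1-\alpha_{k-1})}{\alpha_{k-1}^2+\alpha_k}$, and $y^k=x^k+\beta_k(x^k-x^{k-1})$. **Inner loop (EC-SDCA on $G_k$).** Let $\xi_k(x)=\frac1{\tilde\lambda}(g(x)+\frac\kappa2\|x-y^{k-1}\|^2)$ and $v(\alpha)=\frac1{\tilde\lambda N}\sum_{\tau,i}A_{i\tau}\alpha_{i\tau}$. Start from the previous dual variables $\alpha^0_{(k)}=\alpha^{k-1}$ (with $\alpha^0=0$), $e^0_\tau=0$, $u^0=v(\alpha^0_{(k)})$. At iteration $K\ge0$ set $x^{K+1}=\nabla\xi_k^*(u^K)$; each node $\tau$ draws $i^\tau$ uniformly in $[m]$ and adds $\Delta\alpha_\tau=-\theta m\,(\alpha^K_{i^\tau\tau}+\nabla\phi_{i^\tau\tau}(A_{i^\tau\tau}^\top x^{K+1}))$ to $\alpha_{i^\tau\tau}$,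 all other dual variables being unchanged; with $z_\tau=\frac1{\tilde\lambda m}A_{i^\tau\tau}\Delta\alpha_\tau+e_\tau^K$ set $e_\tau^{K+1}=z_\tau-Q(z_\tau)$ and $u^{K+1}=u^K+\frac1n\sum_\tau Q(z_\tau)$. All index samples and all calls of $Q$ (over outer iterations, inner iterations and nodes) are independent. With $B=\sqrt{1-\delta}\sqrt{2\bar R^2+\delta R_m^2}$, the stepsize satisfies $c\,\theta_0\le\theta\le\theta_0$ for some $c\in(0,1]$, where $$\frac1{\theta_0}=m+\frac{R_m^2/n+R^2}{\tilde\lambda\gamma}+\frac{4RB}{\delta\tilde\lambda\gamma}+\frac{2B}{\delta\sqrt{\tilde\lambda\gamma}}.$$ **Stopping rule.** Let $D_k(\alpha)=-\frac1N\sum_{\tau,i}\phi_{i\tau}^*(-\alpha_{i\tau})-\tilde\lambda\,\xi_k^*(v(\alpha))$ be the dual objective, $D_k^*=\sup D_k$, $G_k^*=\min G_k$, $\rho=\frac{\delta\tilde\lambda R}{2B}$ (and $\rho=0$ if $B=0$), and $$\Psi_{3,(k)}^K=D_k^*-D_k(\alpha_{(k)}^K)+\frac{2(\rho+\theta\tilde\lambda)}{\delta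 n}\sum_{\tau=1}^n\|e^K_{\tau,(k)}\|^2 .$$ The inner loop is stopped at $$T_k=\inf\{K\ge1:\ \sqrt{4n+\delta mn}\,\Psi_{3,(k)}^K+2(G_k(x_{(k)}^{K+1})-G_k^*)\le\epsilon_k\},$$ and the output is $(x^k,\alpha^k)=(x_{(k)}^{T_k+1},\alpha_{(k)}^{T_k})$. **Claim.** For every $c\in(0,1]$ there is a constant $C>0$ depending only on $c$ (and not on any of the other data) such that for all $k\ge1$ $$\mathbb E[T_k]\le C\Big(\frac1\delta+m+\frac{a_3}{\lambda+\kappa}+\frac{b_3}{\sqrt{\lambda+\kappa}}\Big)\log\Lambda_k ,$$ where $$a_3=\frac{R_m^2}{n\gamma}+\frac{R^2}\gamma+\frac{\sqrt{1-\delta}R\bar R}{\delta\gamma}+\frac{\sqrt{1-\delta}RR_m}{\sqrt\delta\gamma},\qquad b_3=\frac1\delta\sqrt{\frac{(1-\delta)(\bar R^2+\delta R_m^2)}{\gamma}},$$ $$\Lambda_k=2+\frac1\delta+N+\frac{\lambda+\kappa}\lambda+\frac{R^2}{(\lambda+\kappa)\gamma}+\frac1{\sqrt q-\rho_0}+\mathbf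 1_{\{k=1\}}\frac{D_1^*-D_1(0)}{P(x^0)-P^*}.$$ -/

import Mathlib

open MeasureTheory ProbabilityTheory
open scoped ENNReal Gradient

namespace ECCatalyst

noncomputable section

/-- `ℝ^d` with the Euclidean norm. -/
abbrev E (d : ℕ) : Type := EuclideanSpace ℝ (Fin d)

/-- Fenchel conjugate `f^*(u) = sup_x (⟨u, x⟩ - f x)` of a real-valued function; it may be `+∞`. -/
def conj {d : ℕ} (f : E d → ℝ) (u : E d) : EReal :=
  ⨆ x : E d, ((inner ℝ u x - f x : ℝ) : EReal)

/-- Largest (real) eigenvalue of an operator on `ℝ^d`. -/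
def lamMax {d : ℕ} (T : E d →L[ℝ] E d) : ℝ :=
  sSup {c : ℝ | Module.End.HasEigenvalue (T : E d →ₗ[ℝ] E d) c}

/-- `Q` (with an internal random seed `s` of law `ν`) is a contraction compressor
with parameter `del`: `E‖x - Q x‖² ≤ (1 - del) ‖x‖²` for every `x`. -/
structure IsContractionCompressor {d : ℕ} {S : Type*} [MeasurableSpace S] (ν : Measure S)
    (Q : S → E d → E d) (del : ℝ) : Prop where
  measurable : Measurable fun z : S × E d => Q z.1 z.2
  contraction : ∀ x : E d,
    ∫⁻ s, ENNReal.ofReal (‖x - Q s x‖ ^ 2) ∂ν ≤ ENNReal.ofReal ((1 - del) * ‖x‖ ^ 2)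

/-- The data of the problem and the parameters of the method:
`P(x) = (1/N) ∑_τ ∑_i φ_{iτ}(A_{iτ}ᵀ x) + g(x)` with `N = mn`, where `g` is `lam`-strongly convex and
each `φ_{iτ}` is `1/gam`-smooth; `kap` is the Catalyst parameter, `rho0` the rate in the
accuracies, `x0` the starting point; `del` is the compressor parameter, `theta` the stepsize. -/
structure Setup (d t m n : ℕ) where
  A : Fin m → Fin n → (E t →L[ℝ] E d)
  φ : Fin m → Fin n → E t → ℝ
  g : E d → ℝ
  lam : ℝ
  gam : ℝ
  kap : ℝ
  rho0 : ℝ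
  x0 : E d
  del : ℝ
  theta : ℝ

/-- The dual variables `α = (α_{iτ})`. -/
abbrev DualVar (t m n : ℕ) : Type := Fin m → Fin n → E t

/-- The variables of EC-SDCA: `α`, the local errors `e_τ`, and `u`. -/
structure InnerState (d t m n : ℕ) where
  α : DualVar t m n
  e : Fin n → E d
  u : E d

/-- The variables of Catalyst after an outer iteration: `x^k`, `y^k`, `α^k`. -/
structure OuterState (d t m n : ℕ) where
  x : E d
  y : E d
  α : DualVar t m n

/-- The Catalyst sequence: `α_0 = √q`, and `α_k` is the positive root of
`α_k² = (1 - α_k) α_{k-1}² + q α_k`. -/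
def catAlpha (q : ℝ) : ℕ → ℝ
  | 0 => Real.sqrt q
  | k + 1 => ((q - catAlpha q k ^ 2) +
      Real.sqrt ((q - catAlpha q k ^ 2) ^ 2 + 4 * catAlpha q k ^ 2)) / 2

theorem catAlpha_succ_eq (q : ℝ) (k : ℕ) :
    catAlpha q (k + 1) ^ 2 = (1 - catAlpha q (k + 1)) * catAlpha q k ^ 2 + q * catAlpha q (k + 1) := by
  have h : (0 : ℝ) ≤ (q - catAlpha q k ^ 2) ^ 2 + 4 * catAlpha q k ^ 2 := by positivity
  have hs := Real.sq_sqrt h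
  simp only [catAlpha]
  nlinarith [hs]

theorem catAlpha_pos {q : ℝ} (hq : 0 < q) (k : ℕ) : 0 < catAlpha q k := by
  induction k with
  | zero => exact Real.sqrt_pos.2 hq
  | succ k ih =>
    have h2 : |q - catAlpha q k ^ 2| <
        Real.sqrt ((q - catAlpha q k ^ 2) ^ 2 + 4 * catAlpha q k ^ 2) := by
      rw [← Real.sqrt_sq_eq_abs]
      exact Real.sqrt_lt_sqrt (sq_nonneg _) (by nlinarith [sq_pos_of_pos ih])
    have h3 := neg_abs_le (q - catAlpha q k ^ 2)
    simp only [catAlpha]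
    linarith

namespace Setup

variable {d t m n : ℕ} (p : Setup d t m n)

/-- The standing assumptions on `φ` and `g`: every `φ_{iτ}` is convex and `1/gam`-smooth, and `g`
is `lam`-strongly convex. -/
structure Regular : Prop where
  lam_pos : 0 < p.lam
  gam_pos : 0 < p.gam
  φ_convex : ∀ i τ, ConvexOn ℝ Set.univ (p.φ i τ)
  φ_diff : ∀ i τ, Differentiable ℝ (p.φ i τ)
  φ_smooth : ∀ i τ x y, ‖∇ (p.φ i τ) x - ∇ (p.φ i τ) y‖ ≤ (1 / p.gam) * ‖x - y‖
  g_strong : StrongConvexOn Set.univ p.lam p.g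

/-- `N = mn`. -/
def N (_p : Setup d t m n) : ℝ := (m : ℝ) * n

/-- `λ + κ`. -/
def lamK : ℝ := p.lam + p.kap

/-- `q = λ / (λ + κ)`. -/
def q : ℝ := p.lam / p.lamK

/-- The objective `P`. -/
def P (x : E d) : ℝ :=
  (1 / p.N) * ∑ τ, ∑ i, p.φ i τ (ContinuousLinearMap.adjoint (p.A i τ) x) + p.g x

/-- `P^*`. -/
def Pstar : ℝ := ⨅ x, p.P x

/-- The Catalyst subproblem with prox-centre `y`: `G(x) = P(x) + (κ/2) ‖x - y‖²`. -/
def G (y x : E d) : ℝ := p.P x + p.kap / 2 * ‖x - y‖ ^ 2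

/-- The minimum of the subproblem. -/
def Gstar (y : E d) : ℝ := ⨅ x, p.G y x

/-- `R_m = max ‖A_{iτ}‖`. -/
def Rm : ℝ := ⨆ i, ⨆ τ, ‖p.A i τ‖

/-- `R̄`, where `R̄² = max_τ (1/m) λ_max(∑_i A_{iτ} A_{iτ}ᵀ)`. -/
def Rbar : ℝ := Real.sqrt
  (⨆ τ, (1 / (m : ℝ)) * lamMax (∑ i, (p.A i τ) ∘L ContinuousLinearMap.adjoint (p.A i τ)))

/-- `R`, where `R² = (1/N) λ_max(∑_τ ∑_i A_{iτ} A_{iτ}ᵀ)`. -/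
def R : ℝ := Real.sqrt
  ((1 / p.N) * lamMax (∑ τ, ∑ i, (p.A i τ) ∘L ContinuousLinearMap.adjoint (p.A i τ)))

/-- The normalized regularizer of the subproblem, `ξ_k(x) = (g(x) + (κ/2)‖x - y‖²) / (λ + κ)`, which
is `1`-strongly convex; so `G(x) = (1/N) ∑ φ_{iτ}(A_{iτ}ᵀ x) + (λ + κ) ξ_k(x)`. -/
def ξ (y x : E d) : ℝ := (p.g x + p.kap / 2 * ‖x - y‖ ^ 2) / p.lamK

/-- `v(α) = (1/((λ+κ)N)) ∑_τ ∑_i A_{iτ} α_{iτ}`. -/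
def v (α : DualVar t m n) : E d := (1 / (p.lamK * p.N)) • ∑ τ, ∑ i, p.A i τ (α i τ)

/-- The dual objective of the subproblem,
`D(α) = -(1/N) ∑_τ ∑_i φ_{iτ}^*(-α_{iτ}) - (λ+κ) ξ_k^*(v(α))`, with values in `[-∞, ∞)`. -/
def D (y : E d) (α : DualVar t m n) : EReal :=
  -(((1 / p.N : ℝ) : EReal) * ∑ τ, ∑ i, conj (p.φ i τ) (-α i τ))
    - (p.lamK : EReal) * conj (p.ξ y) (p.v α)

/-- The dual suboptimality `ε_D = D^* - D(α)`, with `D^* = sup D`. -/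
def dualGap (y : E d) (α : DualVar t m n) : EReal := (⨆ β, p.D y β) - p.D y α

/-- `√(1-δ) · √(2 R̄² + δ R_m²)`, the size of the compression error. -/
def B : ℝ := Real.sqrt (1 - p.del) * Real.sqrt (2 * p.Rbar ^ 2 + p.del * p.Rm ^ 2)

/-- The weight `ρ = δ (λ+κ) R / (2 √(1-δ) √(2 R̄² + δ R_m²))`. -/
def ρ : ℝ := p.del * p.lamK * p.R / (2 * p.B)

/-- The reference stepsize `θ₀` of EC-SDCA for the subproblem. -/
def theta0 : ℝ :=
  1 / (m + (p.Rm ^ 2 / n + p.R ^ 2) / (p.lamK * p.gam)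
    + 4 * p.R * p.B / (p.del * (p.lamK * p.gam))
    + 2 * p.B / (p.del * Real.sqrt (p.lamK * p.gam)))

/-- The Lyapunov function `Ψ₃ = ε_D + (2(ρ + θ(λ+κ)) / (δ n)) ∑_τ ‖e_τ‖²`. -/
def Ψ₃ (y : E d) (s : InnerState d t m n) : EReal :=
  p.dualGap y s.α +
    ((2 * (p.ρ + p.theta * p.lamK) / (p.del * n) * ∑ τ, ‖s.e τ‖ ^ 2 : ℝ) : EReal)

/-! ### EC-SDCA applied to the subproblem with prox-centre `y` -/

/-- The primal iterate `x^{K+1} = ∇ξ_k^*(u^K)`. -/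
def primal (y u : E d) : E d := ∇ (fun w => (conj (p.ξ y) w).toReal) u

/-- `Δα_{iτ} = -θ p_{iτ}⁻¹ α_{iτ} - θ p_{iτ}⁻¹ ∇φ_{iτ}(A_{iτ}ᵀ x)` with `p_{iτ} = 1/m`. -/
def Δα (x : E d) (α : DualVar t m n) (i : Fin m) (τ : Fin n) : E t :=
  -((p.theta * m) • α i τ)
    - (p.theta * m) • ∇ (p.φ i τ) (ContinuousLinearMap.adjoint (p.A i τ) x)

/-- The vector compressed on node `τ`: `(1/((λ+κ)m)) A_{iτ} Δα_{iτ} + e_τ`. -/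
def message (x : E d) (s : InnerState d t m n) (i : Fin m) (τ : Fin n) : E d :=
  (1 / (p.lamK * m)) • p.A i τ (p.Δα x s.α i τ) + s.e τ

/-- Initialization: given `α^0`, `e_τ^0 = 0`, and `u^0 = v(α^0)`. -/
def innerInit (α : DualVar t m n) : InnerState d t m n := ⟨α, fun _ => 0, p.v α⟩

/-- One iteration; `z τ` is the pair (sampled index, compressor seed) of node `τ`. -/
def innerStep {S : Type*} (Q : S → E d → E d) (y : E d) (z : Fin n → Fin m × S)
    (s : InnerState d t m n) : InnerState d t m n where
  α := fun i τ =>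
    if i = (z τ).1 then s.α i τ + p.Δα (p.primal y s.u) s.α i τ else s.α i τ
  e := fun τ => p.message (p.primal y s.u) s (z τ).1 τ
    - Q (z τ).2 (p.message (p.primal y s.u) s (z τ).1 τ)
  u := s.u + (1 / (n : ℝ)) • ∑ τ, Q (z τ).2 (p.message (p.primal y s.u) s (z τ).1 τ)

/-- The state after `K` iterations, with `z K` the randomness of iteration `K`. -/
def inner {S : Type*} (Q : S → E d → E d) (y : E d) (α : DualVar t m n)
    (z : ℕ → Fin n → Fin m × S) : ℕ → InnerState d t m n
  | 0 => p.innerInit α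
  | K + 1 => p.innerStep Q y (z K) (inner Q y α z K)

/-! ### Catalyst with EC-SDCA as the inner solver -/

/-- `ε_k = (2/9) (P(x^0) - P^*) (1 - ρ_0)^k`. -/
def eps (k : ℕ) : ℝ := 2 / 9 * (p.P p.x0 - p.Pstar) * (1 - p.rho0) ^ k

/-- `β_k = α_{k-1}(1 - α_{k-1}) / (α_{k-1}² + α_k)`, at the index `k + 1`. -/
def beta (k : ℕ) : ℝ :=
  catAlpha p.q k * (1 - catAlpha p.q k) / (catAlpha p.q k ^ 2 + catAlpha p.q (k + 1))

/-- The stopping criterion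
`√(4n + δmn) Ψ₃^K + 2 (G(x^{K+1}) - G^*) ≤ ε` at an inner state. -/
def Stops (y : E d) (ε : ℝ) (s : InnerState d t m n) : Prop :=
  (Real.sqrt (4 * n + p.del * m * n) : EReal) * p.Ψ₃ y s
    + ((2 * (p.G y (p.primal y s.u) - p.Gstar y) : ℝ) : EReal) ≤ (ε : EReal)

/-- The first `K ≥ 1` at which the inner loop stops (`⊤` if it never does). -/
def stopTime {S : Type*} (Q : S → E d → E d) (y : E d) (α : DualVar t m n) (ε : ℝ)
    (z : ℕ → Fin n → Fin m × S) : ℕ∞ :=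
  ⨅ K ∈ {K : ℕ | 1 ≤ K ∧ p.Stops y ε (p.inner Q y α z K)}, (K : ℕ∞)

/-- The outer loop: `z k K τ` is the randomness of node `τ` at inner iteration `K` of outer
iteration `k ≥ 1`. The output of outer iteration `k + 1` is `x^{k+1} = x_{(k+1)}^{T+1}` and
`α^{k+1} = α_{(k+1)}^T`. -/
def outer {S : Type*} (Q : S → E d → E d) (z : ℕ → ℕ → Fin n → Fin m × S) :
    ℕ → OuterState d t m n
  | 0 => ⟨p.x0, p.x0, fun _ _ => 0⟩
  | k + 1 =>
    let o := outer Q z k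
    let T := p.stopTime Q o.y o.α (p.eps (k + 1)) (z (k + 1))
    let s := p.inner Q o.y o.α (z (k + 1)) T.toNat
    let x' := p.primal o.y s.u
    ⟨x', x' + p.beta k • (x' - o.x), s.α⟩

/-- `T_k`, the number of inner iterations of outer iteration `k ≥ 1`. -/
def T {S : Type*} (Q : S → E d → E d) (z : ℕ → ℕ → Fin n → Fin m × S) (k : ℕ) : ℕ∞ :=
  p.stopTime Q (p.outer Q z (k - 1)).y (p.outer Q z (k - 1)).α (p.eps k) (z k)

/-! ### The constants of the bound -/

def a₃ : ℝ :=
  p.Rm ^ 2 / (n * p.gam) + p.R ^ 2 / p.gam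
    + Real.sqrt (1 - p.del) * p.R * p.Rbar / (p.del * p.gam)
    + Real.sqrt (1 - p.del) * p.R * p.Rm / (Real.sqrt p.del * p.gam)

def b₃ : ℝ :=
  1 / p.del * Real.sqrt ((1 - p.del) * (p.Rbar ^ 2 + p.del * p.Rm ^ 2) / p.gam)

/-- The quantity inside the logarithm hidden by `Õ`. The dual suboptimality of the starting point
`α = 0`, relative to `P(x^0) - P^*`, enters only for the first outer iteration. -/
def logArg (k : ℕ) : ℝ :=
  2 + 1 / p.del + p.N + p.lamK / p.lam + p.R ^ 2 / (p.lamK * p.gam)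
    + 1 / (Real.sqrt p.q - p.rho0)
    + if k = 1 then (p.dualGap p.x0 (fun _ _ => 0)).toReal / (p.P p.x0 - p.Pstar) else 0

end Setup

end

end ECCatalyst

/-! Write η = min(θ, δ/4) and L for `logArg k`. The bound rests on a linear contraction of the inner
loop, a comparison of the stopping quantity with the contracted one, and a polynomial bound on the
Lyapunov function at the start of each inner loop.

Contraction (`mean_step_le`, `lintegral_innerStep_le`). Let Φ be the dual gap plus a weighted sum of
the squared errors. The dual step moves the sampled coordinates of α towards -∇φ(Aᵀx). By
Fenchel–Young the mean gain is θ times the duality gap at x (`le_sum_incr`), up to terms in v(α) -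
u, which is the average of the errors. The γ-strong convexity of the conjugates φ* supplies a
negative multiple of the mean square of the increments. The stepsize is small enough that this pays
for the sampling variance, the curvature of ξ* and the noise injected by the compressor. The
compressor itself shrinks the errors, so the conditional mean of Φ falls by the factor 1 - η. Since
samples are independent of the past, E Φ^K ≤ (1-η)^K E Φ^0 in every outer iteration.

From contraction to time (`lintegral_T_le`). If the stopping quantity is at most wΦ and Φ^0 ≤ Mε
almost surely, Markov's inequality at each K bounds the probability of not stopping at K by (w/ε) E
Φ^K ≤ wM(1-η)^K. Summing these tails beyond K0 ≈ log(wM)/η gives E T ≤ (log(wM) + 3)/η. Here w =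
60L⁴/c (`ofReal_stopVal_le`) and M = 150L⁵ (`warm_start`), so the logarithm is of order log L, while
1/η is at most 8/c times the bracket of the claim (`inv_min_le`).

Warm start. Moving the prox-centre from y to y' changes the dual gap into at most the old
primal-dual gap plus κ/2 ‖y' - y‖² (`dual_gap_move`); the primal-dual gap is at most 1 +
2R²/((λ+κ)γ) times the dual gap (`G_sub_Dr_le`), and the latter was below ε/2 at the stop. The
centres are controlled by the accelerated proximal-point potential P(x) - P* + λ/2 ‖x* - v‖², which
decays like (1-ρ0)^k despite the inexact steps (`catalyst_step`, `outer_potential`). This uses that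
all earlier inner loops stopped, which holds almost surely because their expected times are finite;
hence the strong induction in `lintegral_T_le_log`. -/

namespace ECCatalyst

/-! ### Convex analysis: smoothness, strong convexity and conjugates -/

section Convex

variable {d : ℕ}

/-- Along t ↦ x + t v, φ minus the quadratic majorant has nonpositive derivative on (0, 1), by
Cauchy–Schwarz and the Lipschitz gradient. -/
theorem smooth_upper_bound {φ : E d → ℝ} {L : ℝ} (hd : Differentiable ℝ φ)
    (hL : ∀ x y, ‖∇ φ x - ∇ φ y‖ ≤ L * ‖x - y‖) (x v : E d) :
    φ (x + v) ≤ φ x + inner ℝ (∇ φ x) v + L / 2 * ‖v‖ ^ 2 := by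
  set ψ : ℝ → ℝ := fun t => φ (x + t • v) - t * inner ℝ (∇ φ x) v - L / 2 * t ^ 2 * ‖v‖ ^ 2
    with hψ
  have hder : ∀ t, HasDerivAt ψ (inner ℝ (∇ φ (x + t • v)) v - inner ℝ (∇ φ x) v
      - L * t * ‖v‖ ^ 2) t := by
    intro t
    have h1 : HasDerivAt (fun s : ℝ => x + s • v) v t := by
      simpa using ((hasDerivAt_id t).smul_const v).const_add x
    have h2 := (hd (x + t • v)).hasGradientAt.hasFDerivAt.comp_hasDerivAt t h1
    have h3 := (hasDerivAt_id t).mul_const (inner ℝ (∇ φ x) v)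
    have h4 := (((hasDerivAt_id t).pow 2).const_mul (L / 2)).mul_const (‖v‖ ^ 2)
    refine ((h2.sub h3).sub h4).congr_deriv ?_
    simp only [InnerProductSpace.toDual_apply_apply, id]
    push_cast
    ring
  have hanti : AntitoneOn ψ (Set.Icc 0 1) := by
    refine antitoneOn_of_deriv_nonpos (convex_Icc 0 1)
      (fun t _ => (hder t).continuousAt.continuousWithinAt)
      (fun t _ => (hder t).differentiableAt.differentiableWithinAt) ?_
    intro t ht
    rw [interior_Icc] at ht
    rw [(hder t).deriv, ← inner_sub_left]
    have h1 := real_inner_le_norm (∇ φ (x + t • v) - ∇ φ x) v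
    have h2 := hL (x + t • v) x
    rw [add_sub_cancel_left, norm_smul, Real.norm_of_nonneg ht.1.le] at h2
    nlinarith [mul_le_mul_of_nonneg_right h2 (norm_nonneg v)]
  have := hanti (Set.left_mem_Icc.2 zero_le_one) (Set.right_mem_Icc.2 zero_le_one) zero_le_one
  simp only [hψ, one_smul, zero_smul, add_zero] at this
  linarith

theorem convex_lower_bound {φ : E d → ℝ} (hc : ConvexOn ℝ Set.univ φ) (hd : Differentiable ℝ φ)
    (x y : E d) : φ x + inner ℝ (∇ φ x) (y - x) ≤ φ y := by
  have h1 : HasDerivAt (fun s : ℝ => x + s • (y - x)) (y - x) 0 := by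
    simpa using ((hasDerivAt_id (0 : ℝ)).smul_const (y - x)).const_add x
  have h2 := (hd (x + (0 : ℝ) • (y - x))).hasGradientAt.hasFDerivAt.comp_hasDerivAt 0 h1
  have h3 : ConvexOn ℝ Set.univ (φ ∘ fun s : ℝ => x + s • (y - x)) := by
    refine ⟨convex_univ, fun a _ b _ s t hs ht hst => ?_⟩
    have h := hc.2 (Set.mem_univ (x + a • (y - x))) (Set.mem_univ (x + b • (y - x))) hs ht hst
    have e : s • (x + a • (y - x)) + t • (x + b • (y - x))
        = x + (s • a + t • b) • (y - x) := by
      obtain rfl := eq_sub_of_add_eq hst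
      module
    rw [e] at h
    simpa only [Function.comp] using h
  have h4 := h3.le_slope_of_hasDerivAt (Set.mem_univ 0) (Set.mem_univ 1) zero_lt_one h2
  simp only [InnerProductSpace.toDual_apply_apply, zero_smul, add_zero, slope_def_field,
    Function.comp, one_smul, sub_zero, div_one, add_sub_cancel] at h4
  linarith

theorem conj_le {f : E d → ℝ} {u : E d} {c : ℝ} (h : ∀ x, inner ℝ u x - f x ≤ c) :
    conj f u ≤ c :=
  iSup_le fun x => EReal.coe_le_coe_iff.2 (h x)

theorem le_conj (f : E d → ℝ) (u x : E d) : ((inner ℝ u x - f x : ℝ) : EReal) ≤ conj f u :=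
  le_iSup (fun x : E d => ((inner ℝ u x - f x : ℝ) : EReal)) x

theorem conj_ne_bot (f : E d → ℝ) (u : E d) : conj f u ≠ ⊥ :=
  ne_bot_of_le_ne_bot (EReal.coe_ne_bot _) (le_conj f u 0)

theorem conj_ne_top {f : E d → ℝ} {u : E d} {c : ℝ} (h : ∀ x, inner ℝ u x - f x ≤ c) :
    conj f u ≠ ⊤ :=
  ne_top_of_le_ne_top (EReal.coe_ne_top _) (conj_le h)

theorem coe_toReal_conj {f : E d → ℝ} {u : E d} (h : conj f u ≠ ⊤) :
    (((conj f u).toReal : ℝ) : EReal) = conj f u :=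
  EReal.coe_toReal h (conj_ne_bot f u)

theorem le_toReal_conj {f : E d → ℝ} {u : E d} (h : conj f u ≠ ⊤) (x : E d) :
    inner ℝ u x - f x ≤ (conj f u).toReal := by
  rw [← EReal.coe_le_coe_iff, coe_toReal_conj h]
  exact le_conj f u x

theorem toReal_conj_le {f : E d → ℝ} {u : E d} {c : ℝ} (h : ∀ x, inner ℝ u x - f x ≤ c) :
    (conj f u).toReal ≤ c := by
  rw [← EReal.coe_le_coe_iff, coe_toReal_conj (conj_ne_top h)]
  exact conj_le h

theorem toReal_conj_eq {f : E d → ℝ} {u x : E d}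
    (h : ∀ x', inner ℝ u x' - f x' ≤ inner ℝ u x - f x) :
    (conj f u).toReal = inner ℝ u x - f x :=
  le_antisymm (toReal_conj_le h) (le_toReal_conj (conj_ne_top h) x)

theorem inner_gradient_sub_le {φ : E d → ℝ} (hc : ConvexOn ℝ Set.univ φ)
    (hd : Differentiable ℝ φ) (x x' : E d) :
    inner ℝ (∇ φ x) x' - φ x' ≤ inner ℝ (∇ φ x) x - φ x := by
  have := convex_lower_bound hc hd x x'
  rw [inner_sub_right] at this
  linarith

/-- The conjugate of a `1/γ`-smooth function is `γ`-strongly convex. -/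
theorem conj_segment_le {φ : E d → ℝ} {γ : ℝ} (hγ : 0 < γ) (hd : Differentiable ℝ φ)
    (hL : ∀ x y, ‖∇ φ x - ∇ φ y‖ ≤ (1 / γ) * ‖x - y‖) {a b : E d} (ha : conj φ a ≠ ⊤)
    (hb : conj φ b ≠ ⊤) {s : ℝ} (hs0 : 0 ≤ s) (hs1 : s ≤ 1) (x : E d) :
    inner ℝ (a + s • (b - a)) x - φ x ≤ (1 - s) * (conj φ a).toReal + s * (conj φ b).toReal
      - γ / 2 * (s * (1 - s)) * ‖b - a‖ ^ 2 := by
  -- The conjugates at a and b are tested at two shifts of x along b - a. The shifts have weighted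
  -- mean x, and their lengths optimise the quadratic upper bounds on φ, which yields the modulus γ.
  have h1 := le_toReal_conj ha (x + (-(s * γ)) • (b - a))
  have h2 := le_toReal_conj hb (x + ((1 - s) * γ) • (b - a))
  have h3 := smooth_upper_bound hd hL x ((-(s * γ)) • (b - a))
  have h4 := smooth_upper_bound hd hL x (((1 - s) * γ) • (b - a))
  simp only [inner_add_right, inner_add_left, inner_smul_right, norm_smul, mul_pow,
    Real.norm_eq_abs, sq_abs, real_inner_smul_left] at h1 h2 h3 h4 ⊢
  have h5 : ‖b - a‖ ^ 2 = inner ℝ b (b - a) - inner ℝ a (b - a) := by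
    rw [← inner_sub_left, real_inner_self_eq_norm_sq]
  have h6 : inner ℝ (b - a) x = inner ℝ b x - inner ℝ a x := inner_sub_left _ _ _
  have h7 : 1 / γ / 2 * ((-(s * γ)) ^ 2 * ‖b - a‖ ^ 2) = γ / 2 * s ^ 2 * ‖b - a‖ ^ 2 := by
    field_simp
  have h8 : 1 / γ / 2 * ((1 - s) ^ 2 * γ ^ 2 * ‖b - a‖ ^ 2)
      = γ / 2 * (1 - s) ^ 2 * ‖b - a‖ ^ 2 := by
    field_simp
  rw [h7] at h3
  rw [h8] at h4
  have hA := mul_le_mul_of_nonneg_left (h1.trans' (sub_le_sub_left h3 _)) (sub_nonneg.2 hs1)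
  have hB := mul_le_mul_of_nonneg_left (h2.trans' (sub_le_sub_left h4 _)) hs0
  have h9 : s * (1 - s) * γ * ‖b - a‖ ^ 2
      = s * (1 - s) * γ * (inner ℝ b (b - a) - inner ℝ a (b - a)) := by rw [h5]
  rw [h6]
  linarith

theorem strongConvexOn_le {f : E d → ℝ} {μ : ℝ} (hf : StrongConvexOn Set.univ μ f) (x y : E d)
    {t : ℝ} (h0 : 0 ≤ t) (h1 : t ≤ 1) :
    f ((1 - t) • x + t • y) ≤ (1 - t) * f x + t * f y - (1 - t) * t * (μ / 2 * ‖x - y‖ ^ 2) := by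
  simpa using hf.2 (Set.mem_univ x) (Set.mem_univ y) (sub_nonneg.2 h1) h0 (by ring)

theorem strongConvexOn_continuous {f : E d → ℝ} {μ : ℝ} (hμ : 0 ≤ μ)
    (hf : StrongConvexOn Set.univ μ f) : Continuous f := by
  have h : ConvexOn ℝ Set.univ f := strongConvexOn_zero.1 (hf.mono hμ)
  rw [← continuousOn_univ]
  exact h.continuousOn isOpen_univ

theorem strongConvexOn_growth {f : E d → ℝ} {μ : ℝ} (hf : StrongConvexOn Set.univ μ f)
    {x : E d} (hx : ∀ y, f x ≤ f y) (y : E d) : f x + μ / 2 * ‖y - x‖ ^ 2 ≤ f y := by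
  by_contra! h
  set c := μ / 2 * ‖y - x‖ ^ 2 with hc
  have h0 : 0 ≤ f y - f x := sub_nonneg.2 (hx y)
  have hc0 : 0 < c := by linarith
  -- Letting t → 0 on the segment would give the growth; one t with tc equal to half the supposed
  -- deficit already contradicts minimality.
  set t := (c - (f y - f x)) / (2 * c) with ht
  have ht0 : 0 < t := by apply div_pos <;> linarith
  have ht1 : t ≤ 1 := by rw [ht, div_le_one (by linarith)]; linarith
  have htc : t * c = (c - (f y - f x)) / 2 := by rw [ht]; field_simp
  have h1 := strongConvexOn_le hf x y ht0.le ht1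
  rw [norm_sub_rev, ← hc] at h1
  have h2 := (hx _).trans h1
  have h3 : t * ((1 - t) * c) ≤ t * (f y - f x) := by linarith
  have h4 := le_of_mul_le_mul_left h3 ht0
  linarith

/-- Coercivity: strong convexity on the segment from 0 to x, evaluated at x/‖x‖ where |f| is bounded
by compactness of the sphere, forces f x ≥ f 0 once ‖x‖ is large. -/
theorem strongConvexOn_exists_min {f : E d → ℝ} {μ : ℝ} (hμ : 0 < μ)
    (hf : StrongConvexOn Set.univ μ f) : ∃ x, ∀ y, f x ≤ f y := by
  have hcont := strongConvexOn_continuous hμ.le hf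
  obtain ⟨C, hC⟩ := (isCompact_sphere (0 : E d) 1).exists_bound_of_continuousOn hcont.continuousOn
  refine hcont.exists_forall_le' 0 ?_
  have h1 : ∀ᶠ x : E d in Filter.cocompact (E d), max 1 (1 + 2 * (C + f 0) / μ) ≤ ‖x‖ :=
    (tendsto_norm_cocompact_atTop (E := E d)).eventually_ge_atTop _
  filter_upwards [h1] with x hx
  have hr1 : 1 ≤ ‖x‖ := (le_max_left _ _).trans hx
  have hr2 : 2 * (C + f 0) / μ ≤ ‖x‖ - 1 := by have := (le_max_right _ _).trans hx; linarith
  rw [div_le_iff₀ hμ] at hr2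
  have hr0 : 0 < ‖x‖ := by linarith
  have h2 := strongConvexOn_le hf 0 x (t := ‖x‖⁻¹) (by positivity) (inv_le_one_of_one_le₀ hr1)
  have h3 := hC (‖x‖⁻¹ • x) (by simp [norm_smul, hr0.ne'])
  rw [Real.norm_eq_abs] at h3
  have h4 := (abs_le.1 h3).1
  rw [smul_zero, zero_add, zero_sub, norm_neg] at h2
  have h5 := mul_le_mul_of_nonneg_left (h4.trans h2) hr0.le
  have h6 : ‖x‖ * ((1 - ‖x‖⁻¹) * f 0 + ‖x‖⁻¹ * f x - (1 - ‖x‖⁻¹) * ‖x‖⁻¹ * (μ / 2 * ‖x‖ ^ 2))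
      = (‖x‖ - 1) * f 0 + f x - (‖x‖ - 1) * (μ / 2 * ‖x‖) := by
    field_simp
  rw [h6] at h5
  nlinarith

theorem strongConvexOn_sub_inner {f : E d → ℝ} {μ : ℝ} (hf : StrongConvexOn Set.univ μ f)
    (u : E d) : StrongConvexOn Set.univ μ fun x => f x - inner ℝ u x := by
  refine ⟨convex_univ, fun x _ y _ a b ha hb hab => ?_⟩
  have := hf.2 (Set.mem_univ x) (Set.mem_univ y) ha hb hab
  simp only [inner_add_right, inner_smul_right, smul_eq_mul] at this ⊢
  linarith

/-- A conjugate maximizer, with quadratic growth, for a `1`-strongly convex function. -/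
theorem exists_conj_argmax {f : E d → ℝ} (hf : StrongConvexOn Set.univ 1 f) (u : E d) :
    ∃ x, ∀ y, inner ℝ u y - f y + 1 / 2 * ‖y - x‖ ^ 2 ≤ inner ℝ u x - f x := by
  have h := strongConvexOn_sub_inner hf u
  obtain ⟨x, hx⟩ := strongConvexOn_exists_min one_pos h
  refine ⟨x, fun y => ?_⟩
  have := strongConvexOn_growth h hx y
  linarith

/-- The gradient of the conjugate at u is the maximiser X u of ⟨u, ·⟩ - f. Optimality at w gives 0 ≤
f*(w) - f*(u) - ⟨X u, w - u⟩, and quadratic growth at u bounds this by ½‖w - u‖², so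
differentiability needs no continuity of X. -/
theorem gradient_conj_spec {f : E d → ℝ} (hf : StrongConvexOn Set.univ 1 f) (u y : E d) :
    inner ℝ u y - f y + 1 / 2 * ‖y - ∇ (fun w => (conj f w).toReal) u‖ ^ 2
      ≤ inner ℝ u (∇ (fun w => (conj f w).toReal) u) - f (∇ (fun w => (conj f w).toReal) u) := by
  choose X hX using exists_conj_argmax hf
  have hmax : ∀ u y, inner ℝ u y - f y ≤ inner ℝ u (X u) - f (X u) := fun u y => by
    have := hX u y
    have : (0 : ℝ) ≤ 1 / 2 * ‖y - X u‖ ^ 2 := by positivity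
    linarith
  have heq : ∀ u, (conj f u).toReal = inner ℝ u (X u) - f (X u) := fun u => toReal_conj_eq (hmax u)
  have hg : HasGradientAt (fun w => (conj f w).toReal) (X u) u := by
    rw [hasGradientAt_iff_isLittleO, Asymptotics.isLittleO_iff]
    intro c hc
    filter_upwards [Metric.ball_mem_nhds u hc] with w hw
    rw [Metric.mem_ball, dist_eq_norm] at hw
    rw [heq, heq, Real.norm_eq_abs, abs_le]
    have h1 := hmax w (X u)
    have h2 := hX u (X w)
    have h3 : inner ℝ (X u) (w - u) = inner ℝ w (X u) - inner ℝ u (X u) := by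
      rw [inner_sub_right, real_inner_comm, real_inner_comm (X u) u]
    have h4 : inner ℝ (w - u) (X w - X u) = inner ℝ w (X w) - inner ℝ u (X w)
        - inner ℝ w (X u) + inner ℝ u (X u) := by
      rw [inner_sub_left, inner_sub_right, inner_sub_right]; ring
    have h5 := real_inner_le_norm (w - u) (X w - X u)
    have h6 : 0 ≤ c * ‖w - u‖ := by positivity
    have h7 : ‖w - u‖ * ‖w - u‖ ≤ c * ‖w - u‖ :=
      mul_le_mul_of_nonneg_right hw.le (norm_nonneg _)
    constructor <;> nlinarith [sq_nonneg (‖w - u‖ - ‖X w - X u‖)]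
  rw [hg.gradient]
  exact hX u y

end Convex

end ECCatalyst

namespace ECCatalyst

/-! ### Largest eigenvalues and the constants R, R̄, R_m -/

section LamMax

variable {d t : ℕ}

theorem inner_le_lamMax {T : E d →L[ℝ] E d} (hT : (T : E d →ₗ[ℝ] E d).IsSymmetric) (y : E d) :
    inner ℝ (T y) y ≤ lamMax T * ‖y‖ ^ 2 := by
  have hn : Module.finrank ℝ (E d) = d := finrank_euclideanSpace_fin
  set b := hT.eigenvectorBasis hn
  have h1 : ∀ i, hT.eigenvalues hn i ≤ lamMax T := fun i =>
    le_csSup (Module.End.finite_hasEigenvalue (T : E d →ₗ[ℝ] E d)).bddAbove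
      (hT.hasEigenvalue_eigenvalues hn i)
  rw [← b.sum_inner_mul_inner (T y) y, ← b.sum_sq_norm_inner_right y, Finset.mul_sum]
  refine Finset.sum_le_sum fun i _ => ?_
  have h2 : inner ℝ (T y) (b i) = hT.eigenvalues hn i * inner ℝ (b i) y := by
    have h3 := hT y (b i)
    have h4 := hT.apply_eigenvectorBasis hn i
    simp only [ContinuousLinearMap.coe_coe] at h3 h4
    rw [h3, h4, inner_smul_right, real_inner_comm]
    rfl
  rw [h2, mul_assoc, Real.norm_eq_abs, sq_abs, ← sq]
  exact mul_le_mul_of_nonneg_right (h1 i) (sq_nonneg _)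

/-- Only eigenvectors need testing. The sign condition on c covers an empty set of eigenvalues,
whose real supremum is 0 by default. -/
theorem lamMax_le {T : E d →L[ℝ] E d} {c : ℝ} (hc : 0 ≤ c)
    (h : ∀ y, inner ℝ (T y) y ≤ c * ‖y‖ ^ 2) : lamMax T ≤ c := by
  refine Real.sSup_le (fun a ha => ?_) hc
  obtain ⟨y, hy⟩ := ha.exists_hasEigenvector
  have h1 := h y
  have h2 : T y = a • y := hy.apply_eq_smul
  rw [h2, real_inner_smul_left, real_inner_self_eq_norm_sq] at h1
  exact le_of_mul_le_mul_right h1 (by have := norm_pos_iff.2 hy.2; positivity)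

variable {ι : Type*} [Fintype ι] (A : ι → (E t →L[ℝ] E d))

theorem inner_sum_comp_adjoint (x y : E d) :
    inner ℝ ((∑ i, (A i) ∘L ContinuousLinearMap.adjoint (A i)) x) y
      = ∑ i, inner ℝ (ContinuousLinearMap.adjoint (A i) x)
          (ContinuousLinearMap.adjoint (A i) y) := by
  simp [sum_inner, ContinuousLinearMap.adjoint_inner_right]

theorem isSymmetric_sum_comp_adjoint :
    ((∑ i, (A i) ∘L ContinuousLinearMap.adjoint (A i) : E d →L[ℝ] E d) :
      E d →ₗ[ℝ] E d).IsSymmetric := by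
  intro x y
  have h1 := inner_sum_comp_adjoint A x y
  have h2 := inner_sum_comp_adjoint A y x
  rw [ContinuousLinearMap.coe_coe, h1, real_inner_comm, h2]
  exact Finset.sum_congr rfl fun i _ => real_inner_comm _ _

theorem sum_norm_adjoint_sq (y : E d) :
    ∑ i, ‖ContinuousLinearMap.adjoint (A i) y‖ ^ 2
      = inner ℝ ((∑ i, (A i) ∘L ContinuousLinearMap.adjoint (A i)) y) y := by
  simp_rw [inner_sum_comp_adjoint, real_inner_self_eq_norm_sq]

theorem sum_norm_adjoint_sq_le (y : E d) :
    ∑ i, ‖ContinuousLinearMap.adjoint (A i) y‖ ^ 2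
      ≤ lamMax (∑ i, (A i) ∘L ContinuousLinearMap.adjoint (A i)) * ‖y‖ ^ 2 := by
  rw [sum_norm_adjoint_sq]
  exact inner_le_lamMax (isSymmetric_sum_comp_adjoint A) y

theorem lamMax_sum_nonneg : 0 ≤ lamMax (∑ i, (A i) ∘L ContinuousLinearMap.adjoint (A i)) := by
  refine Real.sSup_nonneg fun a ha => ?_
  obtain ⟨y, hy⟩ := ha.exists_hasEigenvector
  have h2 : (∑ i, (A i) ∘L ContinuousLinearMap.adjoint (A i)) y = a • y := hy.apply_eq_smul
  have h1 := sum_norm_adjoint_sq A y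
  rw [h2, real_inner_smul_left, real_inner_self_eq_norm_sq] at h1
  have h3 : 0 ≤ a * ‖y‖ ^ 2 := h1 ▸ Finset.sum_nonneg fun i _ => sq_nonneg _
  have := norm_pos_iff.2 hy.2
  exact nonneg_of_mul_nonneg_left h3 (by positivity)

/-- The adjoint of β ↦ ∑ A_i β_i is y ↦ (A_iᵀ y)_i, whose squared norm the eigenvalue controls.
Pairing y = ∑ A_i β_i with itself and applying Cauchy–Schwarz transfers the bound. -/
theorem norm_sum_apply_sq_le (β : ι → E t) :
    ‖∑ i, A i (β i)‖ ^ 2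
      ≤ lamMax (∑ i, (A i) ∘L ContinuousLinearMap.adjoint (A i)) * ∑ i, ‖β i‖ ^ 2 := by
  set y := ∑ i, A i (β i) with hy
  set l := lamMax (∑ i, (A i) ∘L ContinuousLinearMap.adjoint (A i)) with hl
  have h1 : ‖y‖ ^ 2 = ∑ i, inner ℝ (ContinuousLinearMap.adjoint (A i) y) (β i) := by
    simp_rw [ContinuousLinearMap.adjoint_inner_left]
    rw [← inner_sum, ← hy, real_inner_self_eq_norm_sq]
  have h2 : ‖y‖ ^ 2 ≤ ∑ i, ‖ContinuousLinearMap.adjoint (A i) y‖ * ‖β i‖ :=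
    h1 ▸ Finset.sum_le_sum fun i _ => real_inner_le_norm _ _
  have h3 := Finset.sum_mul_sq_le_sq_mul_sq Finset.univ
    (fun i => ‖ContinuousLinearMap.adjoint (A i) y‖) (fun i => ‖β i‖)
  have h4 := sum_norm_adjoint_sq_le A y
  rw [← hl] at h4
  have h5 : 0 ≤ ∑ i, ‖β i‖ ^ 2 := Finset.sum_nonneg fun i _ => sq_nonneg _
  have h6 : (‖y‖ ^ 2) ^ 2 ≤ (l * ∑ i, ‖β i‖ ^ 2) * ‖y‖ ^ 2 := by
    have h7 := pow_le_pow_left₀ (sq_nonneg ‖y‖) h2 2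
    have h8 := mul_le_mul_of_nonneg_right h4 h5
    linarith
  rcases (sq_nonneg ‖y‖).eq_or_lt with h0 | h0
  · rw [← h0]
    exact mul_nonneg (lamMax_sum_nonneg A) h5
  · rw [sq (‖y‖ ^ 2)] at h6
    exact le_of_mul_le_mul_right h6 h0

end LamMax

namespace Setup

variable {d t m n : ℕ} (p : Setup d t m n)

theorem N_pos (hm : 0 < m) (hn : 0 < n) : 0 < p.N := by
  unfold N
  positivity

theorem sum_sum_eq_sum_prod :
    ∑ τ, ∑ i, (p.A i τ) ∘L ContinuousLinearMap.adjoint (p.A i τ)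
      = ∑ j : Fin n × Fin m, (p.A j.2 j.1) ∘L ContinuousLinearMap.adjoint (p.A j.2 j.1) :=
  (Fintype.sum_prod_type' fun τ i =>
    (p.A i τ) ∘L ContinuousLinearMap.adjoint (p.A i τ)).symm

theorem R_nonneg : 0 ≤ p.R := Real.sqrt_nonneg _

theorem Rbar_nonneg : 0 ≤ p.Rbar := Real.sqrt_nonneg _

theorem B_nonneg : 0 ≤ p.B := mul_nonneg (Real.sqrt_nonneg _) (Real.sqrt_nonneg _)

theorem Rm_nonneg : 0 ≤ p.Rm :=
  Real.iSup_nonneg fun _ => Real.iSup_nonneg fun _ => norm_nonneg _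

theorem norm_A_le_Rm (i : Fin m) (τ : Fin n) : ‖p.A i τ‖ ≤ p.Rm :=
  (le_ciSup (f := fun τ => ‖p.A i τ‖) (Set.finite_range _).bddAbove τ).trans
    (le_ciSup (f := fun i => ⨆ τ, ‖p.A i τ‖) (Set.finite_range _).bddAbove i)

theorem N_mul_R_sq (hm : 0 < m) (hn : 0 < n) :
    p.N * p.R ^ 2 = lamMax (∑ τ, ∑ i, (p.A i τ) ∘L ContinuousLinearMap.adjoint (p.A i τ)) := by
  have hN := p.N_pos hm hn
  rw [R, Real.sq_sqrt]
  · field_simp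
  · rw [sum_sum_eq_sum_prod]
    exact mul_nonneg (by positivity) (lamMax_sum_nonneg _)

theorem norm_sum_A_sq_le (hm : 0 < m) (hn : 0 < n) (β : DualVar t m n) :
    ‖∑ τ, ∑ i, p.A i τ (β i τ)‖ ^ 2 ≤ p.N * p.R ^ 2 * ∑ τ, ∑ i, ‖β i τ‖ ^ 2 := by
  have h := norm_sum_apply_sq_le (fun j : Fin n × Fin m => p.A j.2 j.1) fun j => β j.2 j.1
  rw [N_mul_R_sq p hm hn, sum_sum_eq_sum_prod]
  simpa only [Fintype.sum_prod_type] using h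

theorem sum_norm_adjoint_A_sq_le (hm : 0 < m) (hn : 0 < n) (y : E d) :
    ∑ τ, ∑ i, ‖ContinuousLinearMap.adjoint (p.A i τ) y‖ ^ 2 ≤ p.N * p.R ^ 2 * ‖y‖ ^ 2 := by
  have h := sum_norm_adjoint_sq_le (fun j : Fin n × Fin m => p.A j.2 j.1) y
  rw [N_mul_R_sq p hm hn, sum_sum_eq_sum_prod]
  simpa only [Fintype.sum_prod_type] using h

theorem norm_sum_node_sq_le (hm : 0 < m) (τ : Fin n) (β : Fin m → E t) :
    ‖∑ i, p.A i τ (β i)‖ ^ 2 ≤ m * p.Rbar ^ 2 * ∑ i, ‖β i‖ ^ 2 := by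
  refine (norm_sum_apply_sq_le (fun i => p.A i τ) β).trans
    (mul_le_mul_of_nonneg_right ?_ (Finset.sum_nonneg fun i _ => sq_nonneg _))
  have hm' : (0 : ℝ) < m := by exact_mod_cast hm
  rw [Rbar, Real.sq_sqrt]
  · have := le_ciSup (f := fun τ => (1 / (m : ℝ)) *
      lamMax (∑ i, (p.A i τ) ∘L ContinuousLinearMap.adjoint (p.A i τ)))
      (Set.finite_range _).bddAbove τ
    calc _ = m * ((1 / (m : ℝ)) *
        lamMax (∑ i, (p.A i τ) ∘L ContinuousLinearMap.adjoint (p.A i τ))) := by field_simp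
      _ ≤ _ := mul_le_mul_of_nonneg_left this hm'.le
  · exact Real.iSup_nonneg fun τ => mul_nonneg (by positivity) (lamMax_sum_nonneg _)

theorem norm_adjoint_A_le_Rm (i : Fin m) (τ : Fin n) (y : E d) :
    ‖ContinuousLinearMap.adjoint (p.A i τ) y‖ ≤ p.Rm * ‖y‖ := by
  refine (ContinuousLinearMap.le_opNorm _ _).trans
    (mul_le_mul_of_nonneg_right ?_ (norm_nonneg _))
  rw [LinearIsometryEquiv.norm_map]
  exact p.norm_A_le_Rm i τ

theorem norm_A_apply_le_Rm (i : Fin m) (τ : Fin n) (y : E t) : ‖p.A i τ y‖ ≤ p.Rm * ‖y‖ :=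
  (ContinuousLinearMap.le_opNorm _ _).trans
    (mul_le_mul_of_nonneg_right (p.norm_A_le_Rm i τ) (norm_nonneg _))

theorem Rbar_le_Rm (hm : 0 < m) : p.Rbar ≤ p.Rm := by
  rw [Rbar]
  refine Real.sqrt_le_iff.2 ⟨p.Rm_nonneg, Real.iSup_le (fun τ => ?_) (sq_nonneg _)⟩
  have hm' : (0 : ℝ) < m := by exact_mod_cast hm
  rw [one_div, inv_mul_le_iff₀ hm']
  refine lamMax_le (by positivity) fun y => ?_
  rw [← sum_norm_adjoint_sq (fun i => p.A i τ) y]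
  calc _ ≤ ∑ _i : Fin m, (p.Rm * ‖y‖) ^ 2 := Finset.sum_le_sum fun i _ =>
        pow_le_pow_left₀ (norm_nonneg _) (p.norm_adjoint_A_le_Rm i τ y) 2
    _ = _ := by simp; ring

/-- A single summand ‖A_{iτ}ᵀ y‖² is at most the whole sum. The loss of the factor N is harmless,
because the bound enters only inside the logarithm. -/
theorem Rm_sq_le (hm : 0 < m) (hn : 0 < n) : p.Rm ^ 2 ≤ p.N * p.R ^ 2 := by
  have hN := p.N_pos hm hn
  have hle : p.Rm ≤ Real.sqrt (p.N * p.R ^ 2) := by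
    refine Real.iSup_le (fun i => Real.iSup_le (fun τ => ?_) (Real.sqrt_nonneg _))
      (Real.sqrt_nonneg _)
    rw [← LinearIsometryEquiv.norm_map ContinuousLinearMap.adjoint]
    refine ContinuousLinearMap.opNorm_le_bound _ (Real.sqrt_nonneg _) fun y => ?_
    refine abs_le_of_sq_le_sq' ?_ (by positivity) |>.2
    rw [mul_pow, Real.sq_sqrt (by positivity)]
    refine le_trans ?_ (p.sum_norm_adjoint_A_sq_le hm hn y)
    exact (Finset.single_le_sum (f := fun i => ‖ContinuousLinearMap.adjoint (p.A i τ) y‖ ^ 2)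
      (fun _ _ => sq_nonneg _) (Finset.mem_univ i)).trans
      (Finset.single_le_sum
        (f := fun τ => ∑ i, ‖ContinuousLinearMap.adjoint (p.A i τ) y‖ ^ 2)
        (fun _ _ => Finset.sum_nonneg fun _ _ => sq_nonneg _) (Finset.mem_univ τ))
  calc p.Rm ^ 2 ≤ Real.sqrt (p.N * p.R ^ 2) ^ 2 := pow_le_pow_left₀ p.Rm_nonneg hle 2
    _ = _ := Real.sq_sqrt (by positivity)

end Setup

end ECCatalyst

/-! ### Duality for the Catalyst subproblem -/

namespace ECCatalyst

theorem norm_segment_sq {d : ℕ} (x z y : E d) {a b : ℝ} (hab : a + b = 1) :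
    ‖a • x + b • z - y‖ ^ 2 = a * ‖x - y‖ ^ 2 + b * ‖z - y‖ ^ 2 - a * b * ‖x - z‖ ^ 2 := by
  have e : a • x + b • z - y = a • (x - y) + b • (z - y) := by
    obtain rfl := eq_sub_of_add_eq hab
    module
  have e2 : x - z = (x - y) - (z - y) := by abel
  rw [e, e2]
  generalize x - y = v, z - y = w
  rw [norm_add_sq_real, norm_sub_sq_real, norm_smul, norm_smul, real_inner_smul_left,
    real_inner_smul_right, mul_pow, mul_pow, Real.norm_eq_abs, Real.norm_eq_abs, sq_abs, sq_abs]
  obtain rfl := eq_sub_of_add_eq hab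
  ring

theorem coe_sum_ereal {ι : Type*} (s : Finset ι) (f : ι → ℝ) :
    ((∑ j ∈ s, f j : ℝ) : EReal) = ∑ j ∈ s, (f j : EReal) := by
  classical
  induction s using Finset.induction_on with
  | empty => simp
  | insert a s ha ih => rw [Finset.sum_insert ha, Finset.sum_insert ha, EReal.coe_add, ih]

namespace Setup

noncomputable section

variable {d t m n : ℕ} (p : Setup d t m n)

/-- The conjugate of the regularizer, as a real number. -/
def ξc (y u : E d) : ℝ := (conj (p.ξ y) u).toReal

/-- The conjugates of the losses, as real numbers. -/
def φc (i : Fin m) (τ : Fin n) (a : E t) : ℝ := (conj (p.φ i τ) a).toReal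

/-- The dual point `-∇φ(Aᵀx)` attached to a primal point. -/
def dualPt (x : E d) : DualVar t m n :=
  fun i τ => -∇ (p.φ i τ) (ContinuousLinearMap.adjoint (p.A i τ) x)

/-- Dual points at which the dual objective is finite. -/
def Feas (α : DualVar t m n) : Prop := ∀ i τ, conj (p.φ i τ) (-α i τ) ≠ ⊤

/-- The dual objective as a real number. -/
def Dr (y : E d) (α : DualVar t m n) : ℝ :=
  -((1 / p.N) * ∑ τ, ∑ i, p.φc i τ (-α i τ)) - p.lamK * p.ξc y (p.v α)

/-- The dual optimal value as a real number. -/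
def Dstar (y : E d) : ℝ := (⨆ β, p.D y β).toReal

/-- The mean of `‖w - α‖²`. -/
def meanSq (x : E d) (α : DualVar t m n) : ℝ :=
  (1 / p.N) * ∑ τ, ∑ i, ‖p.dualPt x i τ - α i τ‖ ^ 2

/-- The first-order increments of the dual objective. -/
def incr (y x : E d) (α : DualVar t m n) (i : Fin m) (τ : Fin n) : ℝ :=
  p.φc i τ (-α i τ) - p.φc i τ (-p.dualPt x i τ)
    - Inner.inner ℝ (p.A i τ (p.dualPt x i τ - α i τ)) (p.primal y (p.v α))

theorem meanSq_nonneg (x : E d) (α : DualVar t m n) : 0 ≤ p.meanSq x α := by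
  unfold meanSq N
  positivity

theorem lamK_mul_inner_v (hl : 0 < p.lamK) (α : DualVar t m n) (x : E d) :
    p.lamK * Inner.inner ℝ (p.v α) x = (1 / p.N) * ∑ τ, ∑ i, Inner.inner ℝ (p.A i τ (α i τ)) x := by
  simp_rw [v, real_inner_smul_left, sum_inner]
  field_simp

theorem v_add (α β : DualVar t m n) : p.v (α + β) = p.v α + p.v β := by
  simp [v, Finset.sum_add_distrib]

theorem v_sub (α β : DualVar t m n) : p.v (α - β) = p.v α - p.v β := by
  simp [v, Finset.sum_sub_distrib, smul_sub]

theorem norm_v_sq_le (hm : 0 < m) (hn : 0 < n) (hl : 0 < p.lamK) (β : DualVar t m n) :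
    ‖p.v β‖ ^ 2 ≤ p.R ^ 2 / p.lamK ^ 2 * ((1 / p.N) * ∑ τ, ∑ i, ‖β i τ‖ ^ 2) := by
  have hN := p.N_pos hm hn
  have h := p.norm_sum_A_sq_le hm hn β
  rw [v, norm_smul, mul_pow, Real.norm_eq_abs, sq_abs]
  calc _ ≤ (1 / (p.lamK * p.N)) ^ 2 * (p.N * p.R ^ 2 * ∑ τ, ∑ i, ‖β i τ‖ ^ 2) :=
        mul_le_mul_of_nonneg_left h (sq_nonneg _)
    _ = _ := by field_simp

theorem norm_v_dualPt_sub_sq_le (hm : 0 < m) (hn : 0 < n) (hl : 0 < p.lamK) (x : E d)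
    (α : DualVar t m n) :
    ‖p.v (p.dualPt x) - p.v α‖ ^ 2 ≤ p.R ^ 2 / p.lamK ^ 2 * p.meanSq x α := by
  rw [← v_sub]
  exact p.norm_v_sq_le hm hn hl _

theorem G_eq (hl : 0 < p.lamK) (y x : E d) :
    p.G y x = (1 / p.N) * ∑ τ, ∑ i, p.φ i τ (ContinuousLinearMap.adjoint (p.A i τ) x)
      + p.lamK * p.ξ y x := by
  simp only [G, P, ξ]
  field_simp
  ring

variable {p}

theorem Regular.lamK_pos (hp : p.Regular) (hk : 0 ≤ p.kap) : 0 < p.lamK :=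
  add_pos_of_pos_of_nonneg hp.lam_pos hk

theorem Regular.ξ_strong (hp : p.Regular) (hk : 0 ≤ p.kap) (y : E d) :
    StrongConvexOn Set.univ 1 (p.ξ y) := by
  have hl := hp.lamK_pos hk
  refine ⟨convex_univ, fun x _ z _ a b ha hb hab => ?_⟩
  have h := hp.g_strong.2 (Set.mem_univ x) (Set.mem_univ z) ha hb hab
  simp only [smul_eq_mul, ξ] at h ⊢
  rw [norm_segment_sq x z y hab, div_le_iff₀ hl]
  have e : (a * ((p.g x + p.kap / 2 * ‖x - y‖ ^ 2) / p.lamK)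
      + b * ((p.g z + p.kap / 2 * ‖z - y‖ ^ 2) / p.lamK) - a * b * (1 / 2 * ‖x - z‖ ^ 2)) * p.lamK
      = a * (p.g x + p.kap / 2 * ‖x - y‖ ^ 2) + b * (p.g z + p.kap / 2 * ‖z - y‖ ^ 2)
        - a * b * (1 / 2 * ‖x - z‖ ^ 2) * p.lamK := by
    field_simp
  rw [e, lamK]
  linarith

theorem Regular.primal_spec (hp : p.Regular) (hk : 0 ≤ p.kap) (y u x : E d) :
    Inner.inner ℝ u x - p.ξ y x + 1 / 2 * ‖x - p.primal y u‖ ^ 2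
      ≤ Inner.inner ℝ u (p.primal y u) - p.ξ y (p.primal y u) :=
  gradient_conj_spec (hp.ξ_strong hk y) u x

theorem Regular.inner_sub_le (hp : p.Regular) (hk : 0 ≤ p.kap) (y u x : E d) :
    Inner.inner ℝ u x - p.ξ y x ≤ Inner.inner ℝ u (p.primal y u) - p.ξ y (p.primal y u) := by
  have := hp.primal_spec hk y u x
  nlinarith [sq_nonneg ‖x - p.primal y u‖]

theorem Regular.ξc_eq (hp : p.Regular) (hk : 0 ≤ p.kap) (y u : E d) :
    p.ξc y u = Inner.inner ℝ u (p.primal y u) - p.ξ y (p.primal y u) :=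
  toReal_conj_eq (hp.inner_sub_le hk y u)

theorem Regular.conj_ξ (hp : p.Regular) (hk : 0 ≤ p.kap) (y u : E d) :
    conj (p.ξ y) u = p.ξc y u :=
  (coe_toReal_conj (conj_ne_top (hp.inner_sub_le hk y u))).symm

theorem Regular.le_ξc (hp : p.Regular) (hk : 0 ≤ p.kap) (y u x : E d) :
    Inner.inner ℝ u x - p.ξ y x ≤ p.ξc y u :=
  hp.ξc_eq hk y u ▸ hp.inner_sub_le hk y u x

/-- The conjugate of a 1-strongly convex function is 1-smooth: the growth at the maximiser for u
absorbs the cross term ⟨u' - u, x' - x⟩. -/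
theorem Regular.ξc_le (hp : p.Regular) (hk : 0 ≤ p.kap) (y u u' : E d) :
    p.ξc y u' ≤ p.ξc y u + Inner.inner ℝ (u' - u) (p.primal y u) + 1 / 2 * ‖u' - u‖ ^ 2 := by
  rw [hp.ξc_eq hk y u', hp.ξc_eq hk y u]
  have h1 := hp.primal_spec hk y u (p.primal y u')
  have h2 := real_inner_le_norm (u' - u) (p.primal y u' - p.primal y u)
  simp only [inner_sub_left, inner_sub_right] at h2 ⊢
  nlinarith [sq_nonneg (‖u' - u‖ - ‖p.primal y u' - p.primal y u‖)]

theorem Regular.norm_primal_sub_le (hp : p.Regular) (hk : 0 ≤ p.kap) (y u u' : E d) :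
    ‖p.primal y u' - p.primal y u‖ ≤ ‖u' - u‖ := by
  have h1 := hp.primal_spec hk y u (p.primal y u')
  have h2 := hp.primal_spec hk y u' (p.primal y u)
  have h3 := real_inner_le_norm (u' - u) (p.primal y u' - p.primal y u)
  rw [norm_sub_rev] at h2
  simp only [inner_sub_left, inner_sub_right] at h3
  by_contra! h
  have h4 : 0 < ‖p.primal y u' - p.primal y u‖ := (norm_nonneg _).trans_lt h
  nlinarith

theorem Regular.φc_dualPt (hp : p.Regular) (x : E d) (i : Fin m) (τ : Fin n) :
    p.φc i τ (-p.dualPt x i τ)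
      = -Inner.inner ℝ (p.A i τ (p.dualPt x i τ)) x
        - p.φ i τ (ContinuousLinearMap.adjoint (p.A i τ) x) := by
  rw [φc, toReal_conj_eq (x := ContinuousLinearMap.adjoint (p.A i τ) x)]
  · rw [inner_neg_left, ContinuousLinearMap.adjoint_inner_right]
  · intro x'
    rw [dualPt, neg_neg]
    exact inner_gradient_sub_le (hp.φ_convex i τ) (hp.φ_diff i τ) _ x'

theorem Regular.feas_dualPt (hp : p.Regular) (x : E d) : p.Feas (p.dualPt x) := fun i τ => by
  rw [dualPt, neg_neg]
  exact conj_ne_top (inner_gradient_sub_le (hp.φ_convex i τ) (hp.φ_diff i τ) _)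

theorem Feas.coe_φc {α : DualVar t m n} (hα : p.Feas α) (i : Fin m) (τ : Fin n) :
    (p.φc i τ (-α i τ) : EReal) = conj (p.φ i τ) (-α i τ) :=
  coe_toReal_conj (hα i τ)

theorem Regular.D_eq (hp : p.Regular) (hk : 0 ≤ p.kap) (y : E d) {α : DualVar t m n}
    (hα : p.Feas α) : p.D y α = p.Dr y α := by
  rw [D, Dr, hp.conj_ξ hk]
  simp_rw [← hα.coe_φc, ← coe_sum_ereal]
  norm_cast

theorem D_eq_bot (hm : 0 < m) (hn : 0 < n) (y : E d)
    {α : DualVar t m n} (hα : ¬ p.Feas α) : p.D y α = ⊥ := by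
  have hN : 0 < 1 / p.N := one_div_pos.2 (p.N_pos hm hn)
  obtain ⟨i, τ, h⟩ : ∃ i τ, conj (p.φ i τ) (-α i τ) = ⊤ := by
    by_contra! h
    exact hα h
  have hbot : ∀ (ι : Type) (s : Finset ι) (f : ι → EReal), (∀ j ∈ s, f j ≠ ⊥) →
      ∑ j ∈ s, f j ≠ ⊥ := by
    intro ι s f hf
    classical
    induction s using Finset.induction_on with
    | empty => simp
    | insert a s ha ih =>
      rw [Finset.sum_insert ha]
      exact EReal.add_ne_bot_iff.2 ⟨hf a (by simp), ih fun j hj => hf j (by simp [hj])⟩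
  have hin : ∀ τ, ∑ i, conj (p.φ i τ) (-α i τ) ≠ ⊥ := fun τ =>
    hbot _ _ _ fun i _ => conj_ne_bot _ _
  have h1 : ∑ i, conj (p.φ i τ) (-α i τ) = ⊤ := by
    rw [← Finset.add_sum_erase _ _ (Finset.mem_univ i), h]
    exact EReal.top_add_of_ne_bot (hbot _ _ _ fun i _ => conj_ne_bot _ _)
  have h2 : ∑ τ, ∑ i, conj (p.φ i τ) (-α i τ) = ⊤ := by
    rw [← Finset.add_sum_erase _ _ (Finset.mem_univ τ), h1]
    exact EReal.top_add_of_ne_bot (hbot _ _ _ fun τ _ => hin τ)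
  rw [D, h2, EReal.coe_mul_top_of_pos hN, EReal.neg_top, sub_eq_add_neg, EReal.bot_add]

/-- Weak duality: add Fenchel–Young for each loss and for ξ; the bilinear terms cancel by the
definition of v. Strong duality is never needed. -/
theorem Regular.Dr_le_G (hp : p.Regular) (hk : 0 ≤ p.kap) (hm : 0 < m) (hn : 0 < n) (y x : E d)
    {α : DualVar t m n} (hα : p.Feas α) : p.Dr y α ≤ p.G y x := by
  have hl := hp.lamK_pos hk
  have hN := p.N_pos hm hn
  rw [p.G_eq hl, Dr]
  have h1 := mul_le_mul_of_nonneg_left (hp.le_ξc hk y (p.v α) x) hl.le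
  have h2 := p.lamK_mul_inner_v hl α x
  have h3 : (1 / p.N) * ∑ τ, ∑ i, (-Inner.inner ℝ (p.A i τ (α i τ)) x
      - p.φ i τ (ContinuousLinearMap.adjoint (p.A i τ) x))
      ≤ (1 / p.N) * ∑ τ, ∑ i, p.φc i τ (-α i τ) := by
    refine mul_le_mul_of_nonneg_left (Finset.sum_le_sum fun τ _ => Finset.sum_le_sum fun i _ => ?_)
      (by positivity)
    have := le_toReal_conj (hα i τ) (ContinuousLinearMap.adjoint (p.A i τ) x)
    rwa [inner_neg_left, ContinuousLinearMap.adjoint_inner_right] at this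
  simp_rw [Finset.sum_sub_distrib, Finset.sum_neg_distrib] at h3
  linarith

theorem Regular.D_le_G (hp : p.Regular) (hk : 0 ≤ p.kap) (hm : 0 < m) (hn : 0 < n) (y x : E d)
    (α : DualVar t m n) : p.D y α ≤ p.G y x := by
  by_cases hα : p.Feas α
  · rw [hp.D_eq hk y hα]
    exact EReal.coe_le_coe_iff.2 (hp.Dr_le_G hk hm hn y x hα)
  · rw [D_eq_bot hm hn y hα]
    exact bot_le

theorem Regular.coe_Dstar (hp : p.Regular) (hk : 0 ≤ p.kap) (hm : 0 < m) (hn : 0 < n) (y : E d) :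
    (p.Dstar y : EReal) = ⨆ β, p.D y β := by
  refine EReal.coe_toReal ?_ ?_
  · exact ne_top_of_le_ne_top (EReal.coe_ne_top _) (iSup_le (hp.D_le_G hk hm hn y 0))
  · refine ne_bot_of_le_ne_bot (EReal.coe_ne_bot (p.Dr y (p.dualPt 0))) ?_
    rw [← hp.D_eq hk y (hp.feas_dualPt 0)]
    exact le_iSup (p.D y) _

theorem Regular.Dstar_le_G (hp : p.Regular) (hk : 0 ≤ p.kap) (hm : 0 < m) (hn : 0 < n)
    (y x : E d) : p.Dstar y ≤ p.G y x := by
  rw [← EReal.coe_le_coe_iff, hp.coe_Dstar hk hm hn]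
  exact iSup_le (hp.D_le_G hk hm hn y x)

theorem Regular.Dr_le_Dstar (hp : p.Regular) (hk : 0 ≤ p.kap) (hm : 0 < m) (hn : 0 < n) (y : E d)
    {α : DualVar t m n} (hα : p.Feas α) : p.Dr y α ≤ p.Dstar y := by
  rw [← EReal.coe_le_coe_iff, hp.coe_Dstar hk hm hn, ← hp.D_eq hk y hα]
  exact le_iSup (p.D y) α

theorem Regular.dualGap_eq (hp : p.Regular) (hk : 0 ≤ p.kap) (hm : 0 < m) (hn : 0 < n) (y : E d)
    {α : DualVar t m n} (hα : p.Feas α) :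
    p.dualGap y α = ((p.Dstar y - p.Dr y α : ℝ) : EReal) := by
  rw [dualGap, ← hp.coe_Dstar hk hm hn, hp.D_eq hk y hα, EReal.coe_sub]

/-- The domain of each conjugate is convex. The weight may differ from coordinate to coordinate, so
the same statement serves a randomised coordinate update and a full step. -/
theorem Regular.feas_segment (hp : p.Regular) {α : DualVar t m n} (hα : p.Feas α) (x : E d)
    {s : Fin m → Fin n → ℝ} (hs0 : ∀ i τ, 0 ≤ s i τ) (hs1 : ∀ i τ, s i τ ≤ 1) :
    p.Feas (α + fun i τ => s i τ • (p.dualPt x i τ - α i τ)) := fun i τ => by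
  have e : -(α + fun i τ => s i τ • (p.dualPt x i τ - α i τ)) i τ
      = -α i τ + s i τ • (-p.dualPt x i τ - -α i τ) := by
    simp only [Pi.add_apply]
    module
  rw [e]
  exact conj_ne_top (conj_segment_le hp.gam_pos (hp.φ_diff i τ) (hp.φ_smooth i τ) (hα i τ)
    (hp.feas_dualPt x i τ) (hs0 i τ) (hs1 i τ))

/-- Growth of the dual objective along the segments from `α` to `dualPt x`. -/
theorem Regular.Dr_segment (hp : p.Regular) (hk : 0 ≤ p.kap) (hm : 0 < m) (hn : 0 < n)
    (y x : E d) {α : DualVar t m n} (hα : p.Feas α)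
    {s : Fin m → Fin n → ℝ} (hs0 : ∀ i τ, 0 ≤ s i τ) (hs1 : ∀ i τ, s i τ ≤ 1) :
    p.Dr y α + (1 / p.N) * ∑ τ, ∑ i, s i τ * p.incr y x α i τ
      + (1 / p.N) * ∑ τ, ∑ i, p.gam / 2 * (s i τ * (1 - s i τ)) * ‖p.dualPt x i τ - α i τ‖ ^ 2
      - p.lamK / 2 * ‖p.v fun i τ => s i τ • (p.dualPt x i τ - α i τ)‖ ^ 2
      ≤ p.Dr y (α + fun i τ => s i τ • (p.dualPt x i τ - α i τ)) := by
  have hl := hp.lamK_pos hk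
  have hN := p.N_pos hm hn
  set β : DualVar t m n := fun i τ => s i τ • (p.dualPt x i τ - α i τ) with hβ
  have h1 := mul_le_mul_of_nonneg_left (hp.ξc_le hk y (p.v α) (p.v α + p.v β)) hl.le
  rw [add_sub_cancel_left] at h1
  have h2 := p.lamK_mul_inner_v hl β (p.primal y (p.v α))
  have h3 : (1 / p.N) * ∑ τ, ∑ i, p.φc i τ (-(α + β) i τ)
      ≤ (1 / p.N) * ∑ τ, ∑ i, (p.φc i τ (-α i τ)
        - (s i τ * p.incr y x α i τ
          + p.gam / 2 * (s i τ * (1 - s i τ)) * ‖p.dualPt x i τ - α i τ‖ ^ 2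
          + Inner.inner ℝ (p.A i τ (β i τ)) (p.primal y (p.v α)))) := by
    refine mul_le_mul_of_nonneg_left (Finset.sum_le_sum fun τ _ => Finset.sum_le_sum fun i _ => ?_)
      (by positivity)
    have e : -(α + β) i τ = -α i τ + s i τ • (-p.dualPt x i τ - -α i τ) := by
      simp only [Pi.add_apply, hβ]
      module
    have e2 : ‖-p.dualPt x i τ - -α i τ‖ = ‖p.dualPt x i τ - α i τ‖ := by
      rw [← norm_neg]; congr 1; abel
    have := toReal_conj_le (conj_segment_le hp.gam_pos (hp.φ_diff i τ) (hp.φ_smooth i τ) (hα i τ)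
      (hp.feas_dualPt x i τ) (hs0 i τ) (hs1 i τ))
    rw [← e, e2] at this
    refine this.trans (le_of_eq ?_)
    simp only [hβ, map_smul, real_inner_smul_left, incr, φc]
    ring
  simp_rw [Finset.sum_sub_distrib, Finset.sum_add_distrib] at h3
  rw [Dr, Dr, v_add]
  linarith

/-- For u = v(α), Fenchel–Young is an equality at `dualPt x` and at x = ∇ξ*(u), and the averaged
increment is exactly the duality gap G(x) - D(α). For other u the two subtracted terms account for
the shift of ∇ξ*, which is nonexpansive, and for the curvature of ξ*. -/
theorem Regular.le_sum_incr (hp : p.Regular) (hk : 0 ≤ p.kap) (y u : E d) (α : DualVar t m n) :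
    p.G y (p.primal y u) - p.Dr y α
      - p.lamK * (‖p.v (p.dualPt (p.primal y u)) - p.v α‖ * ‖p.v α - u‖)
      - p.lamK / 2 * ‖p.v α - u‖ ^ 2
      ≤ (1 / p.N) * ∑ τ, ∑ i, p.incr y (p.primal y u) α i τ := by
  have hl := hp.lamK_pos hk
  set x := p.primal y u with hx
  set w := p.dualPt x with hw
  have h1 := hp.ξc_le hk y u (p.v α)
  rw [← hx] at h1
  have h2 := hp.ξc_eq hk y u
  rw [← hx] at h2
  have h3 := real_inner_le_norm (p.v w - p.v α) (p.primal y (p.v α) - x)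
  have h4 := (mul_le_mul_of_nonneg_left (hp.norm_primal_sub_le hk y u (p.v α))
    (norm_nonneg (p.v w - p.v α))).trans' h3
  have h5 := p.lamK_mul_inner_v hl w x
  have h6 := p.lamK_mul_inner_v hl (w - α) (p.primal y (p.v α))
  rw [v_sub] at h6
  have h7 : ∑ τ, ∑ i, p.φ i τ (ContinuousLinearMap.adjoint (p.A i τ) x)
      = ∑ τ, ∑ i, (-Inner.inner ℝ (p.A i τ (w i τ)) x - p.φc i τ (-w i τ)) :=
    Finset.sum_congr rfl fun τ _ => Finset.sum_congr rfl fun i _ => by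
      rw [hw, hp.φc_dualPt x i τ]; ring
  rw [p.G_eq hl, h7, Dr]
  simp only [incr, ← hw]
  simp_rw [Finset.sum_sub_distrib, Finset.sum_neg_distrib]
  simp only [Pi.sub_apply] at h6
  have h8 : p.lamK * (p.ξ y x + p.ξc y (p.v α) - Inner.inner ℝ (p.v w) x)
      ≤ p.lamK * (-Inner.inner ℝ (p.v w - p.v α) (p.primal y (p.v α))
        + ‖p.v w - p.v α‖ * ‖p.v α - u‖ + 1 / 2 * ‖p.v α - u‖ ^ 2) := by
    refine mul_le_mul_of_nonneg_left ?_ hl.le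
    simp only [inner_sub_left, inner_sub_right] at h1 h4 ⊢
    linarith
  linarith

/-- The duality gap at `x` is controlled by the dual gap and the perturbation of `v(α)`. -/
theorem Regular.G_sub_Dr_le (hp : p.Regular) (hk : 0 ≤ p.kap) (hm : 0 < m) (hn : 0 < n)
    (y u : E d) {α : DualVar t m n} (hα : p.Feas α) :
    p.G y (p.primal y u) - p.Dr y α
      ≤ (1 + 2 * p.R ^ 2 / (p.lamK * p.gam))
        * (p.Dstar y - p.Dr y α + p.lamK * ‖p.v α - u‖ ^ 2) := by
  have hl := hp.lamK_pos hk
  have hg := hp.gam_pos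
  have hN := p.N_pos hm hn
  set x := p.primal y u with hx
  set V := p.meanSq x α with hV
  set a := ‖p.v (p.dualPt x) - p.v α‖ with ha
  set b := ‖p.v α - u‖ with hb
  -- The value of s solves γ(1-s)/2 = sR²/(λ+κ): the strong-convexity gain then covers (λ+κ)(s a)²,
  -- half of which is the curvature of ξ* and half the Young bound on the cross term a b.
  set s := p.gam * p.lamK / (p.gam * p.lamK + 2 * p.R ^ 2) with hs
  have hden : 0 < p.gam * p.lamK + 2 * p.R ^ 2 := by positivity
  have hs0 : 0 < s := by positivity
  have hs1 : s ≤ 1 := by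
    rw [hs, div_le_one hden]
    nlinarith [sq_nonneg p.R]
  have h1 := hp.Dr_segment hk hm hn y x hα (s := fun _ _ => s) (fun _ _ => hs0.le) fun _ _ => hs1
  have h2 := hp.Dr_le_Dstar hk hm hn y (hp.feas_segment hα x (s := fun _ _ => s)
    (fun _ _ => hs0.le) fun _ _ => hs1)
  have h3 := mul_le_mul_of_nonneg_left (hp.le_sum_incr hk y u α) hs0.le
  rw [← hx, ← ha, ← hb] at h3
  have h4 := p.norm_v_dualPt_sub_sq_le hm hn hl x α
  rw [← ha, ← hV] at h4
  have h5 : p.v (fun i τ => s • (p.dualPt x i τ - α i τ)) = s • (p.v (p.dualPt x) - p.v α) := by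
    rw [← v_sub]
    simp only [v, map_smul, ← Finset.smul_sum, Pi.sub_apply]
    rw [smul_comm]
  rw [h5, norm_smul, ← ha, Real.norm_of_nonneg hs0.le] at h1
  have h6 : (1 / p.N) * ∑ τ, ∑ i, p.gam / 2 * (s * (1 - s)) * ‖p.dualPt x i τ - α i τ‖ ^ 2
      = p.gam / 2 * (s * (1 - s)) * V := by
    rw [hV, meanSq]
    simp_rw [← Finset.mul_sum]
    ring
  have h7 : (1 / p.N) * ∑ τ, ∑ i, s * p.incr y x α i τ
      = s * ((1 / p.N) * ∑ τ, ∑ i, p.incr y x α i τ) := by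
    simp_rw [← Finset.mul_sum]
    ring
  rw [h6, h7] at h1
  have hV0 : 0 ≤ V := p.meanSq_nonneg x α
  have h8 : p.gam / 2 * (1 - s) = s * (p.R ^ 2 / p.lamK) := by
    rw [hs]
    field_simp
    ring
  have h9 : p.lamK * (s * a) ^ 2 ≤ p.gam / 2 * (s * (1 - s)) * V := by
    have h10 : p.lamK * (s ^ 2 * a ^ 2)
        ≤ p.lamK * (s ^ 2 * (p.R ^ 2 / p.lamK ^ 2 * V)) := by gcongr
    calc _ = p.lamK * (s ^ 2 * a ^ 2) := by ring
      _ ≤ _ := h10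
      _ = s * (s * (p.R ^ 2 / p.lamK)) * V := by field_simp
      _ = _ := by rw [← h8]; ring
  have h11 : s * (p.lamK * (a * b)) ≤ p.lamK / 2 * (s * a) ^ 2 + p.lamK / 2 * b ^ 2 := by
    nlinarith [mul_nonneg hl.le (sq_nonneg (s * a - b))]
  have h12 : s * (p.lamK / 2 * b ^ 2) ≤ p.lamK / 2 * b ^ 2 :=
    mul_le_of_le_one_left (by positivity) hs1
  have h13 : s * (p.G y x - p.Dr y α) ≤ p.Dstar y - p.Dr y α + p.lamK * b ^ 2 := by
    linarith
  have h14 : 1 + 2 * p.R ^ 2 / (p.lamK * p.gam) = s⁻¹ := by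
    rw [hs]
    field_simp
  rw [h14, ← div_eq_inv_mul, le_div_iff₀ hs0]
  linarith

/-- Change of the dual gap when the prox-centre moves. -/
theorem Regular.dual_gap_move (hp : p.Regular) (hk : 0 ≤ p.kap) (hm : 0 < m) (hn : 0 < n)
    (y y' : E d) (α : DualVar t m n) :
    p.Dstar y' - p.Dr y' α
      ≤ p.G y (p.primal y (p.v α)) - p.Dr y α + p.kap / 2 * ‖y' - y‖ ^ 2 := by
  have hl := hp.lamK_pos hk
  set x := p.primal y (p.v α) with hx
  set z := p.primal y' (p.v α) with hz
  -- Weak duality for the new subproblem, tested at the maximiser attached to the old centre.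
  have h1 := hp.Dstar_le_G hk hm hn y' x
  have h2 := hp.primal_spec hk y (p.v α) z
  have h3 := hp.ξc_eq hk y (p.v α)
  have h4 := hp.ξc_eq hk y' (p.v α)
  rw [← hx] at h2 h3
  rw [← hz] at h4
  have h5 : ∀ y w, p.lamK * p.ξ y w = p.g w + p.kap / 2 * ‖w - y‖ ^ 2 := fun y w => by
    rw [ξ]; field_simp
  rw [Dr, Dr, G, h3, h4]
  rw [G] at h1
  have h6 := mul_le_mul_of_nonneg_left h2 hl.le
  have h7 := h5 y x
  have h8 := h5 y z
  have h9 := h5 y' z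
  have h10 : ‖z - y‖ ^ 2 - ‖z - y'‖ ^ 2 + ‖x - y'‖ ^ 2 - ‖x - y‖ ^ 2
      = 2 * Inner.inner ℝ (z - x) (y' - y) := by
    have e1 : z - y = (z - x) + (x - y) := by abel
    have e2 : z - y' = (z - x) + (x - y) - (y' - y) := by abel
    have e3 : x - y' = (x - y) - (y' - y) := by abel
    rw [e1, e2, e3]
    simp only [norm_sub_sq_real, norm_add_sq_real, inner_add_left]
    ring
  have h11 := real_inner_le_norm (z - x) (y' - y)
  -- All dependence on the centres collapses to κ⟨z - x, y' - y⟩; since κ ≤ λ + κ, the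
  -- strong-convexity term in ‖z - x‖² absorbs its half of Young's inequality.
  have h12 : p.kap * Inner.inner ℝ (z - x) (y' - y)
      ≤ p.kap / 2 * ‖y' - y‖ ^ 2 + p.lamK / 2 * ‖z - x‖ ^ 2 := by
    have h13 := mul_le_mul_of_nonneg_left h11 hk
    have h14 : p.kap ≤ p.lamK := by rw [lamK]; linarith [hp.lam_pos]
    have h15 := mul_le_mul_of_nonneg_right h14 (sq_nonneg ‖z - x‖)
    nlinarith [mul_nonneg hk (sq_nonneg (‖z - x‖ - ‖y' - y‖))]
  have h16 : p.kap / 2 * (‖z - y‖ ^ 2 - ‖z - y'‖ ^ 2 + ‖x - y'‖ ^ 2 - ‖x - y‖ ^ 2)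
      = p.kap * Inner.inner ℝ (z - x) (y' - y) := by rw [h10]; ring
  linarith

end

end Setup

end ECCatalyst

/-! ### Averages over the sampled indices and one-step estimates -/

namespace ECCatalyst

theorem sum_pi_fin_succ {m n : ℕ} {M : Type*} [AddCommMonoid M]
    (f : (Fin (n + 1) → Fin m) → M) :
    ∑ σ, f σ = ∑ σ' : Fin n → Fin m, ∑ j : Fin m, f (Fin.cons j σ') := by
  rw [← (Fin.consEquiv fun _ : Fin (n + 1) => Fin m).sum_comp, Fintype.sum_prod_type,
    Finset.sum_comm]
  rfl

/-- Linearity of expectation for independent uniform indices, in counting form. -/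
theorem sum_pi_coord {m : ℕ} (hm : 0 < m) : ∀ {n : ℕ} (f : Fin n → Fin m → ℝ),
    ∑ σ : Fin n → Fin m, ∑ τ, f τ (σ τ) = (m : ℝ) ^ n * ∑ τ, (1 / (m : ℝ)) * ∑ i, f τ i
  | 0, f => by simp
  | n + 1, f => by
    have hm' : (m : ℝ) ≠ 0 := by positivity
    have ih := sum_pi_coord hm fun τ : Fin n => f τ.succ
    rw [sum_pi_fin_succ]
    simp_rw [Fin.sum_univ_succ, Fin.cons_zero, Fin.cons_succ, Finset.sum_add_distrib,
      Finset.sum_const, Finset.card_univ, Fintype.card_fin, nsmul_eq_mul, ← Finset.mul_sum] at ih ⊢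
    rw [ih]
    simp
    field_simp
    ring

theorem sum_norm_add_sq_le {d m : ℕ} (hm : 0 < m) (w : E d) (b : Fin m → E d) :
    ∑ j, ‖w + b j‖ ^ 2 ≤ m * ‖w + (1 / (m : ℝ)) • ∑ j, b j‖ ^ 2 + ∑ j, ‖b j‖ ^ 2 := by
  have hm' : (m : ℝ) ≠ 0 := by positivity
  simp_rw [norm_add_sq_real, Finset.sum_add_distrib, ← Finset.mul_sum, ← inner_sum,
    inner_smul_right]
  rw [Finset.sum_const, Finset.card_univ, Fintype.card_fin, nsmul_eq_mul]
  have : (m : ℝ) * (‖w‖ ^ 2 + 2 * (1 / (m : ℝ) * inner ℝ w (∑ j, b j))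
      + ‖(1 / (m : ℝ)) • ∑ j, b j‖ ^ 2) = m * ‖w‖ ^ 2 + 2 * inner ℝ w (∑ j, b j)
      + m * ‖(1 / (m : ℝ)) • ∑ j, b j‖ ^ 2 := by field_simp
  rw [this]
  have : 0 ≤ (m : ℝ) * ‖(1 / (m : ℝ)) • ∑ j, b j‖ ^ 2 := by positivity
  linarith

/-- Squared mean plus variance, with each node's variance bounded by its second moment. Averaging
one node at a time and moving its mean into c makes the cross terms between nodes disappear. -/
theorem sum_pi_norm_sq_le {d m : ℕ} (hm : 0 < m) : ∀ {n : ℕ} (c : E d) (b : Fin n → Fin m → E d),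
    ∑ σ : Fin n → Fin m, ‖c + ∑ τ, b τ (σ τ)‖ ^ 2
      ≤ (m : ℝ) ^ n * (‖c + ∑ τ, (1 / (m : ℝ)) • ∑ i, b τ i‖ ^ 2
        + ∑ τ, (1 / (m : ℝ)) * ∑ i, ‖b τ i‖ ^ 2)
  | 0, c, b => by simp
  | n + 1, c, b => by
    have hm' : (m : ℝ) ≠ 0 := by positivity
    have ih := sum_pi_norm_sq_le hm (c + (1 / (m : ℝ)) • ∑ i, b 0 i) fun τ : Fin n => b τ.succ
    rw [sum_pi_fin_succ]
    simp_rw [Fin.sum_univ_succ, Fin.cons_zero, Fin.cons_succ]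
    calc _ ≤ ∑ σ' : Fin n → Fin m, (m * ‖c + (1 / (m : ℝ)) • ∑ i, b 0 i
          + ∑ τ, b τ.succ (σ' τ)‖ ^ 2 + ∑ j, ‖b 0 j‖ ^ 2) := by
          refine Finset.sum_le_sum fun σ' _ => ?_
          have h := sum_norm_add_sq_le hm (c + ∑ τ, b τ.succ (σ' τ)) (b 0)
          have e : c + ∑ τ, b τ.succ (σ' τ) + (1 / (m : ℝ)) • ∑ j, b 0 j
            = c + (1 / (m : ℝ)) • ∑ i, b 0 i + ∑ τ, b τ.succ (σ' τ) := by abel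
          rw [e] at h
          refine le_trans (le_of_eq ?_) h
          refine Finset.sum_congr rfl fun j _ => ?_
          congr 2
          abel
      _ ≤ m * ((m : ℝ) ^ n * (‖c + (1 / (m : ℝ)) • ∑ i, b 0 i
            + ∑ τ : Fin n, (1 / (m : ℝ)) • ∑ i, b τ.succ i‖ ^ 2
            + ∑ τ : Fin n, (1 / (m : ℝ)) * ∑ i, ‖b τ.succ i‖ ^ 2))
            + (m : ℝ) ^ n * ∑ j, ‖b 0 j‖ ^ 2 := by
          rw [Finset.sum_add_distrib, ← Finset.mul_sum, Finset.sum_const, Finset.card_univ,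
            Fintype.card_fun, Fintype.card_fin, Fintype.card_fin, nsmul_eq_mul]
          push_cast
          gcongr
      _ = _ := by
          rw [add_assoc c]
          field_simp
          ring

namespace Setup

noncomputable section

variable {d t m n : ℕ} (p : Setup d t m n)

theorem R_le_Rm (hm : 0 < m) (hn : 0 < n) : p.R ≤ p.Rm := by
  refine abs_le_of_sq_le_sq' ?_ p.Rm_nonneg |>.2
  have hN := p.N_pos hm hn
  refine le_of_mul_le_mul_left ?_ hN
  rw [N_mul_R_sq p hm hn]
  refine lamMax_le (by positivity) fun y => ?_
  rw [sum_sum_eq_sum_prod, ← sum_norm_adjoint_sq (fun j : Fin n × Fin m => p.A j.2 j.1) y]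
  calc _ ≤ ∑ _j : Fin n × Fin m, (p.Rm * ‖y‖) ^ 2 := Finset.sum_le_sum fun j _ =>
        pow_le_pow_left₀ (norm_nonneg _) (p.norm_adjoint_A_le_Rm j.2 j.1 y) 2
    _ = _ := by simp [N]; ring

theorem B_sq (h1 : p.del < 1) (h0 : 0 < p.del) :
    p.B ^ 2 = (1 - p.del) * (2 * p.Rbar ^ 2 + p.del * p.Rm ^ 2) := by
  rw [B, mul_pow, Real.sq_sqrt (by linarith), Real.sq_sqrt (by positivity)]

theorem B_pos_of_R_pos (hm : 0 < m) (hn : 0 < n) (h0 : 0 < p.del) (h1 : p.del < 1)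
    (hR : 0 < p.R) : 0 < p.B := by
  have hRm : 0 < p.Rm := hR.trans_le (p.R_le_Rm hm hn)
  exact mul_pos (Real.sqrt_pos.2 (by linarith)) (Real.sqrt_pos.2 (by positivity))

theorem ρ_nonneg (h0 : 0 < p.del) (hl : 0 < p.lamK) : 0 ≤ p.ρ := by
  have := p.R_nonneg
  have := p.B_nonneg
  unfold ρ
  positivity

/-- Apart from its sign, this is all that is used about ρ. It survives B = 0: then R = 0 as well,
and the division in ρ returns 0. -/
theorem two_mul_ρ_mul_B (hm : 0 < m) (hn : 0 < n) (h0 : 0 < p.del) (h1 : p.del < 1) :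
    2 * (p.ρ * p.B) = p.del * p.lamK * p.R := by
  rcases p.R_nonneg.eq_or_lt with hR | hR
  · simp [ρ, ← hR]
  · have := p.B_pos_of_R_pos hm hn h0 h1 hR
    rw [ρ]
    field_simp

theorem theta0_inv_pos (hm : 0 < m) (h0 : 0 < p.del) (hl : 0 < p.lamK) (hg : 0 < p.gam) :
    0 < m + (p.Rm ^ 2 / n + p.R ^ 2) / (p.lamK * p.gam)
      + 4 * p.R * p.B / (p.del * (p.lamK * p.gam))
      + 2 * p.B / (p.del * Real.sqrt (p.lamK * p.gam)) := by
  have := p.R_nonneg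
  have := p.B_nonneg
  positivity

/-- The choice of `theta0` absorbs all terms in the mean square of the dual increments. -/
theorem stepsize_condition (hm : 0 < m) (hg : 0 < p.gam) (hl : 0 < p.lamK)
    (h0 : 0 < p.del) (ht0 : 0 < p.theta) (ht : p.theta ≤ p.theta0) :
    p.theta * (p.Rm ^ 2 / n + p.R ^ 2) / p.lamK + 4 * p.theta * p.R * p.B / (p.del * p.lamK)
      + 4 * p.theta ^ 2 * p.B ^ 2 / (p.lamK * p.del ^ 2) ≤ p.gam * (1 - p.theta * m) := by
  have hR := p.R_nonneg
  have hB := p.B_nonneg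
  have hpos := p.theta0_inv_pos (n := n) hm h0 hl hg
  have hs : 0 < Real.sqrt (p.lamK * p.gam) := Real.sqrt_pos.2 (by positivity)
  have hsq := Real.sq_sqrt (x := p.lamK * p.gam) (by positivity)
  set Y := 2 * p.B / (p.del * Real.sqrt (p.lamK * p.gam)) with hY
  set X := (p.Rm ^ 2 / n + p.R ^ 2) / (p.lamK * p.gam)
      + 4 * p.R * p.B / (p.del * (p.lamK * p.gam)) with hX
  have h1 : p.theta * (m + X + Y) ≤ 1 := by
    rw [theta0, le_div_iff₀ hpos] at ht
    rw [hX]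
    linarith
  have hX0 : 0 ≤ X := by positivity
  have hY0 : 0 ≤ Y := by positivity
  have h2 : p.theta * Y ≤ 1 := by
    have : 0 ≤ p.theta * (m + X) := by positivity
    linarith
  -- The compression term is quadratic in θ, namely γ(θY)². Because θY ≤ 1, it is dominated by the
  -- linear θY available from the stepsize.
  have h3 : (p.theta * Y) ^ 2 ≤ p.theta * Y := by
    rw [sq]
    exact mul_le_of_le_one_left (by positivity) h2
  have h4 : (p.theta * Y) ^ 2 = 4 * p.theta ^ 2 * p.B ^ 2 / (p.lamK * p.del ^ 2) / p.gam := by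
    rw [hY, mul_pow, div_pow, mul_pow p.del, hsq]
    field_simp
    ring
  have h5 : p.theta * X = (p.theta * (p.Rm ^ 2 / n + p.R ^ 2) / p.lamK
      + 4 * p.theta * p.R * p.B / (p.del * p.lamK)) / p.gam := by
    rw [hX]
    field_simp
  rw [← sub_nonneg]
  have h6 : p.theta * X + (p.theta * Y) ^ 2 ≤ 1 - p.theta * m := by linarith
  rw [h4, h5, ← add_div, div_le_iff₀ hg] at h6
  linarith

theorem theta_mul_m_le_one (hm : 0 < m) (hg : 0 < p.gam) (hl : 0 < p.lamK)
    (h0 : 0 < p.del) (ht0 : 0 < p.theta) (ht : p.theta ≤ p.theta0) : p.theta * m ≤ 1 := by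
  have h := p.stepsize_condition (n := n) hm hg hl h0 ht0 ht
  have hR := p.R_nonneg
  have hB := p.B_nonneg
  have : 0 ≤ p.theta * (p.Rm ^ 2 / n + p.R ^ 2) / p.lamK
      + 4 * p.theta * p.R * p.B / (p.del * p.lamK)
      + 4 * p.theta ^ 2 * p.B ^ 2 / (p.lamK * p.del ^ 2) := by positivity
  have := nonneg_of_mul_nonneg_right (this.trans h) hg
  linarith

/-- The dual variables after one step with sampled indices `σ`. -/
def updDual (x : E d) (α : DualVar t m n) (σ : Fin n → Fin m) : DualVar t m n :=
  α + fun i τ => (if i = σ τ then p.theta * m else 0) • (p.dualPt x i τ - α i τ)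

theorem Δα_eq (x : E d) (α : DualVar t m n) (i : Fin m) (τ : Fin n) :
    p.Δα x α i τ = (p.theta * m) • (p.dualPt x i τ - α i τ) := by
  simp only [Δα, dualPt]
  module

theorem message_eq (hm : 0 < m) (x : E d) (s : InnerState d t m n) (i : Fin m) (τ : Fin n) :
    p.message x s i τ
      = (p.theta / p.lamK) • p.A i τ (p.dualPt x i τ - s.α i τ) + s.e τ := by
  have hm' : (m : ℝ) ≠ 0 := by positivity
  rw [message, Δα_eq, map_smul, smul_smul]
  congr 2
  field_simp

theorem innerStep_α {S : Type*} (Q : S → E d → E d) (y : E d) (z : Fin n → Fin m × S)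
    (s : InnerState d t m n) :
    (p.innerStep Q y z s).α = p.updDual (p.primal y s.u) s.α fun τ => (z τ).1 := by
  funext i τ
  simp only [innerStep, updDual, Pi.add_apply]
  split_ifs
  · rw [Δα_eq]
  · simp

variable {p}

theorem Regular.feas_updDual (hp : p.Regular) (ha0 : 0 ≤ p.theta * m) (ha : p.theta * m ≤ 1)
    (x : E d) {α : DualVar t m n} (hα : p.Feas α) (σ : Fin n → Fin m) :
    p.Feas (p.updDual x α σ) := by
  refine hp.feas_segment hα x (fun i τ => ?_) fun i τ => ?_ <;> split_ifs <;> linarith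

/-- Mean decrease of the dual gap in one step. -/
theorem Regular.sum_gap_updDual_le (hp : p.Regular) (hk : 0 ≤ p.kap) (hm : 0 < m) (hn : 0 < n)
    (ha0 : 0 ≤ p.theta * m) (ha : p.theta * m ≤ 1)
    (y x : E d) {α : DualVar t m n} (hα : p.Feas α) :
    ∑ σ : Fin n → Fin m, (p.Dstar y - p.Dr y (p.updDual x α σ)) ≤ (m : ℝ) ^ n *
      (p.Dstar y - p.Dr y α - p.theta * ((1 / p.N) * ∑ τ, ∑ i, p.incr y x α i τ)
        - p.gam / 2 * p.theta * (1 - p.theta * m) * p.meanSq x α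
        + p.lamK / 2 * p.theta ^ 2 * ‖p.v (p.dualPt x) - p.v α‖ ^ 2
        + p.theta ^ 2 * (p.Rm ^ 2 / n) / (2 * p.lamK) * p.meanSq x α) := by
  have hl := hp.lamK_pos hk
  have hm' : (m : ℝ) ≠ 0 := by positivity
  have hn' : (n : ℝ) ≠ 0 := by positivity
  set a := p.theta * m with hadef
  set Δ : DualVar t m n := p.dualPt x - α with hΔ
  set b : Fin n → Fin m → E d := fun τ i => (a / (p.lamK * p.N)) • p.A i τ (Δ i τ) with hb
  have key : ∀ σ : Fin n → Fin m, p.Dstar y - p.Dr y (p.updDual x α σ)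
      ≤ (p.Dstar y - p.Dr y α) - ∑ τ, (a / p.N) * p.incr y x α (σ τ) τ
        - ∑ τ, (p.gam / 2 * (a * (1 - a)) / p.N) * ‖Δ (σ τ) τ‖ ^ 2
        + p.lamK / 2 * ‖0 + ∑ τ, b τ (σ τ)‖ ^ 2 := by
    intro σ
    have h := hp.Dr_segment hk hm hn y x hα (s := fun i τ => if i = σ τ then a else 0)
      (fun i τ => by split_ifs <;> linarith)
      (fun i τ => by split_ifs <;> linarith)
    have e1 : (1 / p.N) * ∑ τ, ∑ i, (if i = σ τ then a else 0) * p.incr y x α i τ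
        = ∑ τ, (a / p.N) * p.incr y x α (σ τ) τ := by
      rw [Finset.mul_sum]
      refine Finset.sum_congr rfl fun τ _ => ?_
      simp only [ite_mul, zero_mul, Finset.sum_ite_eq', Finset.mem_univ, if_true]
      ring
    have e2 : (1 / p.N) * ∑ τ, ∑ i, p.gam / 2 * ((if i = σ τ then a else 0)
          * (1 - (if i = σ τ then a else 0))) * ‖p.dualPt x i τ - α i τ‖ ^ 2
        = ∑ τ, (p.gam / 2 * (a * (1 - a)) / p.N) * ‖Δ (σ τ) τ‖ ^ 2 := by
      rw [Finset.mul_sum]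
      refine Finset.sum_congr rfl fun τ _ => ?_
      rw [Finset.sum_eq_single (σ τ) (fun i _ hi => by simp [hi]) (by simp)]
      simp only [if_true, hΔ, Pi.sub_apply]
      ring
    have e3 : p.v (fun i τ => (if i = σ τ then a else 0) • (p.dualPt x i τ - α i τ))
        = 0 + ∑ τ, b τ (σ τ) := by
      rw [zero_add, v, Finset.smul_sum]
      refine Finset.sum_congr rfl fun τ _ => ?_
      rw [Finset.sum_eq_single (σ τ) (fun i _ hi => by simp [hi]) (by simp)]
      simp only [if_true, hb, hΔ, Pi.sub_apply, map_smul, smul_smul]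
      congr 1
      ring
    rw [e1, e2, e3] at h
    rw [updDual]
    linarith
  refine (Finset.sum_le_sum fun σ _ => key σ).trans ?_
  simp_rw [Finset.sum_add_distrib, Finset.sum_sub_distrib, ← Finset.mul_sum]
  rw [sum_pi_coord hm fun τ i => p.incr y x α i τ, sum_pi_coord hm fun τ i => ‖Δ i τ‖ ^ 2,
    Finset.sum_const, Finset.sum_const, Finset.card_univ, Fintype.card_fun, Fintype.card_fin,
    Fintype.card_fin, nsmul_eq_mul, nsmul_eq_mul]
  push_cast
  have hsq := mul_le_mul_of_nonneg_left (sum_pi_norm_sq_le hm (0 : E d) b)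
    (by positivity : 0 ≤ p.lamK / 2)
  -- The factor m in the update cancels the sampling probability 1/m, so the mean displacement of
  -- v(α) is θ times the full displacement.
  have e4 : (0 : E d) + ∑ τ, (1 / (m : ℝ)) • ∑ i, b τ i
      = p.theta • (p.v (p.dualPt x) - p.v α) := by
    rw [← v_sub, zero_add, v, smul_smul, Finset.smul_sum]
    refine Finset.sum_congr rfl fun τ _ => ?_
    simp only [hb, ← Finset.smul_sum, smul_smul]
    congr 1
    rw [hadef]
    field_simp
  -- Independence across nodes leaves only R_m²/n in the variance.
  have e5 : ∑ τ, (1 / (m : ℝ)) * ∑ i, ‖b τ i‖ ^ 2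
      ≤ p.theta ^ 2 * (p.Rm ^ 2 / n) / p.lamK ^ 2 * p.meanSq x α := by
    calc _ ≤ ∑ τ, (1 / (m : ℝ)) * ∑ i, (a / (p.lamK * p.N)) ^ 2 * (p.Rm * ‖Δ i τ‖) ^ 2 := by
          gcongr with τ _ i _
          rw [hb, norm_smul, mul_pow, Real.norm_eq_abs, sq_abs]
          gcongr
          exact p.norm_A_apply_le_Rm i τ _
      _ = _ := by
          simp_rw [mul_pow, ← Finset.mul_sum]
          rw [meanSq, hadef, N]
          simp only [hΔ, Pi.sub_apply]
          field_simp
  rw [e4, norm_smul, mul_pow, Real.norm_eq_abs, sq_abs] at hsq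
  have e6 : p.lamK / 2 * ((m : ℝ) ^ n * (p.theta ^ 2 * ‖p.v (p.dualPt x) - p.v α‖ ^ 2
      + ∑ τ, (1 / (m : ℝ)) * ∑ i, ‖b τ i‖ ^ 2))
      ≤ p.lamK / 2 * ((m : ℝ) ^ n * (p.theta ^ 2 * ‖p.v (p.dualPt x) - p.v α‖ ^ 2
      + p.theta ^ 2 * (p.Rm ^ 2 / n) / p.lamK ^ 2 * p.meanSq x α)) := by gcongr
  refine (add_le_add_right (hsq.trans e6) _).trans (le_of_eq ?_)
  simp only [meanSq, hΔ, Pi.sub_apply, ← Finset.mul_sum]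
  rw [hadef, N]
  field_simp
  ring

/-- Mean square of the compressed messages of one node. -/
theorem sum_norm_message_sq_le (hm : 0 < m) (h0 : 0 < p.del) (h1 : p.del < 1)
    (x : E d) (s : InnerState d t m n) (τ : Fin n) :
    (1 - p.del) * ((1 / (m : ℝ)) * ∑ i, ‖p.message x s i τ‖ ^ 2)
      ≤ (1 - p.del / 2) * ‖s.e τ‖ ^ 2 + p.theta ^ 2 / p.lamK ^ 2 * (p.B ^ 2 / p.del)
        * ((1 / (m : ℝ)) * ∑ i, ‖p.dualPt x i τ - s.α i τ‖ ^ 2) := by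
  have hm' : (m : ℝ) ≠ 0 := by positivity
  set Δ : Fin m → E t := fun i => p.dualPt x i τ - s.α i τ with hΔ
  -- Only the mean h of the fresh part meets e in the cross term, so that term costs R̄; the second
  -- moment costs R_m.
  set h : E d := (p.theta / p.lamK) • (1 / (m : ℝ)) • ∑ i, p.A i τ (Δ i) with hh
  set W := (1 / (m : ℝ)) * ∑ i, ‖Δ i‖ ^ 2 with hW
  have hW0 : 0 ≤ W := by positivity
  have e1 : (1 / (m : ℝ)) * ∑ i, ‖p.message x s i τ‖ ^ 2
      = (p.theta / p.lamK) ^ 2 * ((1 / (m : ℝ)) * ∑ i, ‖p.A i τ (Δ i)‖ ^ 2)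
        + 2 * Inner.inner ℝ h (s.e τ) + ‖s.e τ‖ ^ 2 := by
    simp_rw [p.message_eq hm, norm_add_sq_real, norm_smul, mul_pow, Real.norm_eq_abs, sq_abs,
      Finset.sum_add_distrib, ← Finset.mul_sum, hh, real_inner_smul_left, sum_inner,
      ← Finset.mul_sum]
    simp only [hΔ, Finset.sum_const, Finset.card_univ, Fintype.card_fin, nsmul_eq_mul]
    field_simp
  have e2 : (1 / (m : ℝ)) * ∑ i, ‖p.A i τ (Δ i)‖ ^ 2 ≤ p.Rm ^ 2 * W := by
    calc _ ≤ (1 / (m : ℝ)) * ∑ i, (p.Rm * ‖Δ i‖) ^ 2 := by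
          gcongr with i _
          exact p.norm_A_apply_le_Rm i τ _
      _ = _ := by simp_rw [mul_pow, ← Finset.mul_sum, hW]; ring
  have e3 : ‖h‖ ^ 2 ≤ (p.theta / p.lamK) ^ 2 * (p.Rbar ^ 2 * W) := by
    rw [hh, norm_smul, norm_smul, mul_pow, mul_pow, Real.norm_eq_abs, Real.norm_eq_abs, sq_abs,
      sq_abs]
    have := p.norm_sum_node_sq_le hm τ Δ
    calc _ ≤ (p.theta / p.lamK) ^ 2 * ((1 / (m : ℝ)) ^ 2
          * (m * p.Rbar ^ 2 * ∑ i, ‖Δ i‖ ^ 2)) := by gcongr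
      _ = _ := by rw [hW]; field_simp
  -- Young's inequality spends δ/2 of the compressor's contraction, leaving the factor 1 - δ/2 on
  -- ‖e‖².
  have e4 : (1 - p.del) * (2 * Inner.inner ℝ h (s.e τ))
      ≤ p.del / 2 * ‖s.e τ‖ ^ 2 + 2 * (1 - p.del) / p.del * ‖h‖ ^ 2 := by
    have h3 := real_inner_le_norm h (s.e τ)
    have h4 : (1 - p.del) * (2 * Inner.inner ℝ h (s.e τ))
        ≤ (1 - p.del) * (2 * (‖h‖ * ‖s.e τ‖)) := by
      gcongr
    refine h4.trans ?_
    have h5 : 0 ≤ (p.del * ‖s.e τ‖ - 2 * (1 - p.del) * ‖h‖) ^ 2 / (2 * p.del) := by positivity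
    have h6 : (p.del * ‖s.e τ‖ - 2 * (1 - p.del) * ‖h‖) ^ 2 / (2 * p.del)
        = p.del / 2 * ‖s.e τ‖ ^ 2 - (1 - p.del) * (2 * (‖h‖ * ‖s.e τ‖))
          + 2 * (1 - p.del) / p.del * ‖h‖ ^ 2 - 2 * (1 - p.del) * ‖h‖ ^ 2 := by
      field_simp
      ring
    have h7 : 0 ≤ 2 * (1 - p.del) * ‖h‖ ^ 2 := by
      have : 0 ≤ 1 - p.del := by linarith
      positivity
    linarith
  have hd : 0 ≤ 1 - p.del := by linarith
  have e5 : (1 - p.del) * ((p.theta / p.lamK) ^ 2 * ((1 / (m : ℝ)) * ∑ i, ‖p.A i τ (Δ i)‖ ^ 2))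
      ≤ (1 - p.del) * ((p.theta / p.lamK) ^ 2 * (p.Rm ^ 2 * W)) := by gcongr
  have e6 : 2 * (1 - p.del) / p.del * ‖h‖ ^ 2
      ≤ 2 * (1 - p.del) / p.del * ((p.theta / p.lamK) ^ 2 * (p.Rbar ^ 2 * W)) := by gcongr
  have e7 : p.theta ^ 2 / p.lamK ^ 2 * (p.B ^ 2 / p.del) * W
      = (1 - p.del) * ((p.theta / p.lamK) ^ 2 * (p.Rm ^ 2 * W))
        + 2 * (1 - p.del) / p.del * ((p.theta / p.lamK) ^ 2 * (p.Rbar ^ 2 * W)) := by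
    rw [p.B_sq h1 h0]
    field_simp
    ring
  rw [e7, e1]
  linarith

end

end Setup

end ECCatalyst

/-! ### Contraction of the Lyapunov function in one iteration -/

namespace ECCatalyst

theorem uniformOn_univ_singleton {m : ℕ} (i : Fin m) :
    uniformOn (Set.univ : Set (Fin m)) {i} = ENNReal.ofReal (1 / (m : ℝ)) := by
  have hm : (0 : ℝ) < m := by exact_mod_cast i.pos
  rw [uniformOn_univ, Measure.count_singleton, Fintype.card_fin, ENNReal.ofReal_div_of_pos hm,
    ENNReal.ofReal_one, ENNReal.ofReal_natCast]

theorem lintegral_uniform_pi {m n : ℕ} (hm : 0 < m) {S : Type*} [MeasurableSpace S]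
    (ν : Measure S) [IsProbabilityMeasure ν] (f : (Fin n → Fin m) → ℝ) (hf : ∀ σ, 0 ≤ f σ) :
    ∫⁻ z : Fin n → Fin m × S, ENNReal.ofReal (f fun τ => (z τ).1)
        ∂(Measure.pi fun _ => (uniformOn (Set.univ : Set (Fin m))).prod ν)
      = ENNReal.ofReal ((1 / (m : ℝ)) ^ n * ∑ σ, f σ) := by
  have : Nonempty (Fin m) := ⟨⟨0, hm⟩⟩
  have h1 := measurePreserving_pi (fun _ : Fin n => (uniformOn (Set.univ : Set (Fin m))).prod ν)
    (fun _ : Fin n => uniformOn (Set.univ : Set (Fin m)))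
    (f := fun _ => Prod.fst) fun _ => measurePreserving_fst
  rw [h1.lintegral_comp (f := fun σ => ENNReal.ofReal (f σ)) (measurable_of_finite _),
    lintegral_fintype, Finset.mul_sum, ENNReal.ofReal_sum_of_nonneg
      (fun σ _ => mul_nonneg (by positivity) (hf σ))]
  refine Finset.sum_congr rfl fun σ _ => ?_
  rw [Measure.pi_singleton]
  simp_rw [uniformOn_univ_singleton]
  rw [Finset.prod_const, Finset.card_univ, Fintype.card_fin, mul_comm,
    ENNReal.ofReal_mul (by positivity), ENNReal.ofReal_pow (by positivity)]

theorem lintegral_uniform_prod {m : ℕ} {S : Type*} [MeasurableSpace S]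
    (ν : Measure S) [IsProbabilityMeasure ν] {f : Fin m × S → ℝ≥0∞} (hf : Measurable f) :
    ∫⁻ z, f z ∂((uniformOn (Set.univ : Set (Fin m))).prod ν)
      = ∑ i, ENNReal.ofReal (1 / (m : ℝ)) * ∫⁻ s, f (i, s) ∂ν := by
  rw [lintegral_prod _ hf.aemeasurable, lintegral_fintype]
  exact Finset.sum_congr rfl fun i _ => by rw [uniformOn_univ_singleton, mul_comm]

theorem ofReal_add_mul_sum_le {ι : Type*} [Fintype ι] {a b W η : ℝ} {A B : ι → ℝ} (ha : 0 ≤ a)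
    (hb : 0 ≤ b) (hW : 0 ≤ W) (hη : 0 ≤ η) (hA : ∀ τ, 0 ≤ A τ) (hB : ∀ τ, 0 ≤ B τ)
    (h : a + W * ∑ τ, A τ ≤ η * (b + W * ∑ τ, B τ)) :
    ENNReal.ofReal a + ENNReal.ofReal W * ∑ τ, ENNReal.ofReal (A τ)
      ≤ ENNReal.ofReal η * (ENNReal.ofReal b + ENNReal.ofReal W * ∑ τ, ENNReal.ofReal (B τ)) := by
  rw [← ENNReal.ofReal_sum_of_nonneg fun τ _ => hA τ, ← ENNReal.ofReal_mul hW,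
    ← ENNReal.ofReal_add ha (mul_nonneg hW (Finset.sum_nonneg fun τ _ => hA τ)),
    ← ENNReal.ofReal_sum_of_nonneg fun τ _ => hB τ, ← ENNReal.ofReal_mul hW,
    ← ENNReal.ofReal_add hb (mul_nonneg hW (Finset.sum_nonneg fun τ _ => hB τ)),
    ← ENNReal.ofReal_mul hη]
  exact ENNReal.ofReal_le_ofReal h

/-- Young's inequality with weight ρ. The relation between ρ and B makes the coefficient of V equal
to the part of the compression noise that carries ρ, so both fit one term of the stepsize condition.
If R = 0 then a = 0, and ρ need not be positive. -/
theorem cross_term_le {θ ρ lam R B δ V e0 a b : ℝ} (hlam : 0 < lam) (hδ : 0 < δ) (hθ : 0 < θ)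
    (hR : 0 ≤ R) (hB : 0 ≤ B) (hρ : 0 ≤ ρ) (hρB : 2 * (ρ * B) = δ * lam * R)
    (hb : b ^ 2 ≤ e0) (ha : a ^ 2 ≤ R ^ 2 / lam ^ 2 * V) :
    θ * (lam * (a * b)) ≤ ρ / 2 * e0 + θ ^ 2 * R * B / (δ * lam) * V := by
  have he0 : 0 ≤ e0 := (sq_nonneg b).trans hb
  rcases hR.eq_or_lt with hR0 | hR0
  · have h : a = 0 := by
      rw [← hR0] at ha
      refine pow_eq_zero_iff two_ne_zero |>.1 (le_antisymm ?_ (sq_nonneg a))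
      simpa using ha
    rw [h, ← hR0]
    simp only [zero_mul, mul_zero, zero_div, add_zero]
    positivity
  · have hpos : 0 < ρ * B := by
      have : 0 < δ * lam * R := by positivity
      linarith
    have hρ0 : 0 < ρ := pos_of_mul_pos_left hpos hB
    have h2 : 0 ≤ (ρ * b - θ * lam * a) ^ 2 / (2 * ρ) := by positivity
    have h3 : (ρ * b - θ * lam * a) ^ 2 / (2 * ρ)
        = ρ / 2 * b ^ 2 - θ * (lam * (a * b)) + θ ^ 2 * lam ^ 2 / (2 * ρ) * a ^ 2 := by
      field_simp
      ring
    have h4 : θ ^ 2 * lam ^ 2 / (2 * ρ) * a ^ 2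
        ≤ θ ^ 2 * lam ^ 2 / (2 * ρ) * (R ^ 2 / lam ^ 2 * V) := by gcongr
    have h5 : θ ^ 2 * lam ^ 2 / (2 * ρ) * (R ^ 2 / lam ^ 2 * V)
        = θ ^ 2 * R * B / (δ * lam) * V := by
      have hB0 : 0 < B := pos_of_mul_pos_right hpos hρ
      have h7 : B = δ * lam * R / (2 * ρ) := by
        rw [eq_div_iff (by positivity), ← hρB]
        ring
      rw [h7]
      field_simp
    have h6 : ρ / 2 * b ^ 2 ≤ ρ / 2 * e0 := by gcongr
    linarith

theorem stepsize_combination {θ lam R B δ V γ M Q : ℝ} (hlam : 0 < lam) (hδ : 0 < δ)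
    (hθ : 0 < θ) (hV : 0 ≤ V)
    (h : θ * (Q + R ^ 2) / lam + 4 * θ * R * B / (δ * lam) + 4 * θ ^ 2 * B ^ 2 / (lam * δ ^ 2)
      ≤ γ * (1 - θ * M)) :
    lam / 2 * θ ^ 2 * (R ^ 2 / lam ^ 2 * V) + θ ^ 2 * Q / (2 * lam) * V
      + 2 * (θ ^ 2 * R * B / (δ * lam) * V) + 2 * θ ^ 3 * B ^ 2 / (lam * δ ^ 2) * V
      ≤ γ / 2 * θ * (1 - θ * M) * V := by
  have h1 := mul_le_mul_of_nonneg_right (mul_le_mul_of_nonneg_left h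
    (by positivity : 0 ≤ θ / 2)) hV
  have h2 : θ / 2 * (θ * (Q + R ^ 2) / lam + 4 * θ * R * B / (δ * lam)
        + 4 * θ ^ 2 * B ^ 2 / (lam * δ ^ 2)) * V
      = lam / 2 * θ ^ 2 * (R ^ 2 / lam ^ 2 * V) + θ ^ 2 * Q / (2 * lam) * V
      + 2 * (θ ^ 2 * R * B / (δ * lam) * V) + 2 * θ ^ 3 * B ^ 2 / (lam * δ ^ 2) * V := by
    field_simp
    ring
  rw [h2] at h1
  linarith

/-- The compression noise, after weighting, splits into a part of the size of the Young cross term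
and a part cubic in θ. -/
theorem err_weight_identity {θ ρ lam R B δ V : ℝ} (hlam : 0 < lam) (hδ : 0 < δ)
    (hρB : 2 * (ρ * B) = δ * lam * R) :
    2 * (ρ + θ * lam) / δ * (θ ^ 2 / lam ^ 2 * (B ^ 2 / δ) * V)
      = θ ^ 2 * R * B / (δ * lam) * V + 2 * θ ^ 3 * B ^ 2 / (lam * δ ^ 2) * V := by
  have : 2 * (ρ + θ * lam) / δ * (θ ^ 2 / lam ^ 2 * (B ^ 2 / δ) * V)
      = (2 * (ρ * B)) * B * θ ^ 2 / (lam ^ 2 * δ ^ 2) * V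
        + 2 * θ ^ 3 * B ^ 2 / (lam * δ ^ 2) * V := by
    field_simp
  rw [this, hρB]
  field_simp

namespace Setup

noncomputable section

variable {d t m n : ℕ} (p : Setup d t m n)

/-- The weight of the squared errors in the Lyapunov function. -/
def errWeight : ℝ := 2 * (p.ρ + p.theta * p.lamK) / (p.del * n)

/-- The Lyapunov function with values in `[0, ∞]`. -/
def Φ (y : E d) (s : InnerState d t m n) : ℝ≥0∞ :=
  ENNReal.ofReal (p.Dstar y - p.Dr y s.α)
    + ENNReal.ofReal p.errWeight * ∑ τ, ENNReal.ofReal (‖s.e τ‖ ^ 2)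

/-- Properties shared by all states of the inner loop. -/
structure Inv (s : InnerState d t m n) : Prop where
  feas : p.Feas s.α
  v_eq : p.v s.α = s.u + (1 / (n : ℝ)) • ∑ τ, s.e τ

variable {p}

theorem errWeight_nonneg (h0 : 0 < p.del) (hl : 0 < p.lamK) (ht0 : 0 < p.theta) :
    0 ≤ p.errWeight := by
  have := p.ρ_nonneg h0 hl
  unfold errWeight
  positivity

theorem Inv.norm_sq_le (hn : 0 < n) {s : InnerState d t m n} (hs : p.Inv s) :
    ‖p.v s.α - s.u‖ ^ 2 ≤ (1 / (n : ℝ)) * ∑ τ, ‖s.e τ‖ ^ 2 := by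
  have hn' : (n : ℝ) ≠ 0 := by positivity
  rw [hs.v_eq, add_sub_cancel_left, norm_smul, mul_pow, Real.norm_eq_abs, sq_abs]
  have h := norm_sum_le Finset.univ s.e
  have h2 := sq_sum_le_card_mul_sum_sq (s := Finset.univ) (f := fun τ => ‖s.e τ‖)
  rw [Finset.card_univ, Fintype.card_fin] at h2
  calc _ ≤ (1 / (n : ℝ)) ^ 2 * (n * ∑ τ, ‖s.e τ‖ ^ 2) := by
        gcongr
        exact (pow_le_pow_left₀ (norm_nonneg _) h 2).trans h2
    _ = _ := by field_simp

theorem inv_innerInit {α : DualVar t m n} (hα : p.Feas α) : p.Inv (p.innerInit α) :=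
  ⟨hα, by simp [innerInit]⟩

/-- Whatever the compressor drops from a message stays in e, so u plus the mean error moves by the
uncompressed dual increment, for any Q. Feasibility persists because θm ≤ 1 makes the update a
convex combination. -/
theorem Regular.inv_innerStep (hp : p.Regular) (hm : 0 < m) (hn : 0 < n)
    (ha0 : 0 ≤ p.theta * m) (ha : p.theta * m ≤ 1) {S : Type*} (Q : S → E d → E d) (y : E d)
    (z : Fin n → Fin m × S) {s : InnerState d t m n} (hs : p.Inv s) :
    p.Inv (p.innerStep Q y z s) := by
  refine ⟨?_, ?_⟩
  · rw [innerStep_α]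
    exact hp.feas_updDual ha0 ha _ hs.feas _
  · have hm' : (m : ℝ) ≠ 0 := by positivity
    have hn' : (n : ℝ) ≠ 0 := by positivity
    rw [innerStep_α, updDual, v_add, hs.v_eq]
    simp only [innerStep]
    rw [add_assoc, add_assoc, ← smul_add, ← Finset.sum_add_distrib]
    simp only [add_sub_cancel, p.message_eq hm]
    rw [Finset.sum_add_distrib, smul_add, add_comm ((1 / (n : ℝ)) • ∑ τ, s.e τ)]
    congr 2
    rw [v, Finset.smul_sum, Finset.smul_sum]
    refine Finset.sum_congr rfl fun τ _ => ?_
    rw [Finset.sum_eq_single (z τ).1 (fun i _ hi => by simp [hi]) (by simp)]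
    simp only [if_true, map_smul, smul_smul, N]
    congr 1
    field_simp

/-- The Lyapunov function contracts in mean. -/
theorem Regular.mean_step_le (hp : p.Regular) (hk : 0 ≤ p.kap) (hm : 0 < m) (hn : 0 < n)
    (h0 : 0 < p.del) (h1 : p.del < 1) (ht0 : 0 < p.theta) (ht : p.theta ≤ p.theta0)
    (y : E d) {s : InnerState d t m n} (hs : p.Inv s) :
    (1 / (m : ℝ)) ^ n * ∑ σ : Fin n → Fin m,
        (p.Dstar y - p.Dr y (p.updDual (p.primal y s.u) s.α σ))
      + p.errWeight * ∑ τ, (1 - p.del)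
        * ((1 / (m : ℝ)) * ∑ i, ‖p.message (p.primal y s.u) s i τ‖ ^ 2)
      ≤ (1 - min p.theta (p.del / 4))
        * (p.Dstar y - p.Dr y s.α + p.errWeight * ∑ τ, ‖s.e τ‖ ^ 2) := by
  have hl := hp.lamK_pos hk
  have hg := hp.gam_pos
  have hm' : (m : ℝ) ≠ 0 := by positivity
  have hn' : (n : ℝ) ≠ 0 := by positivity
  have ha0 : 0 ≤ p.theta * m := by positivity
  have ha := p.theta_mul_m_le_one hm hg hl h0 ht0 ht
  have hρ := p.ρ_nonneg h0 hl
  have hR := p.R_nonneg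
  have hB := p.B_nonneg
  set x := p.primal y s.u with hx
  set V := p.meanSq x s.α with hV
  have hV0 : 0 ≤ V := p.meanSq_nonneg _ _
  set e0 := (1 / (n : ℝ)) * ∑ τ, ‖s.e τ‖ ^ 2 with he0
  have he00 : 0 ≤ e0 := by positivity
  set gap := p.Dstar y - p.Dr y s.α with hgap
  set a' := ‖p.v (p.dualPt x) - p.v s.α‖ with ha'
  set b := ‖p.v s.α - s.u‖ with hb
  have hgap0 : 0 ≤ gap := sub_nonneg.2 (hp.Dr_le_Dstar hk hm hn y hs.feas)
  have k1 : (1 / (m : ℝ)) ^ n * ∑ σ : Fin n → Fin m,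
        (p.Dstar y - p.Dr y (p.updDual x s.α σ))
      ≤ gap - p.theta * ((1 / p.N) * ∑ τ, ∑ i, p.incr y x s.α i τ)
        - p.gam / 2 * p.theta * (1 - p.theta * m) * V
        + p.lamK / 2 * p.theta ^ 2 * a' ^ 2
        + p.theta ^ 2 * (p.Rm ^ 2 / n) / (2 * p.lamK) * V := by
    have h := mul_le_mul_of_nonneg_left (hp.sum_gap_updDual_le hk hm hn ha0 ha y x hs.feas)
      (by positivity : 0 ≤ (1 / (m : ℝ)) ^ n)
    refine h.trans (le_of_eq ?_)
    rw [← mul_assoc, ← mul_pow, one_div_mul_cancel hm', one_pow, one_mul]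
  have k2 : p.errWeight * ∑ τ, (1 - p.del)
        * ((1 / (m : ℝ)) * ∑ i, ‖p.message x s i τ‖ ^ 2)
      ≤ 2 * (p.ρ + p.theta * p.lamK) / p.del * ((1 - p.del / 2) * e0
        + p.theta ^ 2 / p.lamK ^ 2 * (p.B ^ 2 / p.del) * V) := by
    calc _ ≤ p.errWeight * ∑ τ, ((1 - p.del / 2) * ‖s.e τ‖ ^ 2
          + p.theta ^ 2 / p.lamK ^ 2 * (p.B ^ 2 / p.del)
          * ((1 / (m : ℝ)) * ∑ i, ‖p.dualPt x i τ - s.α i τ‖ ^ 2)) :=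
        mul_le_mul_of_nonneg_left (Finset.sum_le_sum fun τ _ =>
          sum_norm_message_sq_le hm h0 h1 x s τ) (errWeight_nonneg h0 hl ht0)
      _ = _ := by
        rw [Finset.sum_add_distrib, ← Finset.mul_sum, ← Finset.mul_sum, ← Finset.mul_sum, he0,
          hV, meanSq, N, errWeight]
        field_simp
  have k3 := hp.le_sum_incr hk y s.u s.α
  rw [← hx, ← ha', ← hb] at k3
  have k4 := hs.norm_sq_le hn
  rw [← hb, ← he0] at k4
  have k5 := p.norm_v_dualPt_sub_sq_le hm hn hl x s.α
  rw [← ha', ← hV] at k5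
  have k6 := hp.Dstar_le_G hk hm hn y x
  have k7 := p.two_mul_ρ_mul_B hm hn h0 h1
  have k8 := p.stepsize_condition (n := n) hm hg hl h0 ht0 ht
  have k9 := cross_term_le hl h0 ht0 hR hB hρ k7 k4 k5
  have k10 : p.theta * (p.lamK / 2 * b ^ 2) ≤ p.theta * (p.lamK / 2 * e0) := by gcongr
  have k11 : p.lamK / 2 * p.theta ^ 2 * a' ^ 2
      ≤ p.lamK / 2 * p.theta ^ 2 * (p.R ^ 2 / p.lamK ^ 2 * V) := by gcongr
  have k12 := err_weight_identity (θ := p.theta) (V := V) hl h0 k7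
  have k13 := stepsize_combination hl h0 ht0 hV0 k8
  have k15 := mul_le_mul_of_nonneg_left k3 ht0.le
  set c := 2 * (p.ρ + p.theta * p.lamK) / p.del with hc
  have hc0 : 0 ≤ c := by positivity
  have k16 : p.errWeight * ∑ τ, ‖s.e τ‖ ^ 2 = c * e0 := by
    rw [hc, he0, errWeight]
    field_simp
  -- This fixes the weight 2(ρ + θ(λ+κ))/δ: half of the error decrease δ/2 pays exactly for the two
  -- perturbation terms of the dual step, and the remaining δ/4 is the contraction rate of the
  -- errors.
  have k17 : c * (p.del / 4) * e0 = p.ρ / 2 * e0 + p.theta * (p.lamK / 2 * e0) := by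
    rw [hc]
    field_simp
    ring
  -- By weak duality the duality gap gained dominates the dual gap, which gives the rate θ.
  have k18 : p.theta * gap ≤ p.theta * (p.G y x - p.Dr y s.α) :=
    mul_le_mul_of_nonneg_left (sub_le_sub_right k6 _) ht0.le
  have k19 : min p.theta (p.del / 4) * gap ≤ p.theta * gap :=
    mul_le_mul_of_nonneg_right (min_le_left _ _) hgap0
  have k20 : min p.theta (p.del / 4) * (c * e0) ≤ p.del / 4 * (c * e0) :=
    mul_le_mul_of_nonneg_right (min_le_right _ _) (mul_nonneg hc0 he00)
  rw [k16]
  linarith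

theorem measurable_err {S : Type*} [MeasurableSpace S] {Q : S → E d → E d}
    (hQ : Measurable fun z : S × E d => Q z.1 z.2) (w : Fin m → E d) :
    Measurable fun z : Fin m × S => ENNReal.ofReal (‖w z.1 - Q z.2 (w z.1)‖ ^ 2) := by
  have h1 : Measurable fun z : Fin m × S => w z.1 := (measurable_of_finite w).comp measurable_fst
  have h2 : Measurable fun z : Fin m × S => Q z.2 (w z.1) := hQ.comp (measurable_snd.prodMk h1)
  exact ((h1.sub h2).norm.pow_const 2).ennreal_ofReal

theorem lintegral_err_le {S : Type*} [MeasurableSpace S] {ν : Measure S} [IsProbabilityMeasure ν]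
    {Q : S → E d → E d} {del : ℝ} (hQ : IsContractionCompressor ν Q del) (h1 : del < 1)
    (w : Fin m → E d) :
    ∫⁻ z, ENNReal.ofReal (‖w z.1 - Q z.2 (w z.1)‖ ^ 2)
        ∂((uniformOn (Set.univ : Set (Fin m))).prod ν)
      ≤ ENNReal.ofReal ((1 - del) * ((1 / (m : ℝ)) * ∑ i, ‖w i‖ ^ 2)) := by
  rw [lintegral_uniform_prod ν (measurable_err hQ.measurable w)]
  calc _ ≤ ∑ i, ENNReal.ofReal (1 / (m : ℝ)) * ENNReal.ofReal ((1 - del) * ‖w i‖ ^ 2) := by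
        gcongr with i _
        exact hQ.contraction (w i)
    _ = _ := by
      have hd : 0 ≤ 1 - del := by linarith
      simp_rw [← ENNReal.ofReal_mul (by positivity : (0 : ℝ) ≤ 1 / m)]
      rw [← ENNReal.ofReal_sum_of_nonneg fun i _ => by positivity, ← Finset.mul_sum,
        ← Finset.mul_sum]
      congr 1
      ring

theorem lintegral_err_pi_le (hm : 0 < m) {S : Type*} [MeasurableSpace S] {ν : Measure S}
    [IsProbabilityMeasure ν] {Q : S → E d → E d} {del : ℝ}
    (hQ : IsContractionCompressor ν Q del) (h1 : del < 1) (τ : Fin n) (w : Fin m → E d) :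
    ∫⁻ z : Fin n → Fin m × S, ENNReal.ofReal (‖w (z τ).1 - Q (z τ).2 (w (z τ).1)‖ ^ 2)
        ∂(Measure.pi fun _ => (uniformOn (Set.univ : Set (Fin m))).prod ν)
      ≤ ENNReal.ofReal ((1 - del) * ((1 / (m : ℝ)) * ∑ i, ‖w i‖ ^ 2)) := by
  have : Nonempty (Fin m) := ⟨⟨0, hm⟩⟩
  have h := MeasurePreserving.lintegral_comp
    (measurePreserving_eval (fun _ : Fin n => (uniformOn (Set.univ : Set (Fin m))).prod ν) τ)
    (measurable_err hQ.measurable w)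
  exact (le_of_eq h).trans (lintegral_err_le hQ h1 w)

/-- One iteration contracts the Lyapunov function in expectation. -/
theorem Regular.lintegral_innerStep_le (hp : p.Regular) (hk : 0 ≤ p.kap) (hm : 0 < m)
    (hn : 0 < n) (h0 : 0 < p.del) (h1 : p.del < 1) (ht0 : 0 < p.theta) (ht : p.theta ≤ p.theta0)
    {S : Type*} [MeasurableSpace S] {ν : Measure S} [IsProbabilityMeasure ν]
    {Q : S → E d → E d} (hQ : IsContractionCompressor ν Q p.del)
    (y : E d) {s : InnerState d t m n} (hs : p.Inv s) :
    ∫⁻ z : Fin n → Fin m × S, p.Φ y (p.innerStep Q y z s)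
        ∂(Measure.pi fun _ => (uniformOn (Set.univ : Set (Fin m))).prod ν)
      ≤ ENNReal.ofReal (1 - min p.theta (p.del / 4)) * p.Φ y s := by
  have hl := hp.lamK_pos hk
  have ha0 : 0 ≤ p.theta * m := by positivity
  have ha := p.theta_mul_m_le_one hm hp.gam_pos hl h0 ht0 ht
  have : Nonempty (Fin m) := ⟨⟨0, hm⟩⟩
  have hW := errWeight_nonneg (n := n) h0 hl ht0
  set x := p.primal y s.u with hx
  have hgap : ∀ σ, 0 ≤ p.Dstar y - p.Dr y (p.updDual x s.α σ) := fun σ =>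
    sub_nonneg.2 (hp.Dr_le_Dstar hk hm hn y (hp.feas_updDual ha0 ha x hs.feas σ))
  have hmeas : ∀ τ, Measurable fun z : Fin n → Fin m × S => ENNReal.ofReal
      (‖p.message x s (z τ).1 τ - Q (z τ).2 (p.message x s (z τ).1 τ)‖ ^ 2) := fun τ =>
    (measurable_err hQ.measurable fun i => p.message x s i τ).comp (measurable_pi_apply τ)
  simp only [Φ, innerStep_α, ← hx]
  simp only [innerStep, ← hx]
  -- The dual gap depends only on the sampled indices and each error only on its own node's pair, so
  -- every term is integrated over its own marginal.
  rw [lintegral_add_right _ ((Finset.measurable_sum _ fun τ _ => hmeas τ).const_mul _),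
    lintegral_uniform_pi hm ν _ hgap,
    lintegral_const_mul _ (Finset.measurable_sum _ fun τ _ => hmeas τ),
    lintegral_finsetSum _ fun τ _ => hmeas τ]
  have hd : 0 ≤ 1 - p.del := by linarith
  refine (add_le_add_right (mul_le_mul_right (Finset.sum_le_sum fun τ _ =>
    lintegral_err_pi_le hm hQ h1 τ fun i => p.message x s i τ) _) _).trans ?_
  have hgs : 0 ≤ p.Dstar y - p.Dr y s.α := sub_nonneg.2 (hp.Dr_le_Dstar hk hm hn y hs.feas)
  have hη : 0 ≤ 1 - min p.theta (p.del / 4) := by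
    have := min_le_right p.theta (p.del / 4)
    linarith
  exact ofReal_add_mul_sum_le (mul_nonneg (by positivity) (Finset.sum_nonneg fun σ _ => hgap σ))
    hgs hW hη (fun τ => mul_nonneg hd (by positivity)) (fun τ => sq_nonneg _)
    (hp.mean_step_le hk hm hn h0 h1 ht0 ht y hs)

end

end Setup

end ECCatalyst

/-! ### Measurability of the iterates and of the stopping criterion -/

namespace ECCatalyst

instance {d t m n : ℕ} : MeasurableSpace (InnerState d t m n) :=
  MeasurableSpace.comap (fun s => (s.α, s.e, s.u)) inferInstance

theorem measurable_innerState_iff {d t m n : ℕ} {Ω : Type*} [MeasurableSpace Ω]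
    {f : Ω → InnerState d t m n} :
    Measurable f ↔ (Measurable fun ω => (f ω).α) ∧ (Measurable fun ω => (f ω).e)
      ∧ Measurable fun ω => (f ω).u := by
  rw [measurable_comap_iff]
  refine ⟨fun h => ⟨measurable_fst.comp h, (measurable_fst.comp measurable_snd).comp h,
    (measurable_snd.comp measurable_snd).comp h⟩, fun h => h.1.prodMk (h.2.1.prodMk h.2.2)⟩

theorem measurable_pair_comp {Ω α β γ : Type*} [MeasurableSpace Ω] [MeasurableSpace α]
    [MeasurableSpace β] [MeasurableSpace γ] {f : α → β → γ}
    (hf : Measurable fun w : α × β => f w.1 w.2) {a : Ω → α} {b : Ω → β} (ha : Measurable a)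
    (hb : Measurable b) : Measurable fun ω => f (a ω) (b ω) :=
  hf.comp (ha.prodMk hb)

theorem measurable_state_α {d t m n : ℕ} (i : Fin m) (τ : Fin n) :
    Measurable fun s : InnerState d t m n => s.α i τ := by
  have h : Measurable fun s : InnerState d t m n => s.α :=
    (measurable_innerState_iff.1 measurable_id).1
  fun_prop

theorem measurable_state_e {d t m n : ℕ} (τ : Fin n) :
    Measurable fun s : InnerState d t m n => s.e τ := by
  have h : Measurable fun s : InnerState d t m n => s.e :=
    (measurable_innerState_iff.1 measurable_id).2.1
  fun_prop

theorem measurable_state_u {d t m n : ℕ} : Measurable fun s : InnerState d t m n => s.u :=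
  (measurable_innerState_iff.1 measurable_id).2.2

theorem measurable_sInf_nat {Ω : Type*} [MeasurableSpace Ω] {P : ℕ → Ω → Prop}
    (hP : ∀ K, MeasurableSet {ω | P K ω}) : Measurable fun ω => sInf {K | P K ω} := by
  refine measurable_to_countable' fun k => ?_
  -- The second set matters only for k = 0: it collects the points where no index qualifies, since
  -- `sInf ∅ = 0`.
  have e : (fun ω => sInf {K | P K ω}) ⁻¹' {k}
      = ({ω | P k ω} ∩ ⋂ j ∈ Set.Iio k, {ω | P j ω}ᶜ)
        ∪ ({_ω | k = 0} ∩ ⋂ j, {ω | P j ω}ᶜ) := by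
    ext ω
    have hmem : ∀ j, j ∈ {K | P K ω} ↔ P j ω := fun j => Iff.rfl
    simp only [Set.mem_preimage, Set.mem_singleton_iff, Set.mem_union, Set.mem_inter_iff,
      Set.mem_ofPred_eq, Set.mem_iInter, Set.mem_compl_iff, Set.mem_Iio]
    generalize {K | P K ω} = A at hmem
    simp only [← hmem]
    constructor
    · intro h
      rcases Set.eq_empty_or_nonempty A with h1 | h1
      · right
        rw [h1, Nat.sInf_empty] at h
        exact ⟨h.symm, fun j => h1 ▸ Set.notMem_empty j⟩
      · left
        refine ⟨h ▸ Nat.sInf_mem h1, fun j hj => Nat.notMem_of_lt_sInf (h.symm ▸ hj)⟩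
    · rintro (⟨h1, h2⟩ | ⟨h1, h2⟩)
      · refine le_antisymm (Nat.sInf_le h1) ?_
        by_contra! h
        exact h2 _ h (Nat.sInf_mem ⟨k, h1⟩)
      · rw [Set.eq_empty_iff_forall_notMem.2 h2, Nat.sInf_empty, h1]
  rw [e]
  exact ((hP k).inter (MeasurableSet.biInter (Set.to_countable _) fun j _ => (hP j).compl)).union
    ((MeasurableSet.const _).inter (MeasurableSet.iInter fun j => (hP j).compl))

theorem measurable_toReal_conj {d : ℕ} (f : E d → ℝ) : Measurable fun a => (conj f a).toReal := by
  have h : LowerSemicontinuous (conj f) := by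
    have : conj f = fun u => ⨆ x : E d, ((inner ℝ u x - f x : ℝ) : EReal) := rfl
    rw [this]
    refine lowerSemicontinuous_iSup fun x => Continuous.lowerSemicontinuous ?_
    exact continuous_coe_real_ereal.comp (by fun_prop)
  exact h.measurable.ereal_toReal

namespace Setup

noncomputable section

variable {d t m n : ℕ} {p : Setup d t m n}

/-- Adding the growth inequalities at both maximisers leaves ⟨u' - u, x' - x⟩ + (κ/(λ+κ))⟨x' - x, y'
- y⟩, and κ/(λ+κ) ≤ 1. Joint continuity is needed because the prox-centre is random too. -/
theorem Regular.norm_primal_sub_le' (hp : p.Regular) (hk : 0 ≤ p.kap) (y y' u u' : E d) :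
    ‖p.primal y' u' - p.primal y u‖ ≤ ‖u' - u‖ + ‖y' - y‖ := by
  have hl := hp.lamK_pos hk
  set x := p.primal y u with hx
  set x' := p.primal y' u' with hx'
  have h1 := hp.primal_spec hk y u x'
  have h2 := hp.primal_spec hk y' u' x
  rw [norm_sub_rev, ← hx'] at h2
  rw [← hx] at h1
  have h3 : p.ξ y x' - p.ξ y x - p.ξ y' x' + p.ξ y' x
      = p.kap / p.lamK * Inner.inner ℝ (x' - x) (y' - y) := by
    simp only [ξ, norm_sub_sq_real, inner_sub_left, inner_sub_right]
    field_simp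
    ring
  have h4 : p.kap / p.lamK * Inner.inner ℝ (x' - x) (y' - y) ≤ ‖x' - x‖ * ‖y' - y‖ := by
    have h5 : p.kap / p.lamK ≤ 1 := by
      rw [div_le_one hl, lamK]
      linarith [hp.lam_pos]
    have h6 := real_inner_le_norm (x' - x) (y' - y)
    have h7 : 0 ≤ p.kap / p.lamK := by positivity
    calc _ ≤ p.kap / p.lamK * (‖x' - x‖ * ‖y' - y‖) := mul_le_mul_of_nonneg_left h6 h7
      _ ≤ _ := mul_le_of_le_one_left (by positivity) h5
  have h8 := real_inner_le_norm (u' - u) (x' - x)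
  have h9 : Inner.inner ℝ (u' - u) (x' - x) = Inner.inner ℝ u' x' - Inner.inner ℝ u' x
      - Inner.inner ℝ u x' + Inner.inner ℝ u x := by
    rw [inner_sub_left, inner_sub_right, inner_sub_right]; ring
  by_contra! h
  have h10 : 0 < ‖x' - x‖ := by
    have := norm_nonneg (u' - u)
    have := norm_nonneg (y' - y)
    linarith
  nlinarith

theorem Regular.continuous_primal (hp : p.Regular) (hk : 0 ≤ p.kap) :
    Continuous fun w : E d × E d => p.primal w.1 w.2 := by
  refine (LipschitzWith.of_dist_le_mul (K := 2) fun w w' => ?_).continuous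
  rw [dist_eq_norm, Prod.dist_eq, dist_eq_norm, dist_eq_norm]
  have h1 := hp.norm_primal_sub_le' hk w'.1 w.1 w'.2 w.2
  have h2 := le_max_left ‖w.1 - w'.1‖ ‖w.2 - w'.2‖
  have h3 := le_max_right ‖w.1 - w'.1‖ ‖w.2 - w'.2‖
  push_cast
  linarith

theorem Regular.continuous_g (hp : p.Regular) : Continuous p.g :=
  strongConvexOn_continuous hp.lam_pos.le hp.g_strong

theorem Regular.continuous_ξ (hp : p.Regular) :
    Continuous fun w : E d × E d => p.ξ w.1 w.2 := by
  have := hp.continuous_g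
  unfold ξ
  fun_prop

theorem Regular.continuous_ξc (hp : p.Regular) (hk : 0 ≤ p.kap) :
    Continuous fun w : E d × E d => p.ξc w.1 w.2 := by
  have h1 := hp.continuous_primal hk
  have h2 : Continuous fun w : E d × E d => p.ξ w.1 (p.primal w.1 w.2) :=
    hp.continuous_ξ.comp (continuous_fst.prodMk h1)
  simp_rw [hp.ξc_eq hk]
  fun_prop

theorem Regular.continuous_grad (hp : p.Regular) (i : Fin m) (τ : Fin n) :
    Continuous fun x => ∇ (p.φ i τ) x := by
  have hg := hp.gam_pos
  refine (LipschitzWith.of_dist_le_mul (K := ⟨1 / p.gam, by positivity⟩) fun w w' => ?_).continuous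
  rw [dist_eq_norm, dist_eq_norm]
  exact hp.φ_smooth i τ w w'

theorem Regular.continuous_dualPt (hp : p.Regular) (i : Fin m) (τ : Fin n) :
    Continuous fun x => p.dualPt x i τ := by
  have := hp.continuous_grad i τ
  unfold dualPt
  fun_prop

theorem Regular.continuous_P (hp : p.Regular) : Continuous p.P := by
  have h1 := hp.continuous_g
  have h2 : ∀ i τ, Continuous (p.φ i τ) := fun i τ => (hp.φ_diff i τ).continuous
  unfold P
  fun_prop

theorem Regular.continuous_G (hp : p.Regular) :
    Continuous fun w : E d × E d => p.G w.1 w.2 := by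
  have := hp.continuous_P
  unfold G
  fun_prop

variable (p) in
theorem continuous_v : Continuous p.v := by
  unfold v
  fun_prop

theorem measurable_φc (i : Fin m) (τ : Fin n) : Measurable (p.φc i τ) :=
  measurable_toReal_conj (p.φ i τ)

theorem Regular.measurable_Dr (hp : p.Regular) (hk : 0 ≤ p.kap) :
    Measurable fun w : E d × DualVar t m n => p.Dr w.1 w.2 := by
  have h0 : ∀ i τ, Measurable fun w : E d × DualVar t m n => -w.2 i τ := fun i τ => by fun_prop
  have h1 : ∀ i τ, Measurable fun w : E d × DualVar t m n => p.φc i τ (-w.2 i τ) := fun i τ =>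
    (measurable_φc i τ).comp (h0 i τ)
  have h2 : Measurable fun w : E d × DualVar t m n => p.ξc w.1 (p.v w.2) :=
    measurable_pair_comp (hp.continuous_ξc hk).measurable measurable_fst
      (p.continuous_v.measurable.comp measurable_snd)
  have h4 : Measurable fun w : E d × DualVar t m n => ∑ τ, ∑ i, p.φc i τ (-w.2 i τ) :=
    Finset.measurable_sum _ fun τ _ => Finset.measurable_sum _ fun i _ => h1 i τ
  exact (h4.const_mul (1 / p.N)).neg.sub (h2.const_mul p.lamK)

/-- The supremum is uncountable, so semicontinuity replaces measurability: feasibility of β does not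
depend on y, so each function of y in the supremum is continuous and real, or constantly -∞. -/
theorem Regular.measurable_Dstar (hp : p.Regular) (hk : 0 ≤ p.kap) (hm : 0 < m) (hn : 0 < n) :
    Measurable p.Dstar := by
  have h : LowerSemicontinuous fun y => ⨆ β, p.D y β := by
    refine lowerSemicontinuous_iSup fun β => Continuous.lowerSemicontinuous ?_
    by_cases hβ : p.Feas β
    · simp_rw [hp.D_eq hk _ hβ]
      refine continuous_coe_real_ereal.comp ?_
      have h := (hp.continuous_ξc hk).comp (continuous_id.prodMk (continuous_const (y := p.v β)))
      have h1 : Continuous fun y => p.ξc y (p.v β) := h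
      exact continuous_const.sub (h1.const_mul p.lamK)
    · simp_rw [D_eq_bot hm hn _ hβ]
      exact continuous_const
  exact h.measurable.ereal_toReal

theorem Regular.bddBelow_G (hp : p.Regular) (hk : 0 ≤ p.kap) (hm : 0 < m) (hn : 0 < n) (y : E d) :
    BddBelow (Set.range (p.G y)) :=
  ⟨p.Dstar y, by rintro _ ⟨x, rfl⟩; exact hp.Dstar_le_G hk hm hn y x⟩

theorem Regular.Gstar_le (hp : p.Regular) (hk : 0 ≤ p.kap) (hm : 0 < m) (hn : 0 < n)
    (y x : E d) : p.Gstar y ≤ p.G y x :=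
  ciInf_le (hp.bddBelow_G hk hm hn y) x

theorem Regular.Dstar_le_Gstar (hp : p.Regular) (hk : 0 ≤ p.kap) (hm : 0 < m) (hn : 0 < n)
    (y : E d) : p.Dstar y ≤ p.Gstar y :=
  le_ciInf (hp.Dstar_le_G hk hm hn y)

theorem Regular.measurable_Gstar (hp : p.Regular) (hk : 0 ≤ p.kap) (hm : 0 < m) (hn : 0 < n) :
    Measurable p.Gstar := by
  refine UpperSemicontinuous.measurable ?_
  refine upperSemicontinuous_ciInf (f := fun x y => p.G y x) (hp.bddBelow_G hk hm hn) fun x => ?_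
  have h := hp.continuous_G.comp (continuous_id.prodMk (continuous_const (y := x)))
  exact h.upperSemicontinuous

variable (p) in
/-- The left-hand side of the stopping criterion, as a real number. -/
def stopVal (y : E d) (s : InnerState d t m n) : ℝ :=
  Real.sqrt (4 * n + p.del * m * n)
      * (p.Dstar y - p.Dr y s.α + p.errWeight * ∑ τ, ‖s.e τ‖ ^ 2)
    + 2 * (p.G y (p.primal y s.u) - p.Gstar y)

theorem Regular.stops_iff (hp : p.Regular) (hk : 0 ≤ p.kap) (hm : 0 < m) (hn : 0 < n)
    (y : E d) (ε : ℝ) {s : InnerState d t m n} (hs : p.Feas s.α) :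
    p.Stops y ε s ↔ p.stopVal y s ≤ ε := by
  rw [Stops, Ψ₃, hp.dualGap_eq hk hm hn y hs, ← EReal.coe_le_coe_iff, stopVal, errWeight]
  push_cast
  rfl

theorem Regular.measurable_gap (hp : p.Regular) (hk : 0 ≤ p.kap) (hm : 0 < m) (hn : 0 < n) :
    Measurable fun w : E d × InnerState d t m n => p.Dstar w.1 - p.Dr w.1 w.2.α := by
  have h1 : Measurable fun w : E d × InnerState d t m n => w.2.α :=
    (measurable_innerState_iff.1 measurable_id).1.comp measurable_snd
  have h2 : Measurable fun w : E d × InnerState d t m n => p.Dr w.1 w.2.α :=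
    measurable_pair_comp (hp.measurable_Dr hk) measurable_fst h1
  have h3 : Measurable fun w : E d × InnerState d t m n => p.Dstar w.1 :=
    (hp.measurable_Dstar hk hm hn).comp measurable_fst
  exact h3.sub h2

theorem measurable_err_sq (τ : Fin n) :
    Measurable fun w : E d × InnerState d t m n => ‖w.2.e τ‖ ^ 2 := by
  have h : Measurable fun w : E d × InnerState d t m n => w.2.e τ :=
    (measurable_state_e τ).comp measurable_snd
  exact h.norm.pow_const 2

theorem Regular.measurable_Φ (hp : p.Regular) (hk : 0 ≤ p.kap) (hm : 0 < m) (hn : 0 < n) :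
    Measurable fun w : E d × InnerState d t m n => p.Φ w.1 w.2 := by
  have h : Measurable fun w : E d × InnerState d t m n => ∑ τ, ENNReal.ofReal (‖w.2.e τ‖ ^ 2) :=
    Finset.measurable_sum _ fun τ _ => (measurable_err_sq τ).ennreal_ofReal
  exact (hp.measurable_gap hk hm hn).ennreal_ofReal.add (h.const_mul _)

theorem Regular.measurable_primal_state (hp : p.Regular) (hk : 0 ≤ p.kap) :
    Measurable fun w : E d × InnerState d t m n => p.primal w.1 w.2.u :=
  measurable_pair_comp (hp.continuous_primal hk).measurable measurable_fst
    (measurable_state_u.comp measurable_snd)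

theorem Regular.measurable_stopVal (hp : p.Regular) (hk : 0 ≤ p.kap) (hm : 0 < m) (hn : 0 < n) :
    Measurable fun w : E d × InnerState d t m n => p.stopVal w.1 w.2 := by
  have h1 : Measurable fun w : E d × InnerState d t m n => ∑ τ, ‖w.2.e τ‖ ^ 2 :=
    Finset.measurable_sum _ fun τ _ => measurable_err_sq τ
  have h2 : Measurable fun w : E d × InnerState d t m n => p.G w.1 (p.primal w.1 w.2.u) :=
    measurable_pair_comp hp.continuous_G.measurable measurable_fst (hp.measurable_primal_state hk)
  have h3 : Measurable fun w : E d × InnerState d t m n => p.Gstar w.1 :=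
    (hp.measurable_Gstar hk hm hn).comp measurable_fst
  exact (((hp.measurable_gap hk hm hn).add (h1.const_mul _)).const_mul _).add
    ((h2.sub h3).const_mul 2)

theorem Regular.measurable_Δα (hp : p.Regular) (hk : 0 ≤ p.kap) (i : Fin m) (τ : Fin n) :
    Measurable fun w : E d × InnerState d t m n => p.Δα (p.primal w.1 w.2.u) w.2.α i τ := by
  simp_rw [Δα_eq]
  have h1 : Measurable fun w : E d × InnerState d t m n => p.dualPt (p.primal w.1 w.2.u) i τ :=
    (hp.continuous_dualPt i τ).measurable.comp (hp.measurable_primal_state hk)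
  have h2 : Measurable fun w : E d × InnerState d t m n => w.2.α i τ :=
    (measurable_state_α i τ).comp measurable_snd
  exact (h1.sub h2).const_smul (p.theta * m)

theorem Regular.measurable_message (hp : p.Regular) (hk : 0 ≤ p.kap) (i : Fin m) (τ : Fin n) :
    Measurable fun w : E d × InnerState d t m n => p.message (p.primal w.1 w.2.u) w.2 i τ := by
  have h1 : Measurable fun w : E d × InnerState d t m n =>
      p.A i τ (p.Δα (p.primal w.1 w.2.u) w.2.α i τ) :=
    (p.A i τ).measurable.comp (hp.measurable_Δα hk i τ)
  have h2 : Measurable fun w : E d × InnerState d t m n => w.2.e τ :=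
    (measurable_state_e τ).comp measurable_snd
  exact (h1.const_smul (1 / (p.lamK * m))).add h2

section InnerStep

variable {S : Type*} [MeasurableSpace S]

theorem measurable_sample (τ : Fin n) :
    Measurable fun w : (E d × InnerState d t m n) × (Fin n → Fin m × S) => w.2 τ :=
  (measurable_pi_apply τ).comp measurable_snd

theorem Regular.measurable_sampled_message (hp : p.Regular) (hk : 0 ≤ p.kap) (τ : Fin n) :
    Measurable fun w : (E d × InnerState d t m n) × (Fin n → Fin m × S) =>
      p.message (p.primal w.1.1 w.1.2.u) w.1.2 (w.2 τ).1 τ := by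
  have h1 : Measurable fun w : Fin m × (E d × InnerState d t m n) =>
      p.message (p.primal w.2.1 w.2.2.u) w.2.2 w.1 τ :=
    measurable_from_prod_countable_right fun i => hp.measurable_message hk i τ
  have h2 : Measurable fun w : (E d × InnerState d t m n) × (Fin n → Fin m × S) => (w.2 τ).1 :=
    measurable_fst.comp (measurable_sample τ)
  exact measurable_pair_comp
    (f := fun (i : Fin m) (w : E d × InnerState d t m n) =>
      p.message (p.primal w.1 w.2.u) w.2 i τ) h1 h2 measurable_fst

variable {Q : S → E d → E d}

theorem Regular.measurable_compressed (hp : p.Regular) (hk : 0 ≤ p.kap)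
    (hQ : Measurable fun z : S × E d => Q z.1 z.2) (τ : Fin n) :
    Measurable fun w : (E d × InnerState d t m n) × (Fin n → Fin m × S) =>
      Q (w.2 τ).2 (p.message (p.primal w.1.1 w.1.2.u) w.1.2 (w.2 τ).1 τ) := by
  have h2 : Measurable fun w : (E d × InnerState d t m n) × (Fin n → Fin m × S) => (w.2 τ).2 :=
    measurable_snd.comp (measurable_sample τ)
  exact measurable_pair_comp hQ h2 (hp.measurable_sampled_message hk τ)

theorem Regular.measurable_innerStep (hp : p.Regular) (hk : 0 ≤ p.kap)
    (hQ : Measurable fun z : S × E d => Q z.1 z.2) :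
    Measurable fun w : (E d × InnerState d t m n) × (Fin n → Fin m × S) =>
      p.innerStep Q w.1.1 w.2 w.1.2 := by
  refine measurable_innerState_iff.2 ⟨?_, ?_, ?_⟩
  · refine measurable_pi_lambda _ fun i => measurable_pi_lambda _ fun τ => ?_
    have h1 : Measurable fun w : (E d × InnerState d t m n) × (Fin n → Fin m × S) =>
        w.1.2.α i τ := (measurable_state_α i τ).comp (measurable_snd.comp measurable_fst)
    have h2 : Measurable fun w : (E d × InnerState d t m n) × (Fin n → Fin m × S) =>
        p.Δα (p.primal w.1.1 w.1.2.u) w.1.2.α i τ :=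
      (hp.measurable_Δα hk i τ).comp measurable_fst
    have h3 : MeasurableSet
        {w : (E d × InnerState d t m n) × (Fin n → Fin m × S) | i = (w.2 τ).1} :=
      measurableSet_eq_fun measurable_const (measurable_fst.comp (measurable_sample τ))
    exact Measurable.ite h3 (h1.add h2) h1
  · refine measurable_pi_lambda _ fun τ => ?_
    exact (hp.measurable_sampled_message hk τ).sub (hp.measurable_compressed hk hQ τ)
  · have h1 : Measurable fun w : (E d × InnerState d t m n) × (Fin n → Fin m × S) => w.1.2.u :=
      measurable_state_u.comp (measurable_snd.comp measurable_fst)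
    have h2 : Measurable fun w : (E d × InnerState d t m n) × (Fin n → Fin m × S) =>
        ∑ τ, Q (w.2 τ).2 (p.message (p.primal w.1.1 w.1.2.u) w.1.2 (w.2 τ).1 τ) :=
      Finset.measurable_sum _ fun τ _ => hp.measurable_compressed hk hQ τ
    exact h1.add (h2.const_smul (1 / (n : ℝ)))

end InnerStep

section Trajectory

variable {S : Type*} {Q : S → E d → E d}

theorem Regular.inv_inner (hp : p.Regular) (hm : 0 < m) (hn : 0 < n)
    (ha0 : 0 ≤ p.theta * m) (ha : p.theta * m ≤ 1) (y : E d) {α : DualVar t m n}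
    (hα : p.Feas α) (z : ℕ → Fin n → Fin m × S) (K : ℕ) : p.Inv (p.inner Q y α z K) := by
  induction K with
  | zero => exact inv_innerInit hα
  | succ K ih => exact hp.inv_innerStep hm hn ha0 ha Q y (z K) ih

variable [MeasurableSpace S] {Ω : Type*} {mΩ : MeasurableSpace Ω}

theorem Regular.measurable_inner (hp : p.Regular) (hk : 0 ≤ p.kap)
    (hQ : Measurable fun z : S × E d => Q z.1 z.2) {y : Ω → E d} (hy : Measurable y)
    {α : Ω → DualVar t m n} (hα : Measurable α) {z : Ω → ℕ → Fin n → Fin m × S} (K : ℕ)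
    (hz : ∀ j < K, Measurable fun ω => z ω j) :
    Measurable fun ω => p.inner Q (y ω) (α ω) (z ω) K := by
  induction K with
  | zero =>
    exact measurable_innerState_iff.2 ⟨hα, measurable_const, p.continuous_v.measurable.comp hα⟩
  | succ K ih =>
    exact measurable_pair_comp
      (f := fun (w : E d × InnerState d t m n) z => p.innerStep Q w.1 z w.2)
      (hp.measurable_innerStep hk hQ) (hy.prodMk (ih fun j hj => hz j (by omega)))
      (hz K (by omega))

end Trajectory

end

end Setup

end ECCatalyst

/-! ### Expected stopping time from the contraction -/

namespace ECCatalyst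

theorem iInf_coe_of_nonempty {A : Set ℕ} (hA : A.Nonempty) :
    (⨅ K ∈ A, (K : ℕ∞)) = ((sInf A : ℕ) : ℕ∞) :=
  le_antisymm (iInf₂_le (sInf A) (Nat.sInf_mem hA))
    (le_iInf₂ fun _ hK => Nat.cast_le.2 (Nat.sInf_le hK))

theorem toNat_iInf_coe (A : Set ℕ) : (⨅ K ∈ A, (K : ℕ∞)).toNat = sInf A := by
  rcases A.eq_empty_or_nonempty with rfl | hA
  · simp
  · rw [iInf_coe_of_nonempty hA, ENat.toNat_natCast]

/-- Every index from K0 up to the first success after it contributes 1; if there is none the series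
is infinite. Monotonicity of P is not needed. -/
theorem toENNReal_iInf_le (P : ℕ → Prop) [DecidablePred P] {K0 : ℕ} (hK0 : 1 ≤ K0) :
    ((⨅ K ∈ {K : ℕ | 1 ≤ K ∧ P K}, (K : ℕ∞) : ℕ∞) : ℝ≥0∞)
      ≤ K0 + ∑' j, if P (K0 + j) then (0 : ℝ≥0∞) else 1 := by
  by_cases h : ∃ j, P (K0 + j)
  · have h1 : (⨅ K ∈ {K : ℕ | 1 ≤ K ∧ P K}, (K : ℕ∞)) ≤ ((K0 + Nat.find h : ℕ) : ℕ∞) :=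
      iInf₂_le (K0 + Nat.find h) ⟨by omega, Nat.find_spec h⟩
    have h2 := ENat.toENNReal_le.2 h1
    rw [ENat.toENNReal_coe] at h2
    refine h2.trans ?_
    push_cast
    gcongr
    calc ((Nat.find h : ℕ) : ℝ≥0∞)
        = ∑ j ∈ Finset.range (Nat.find h), if P (K0 + j) then (0 : ℝ≥0∞) else 1 := by
          rw [Finset.sum_congr rfl fun j hj =>
            if_neg (Nat.find_min h (Finset.mem_range.1 hj))]
          simp
      _ ≤ _ := ENNReal.sum_le_tsum _
  · push Not at h
    have : (∑' j, if P (K0 + j) then (0 : ℝ≥0∞) else 1) = ⊤ := by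
      simp_rw [if_neg (h _)]
      exact ENNReal.tsum_const_eq_top_of_ne_zero one_ne_zero
    rw [this]
    simp

/-- Freezing: independence makes the joint law a product, so Z can be integrated out with X held
fixed. -/
theorem lintegral_le_of_indepFun {Ω α β : Type*} [MeasurableSpace Ω] [MeasurableSpace α]
    [MeasurableSpace β] {μ : Measure Ω} [IsProbabilityMeasure μ] {X : Ω → α} {Z : Ω → β}
    (hX : Measurable X) (hZ : Measurable Z) (hXZ : IndepFun X Z μ) {F : α → β → ℝ≥0∞}
    (hF : Measurable fun w : α × β => F w.1 w.2) {G : Ω → ℝ≥0∞}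
    (h : ∀ ω, ∫⁻ z, F (X ω) z ∂(μ.map Z) ≤ G ω) :
    ∫⁻ ω, F (X ω) (Z ω) ∂μ ≤ ∫⁻ ω, G ω ∂μ := by
  have h1 : ∫⁻ ω, F (X ω) (Z ω) ∂μ = ∫⁻ w, F w.1 w.2 ∂(μ.map fun ω => (X ω, Z ω)) :=
    (lintegral_map hF (hX.prodMk hZ)).symm
  have : IsProbabilityMeasure (μ.map Z) := Measure.isProbabilityMeasure_map hZ.aemeasurable
  rw [h1, (indepFun_iff_map_prod_eq_prod_map_map hX.aemeasurable hZ.aemeasurable).1 hXZ,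
    lintegral_prod _ hF.aemeasurable, lintegral_map hF.lintegral_prod_right' hX]
  exact lintegral_mono h

/-- Take ⌈log A / η⌉ + 1 and use 1 - η ≤ exp(-η). The extra 1 ensures K ≥ 1, as the stopping rule
demands. -/
theorem exists_pow_le {η A : ℝ} (hη0 : 0 < η) (hη1 : η ≤ 1) (hA : 1 ≤ A) :
    ∃ K : ℕ, 1 ≤ K ∧ A * (1 - η) ^ K ≤ 1 ∧ (K : ℝ) ≤ (Real.log A + 2) / η := by
  have hlog := Real.log_nonneg hA
  refine ⟨⌈Real.log A / η⌉₊ + 1, by omega, ?_, ?_⟩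
  · have h1 : Real.log A ≤ η * (⌈Real.log A / η⌉₊ + 1 : ℕ) := by
      have := Nat.le_ceil (Real.log A / η)
      rw [div_le_iff₀ hη0] at this
      push_cast
      linarith
    have h2 : (1 - η) ^ (⌈Real.log A / η⌉₊ + 1) ≤ Real.exp (-Real.log A) := by
      have h3 : 1 - η ≤ Real.exp (-η) := by linarith [Real.add_one_le_exp (-η)]
      calc _ ≤ Real.exp (-η) ^ (⌈Real.log A / η⌉₊ + 1) :=
            pow_le_pow_left₀ (by linarith) h3 _
        _ = Real.exp (((⌈Real.log A / η⌉₊ + 1 : ℕ) : ℝ) * -η) := (Real.exp_nat_mul _ _).symm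
        _ ≤ _ := Real.exp_le_exp.2 (by linarith)
    rw [Real.exp_neg, Real.exp_log (by linarith)] at h2
    calc _ ≤ A * A⁻¹ := mul_le_mul_of_nonneg_left h2 (by linarith)
      _ = 1 := mul_inv_cancel₀ (by linarith)
  · have h1 := Nat.ceil_lt_add_one (div_nonneg hlog hη0.le)
    have h2 : 1 ≤ 1 / η := by rw [le_div_iff₀ hη0]; linarith
    have h3 : (Real.log A + 2) / η = Real.log A / η + 2 * (1 / η) := by ring
    push_cast
    linarith

theorem tsum_ofReal_geometric {η : ℝ} (hη0 : 0 < η) (hη1 : η ≤ 1) :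
    ∑' j : ℕ, ENNReal.ofReal (1 - η) ^ j = ENNReal.ofReal (1 / η) := by
  rw [ENNReal.tsum_geometric, ← ENNReal.ofReal_one, ← ENNReal.ofReal_sub _ (by linarith),
    sub_sub_cancel, one_div, ENNReal.ofReal_inv_of_pos hη0]

namespace Setup

noncomputable section

variable {d t m n : ℕ} {p : Setup d t m n}

section Outer

variable {S : Type*} {Q : S → E d → E d}

theorem feas_zero (hb : ∀ i τ, BddBelow (Set.range (p.φ i τ))) : p.Feas fun _ _ => 0 := by
  intro i τ
  obtain ⟨c, hc⟩ := hb i τ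
  refine conj_ne_top (c := -c) fun x => ?_
  have h1 : c ≤ p.φ i τ x := hc ⟨x, rfl⟩
  rw [neg_zero, inner_zero_left]
  linarith

theorem Regular.feas_outer (hp : p.Regular) (hm : 0 < m) (hn : 0 < n)
    (ha0 : 0 ≤ p.theta * m) (ha : p.theta * m ≤ 1)
    (hb : ∀ i τ, BddBelow (Set.range (p.φ i τ))) (z : ℕ → ℕ → Fin n → Fin m × S) (k : ℕ) :
    p.Feas (p.outer Q z k).α := by
  induction k with
  | zero => exact feas_zero hb
  | succ k ih => exact (hp.inv_inner hm hn ha0 ha _ ih _ _).feas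

/-- The state after `K` inner iterations of outer iteration `k + 1`, with its prox-centre. -/
def traj {Ω : Type*} (p : Setup d t m n) (Q : S → E d → E d) (ζ : ℕ × ℕ × Fin n → Ω → Fin m × S)
    (k K : ℕ) (ω : Ω) : E d × InnerState d t m n :=
  let o := p.outer Q (fun k' K' τ => ζ (k', K', τ) ω) k
  (o.y, p.inner Q o.y o.α (fun K' τ => ζ (k + 1, K', τ) ω) K)

theorem Regular.inv_traj {Ω : Type*} {ζ : ℕ × ℕ × Fin n → Ω → Fin m × S} (hp : p.Regular)
    (hm : 0 < m) (hn : 0 < n)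
    (ha0 : 0 ≤ p.theta * m) (ha : p.theta * m ≤ 1)
    (hb : ∀ i τ, BddBelow (Set.range (p.φ i τ))) (k K : ℕ) (ω : Ω) :
    p.Inv (p.traj Q ζ k K ω).2 :=
  hp.inv_inner hm hn ha0 ha _ (hp.feas_outer hm hn ha0 ha hb _ k) _ K

variable [MeasurableSpace S] {Ω : Type*} {mΩ : MeasurableSpace Ω}

theorem Regular.measurable_toNat_stopTime (hp : p.Regular) (hk : 0 ≤ p.kap) (hm : 0 < m)
    (hn : 0 < n) (ha0 : 0 ≤ p.theta * m) (ha : p.theta * m ≤ 1)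
    (hQ : Measurable fun z : S × E d => Q z.1 z.2) {y : Ω → E d} (hy : Measurable y)
    {α : Ω → DualVar t m n} (hα : Measurable α) (hF : ∀ ω, p.Feas (α ω)) (ε : ℝ)
    {z : Ω → ℕ → Fin n → Fin m × S} (hz : ∀ j, Measurable fun ω => z ω j) :
    Measurable fun ω => (p.stopTime Q (y ω) (α ω) ε (z ω)).toNat := by
  simp_rw [stopTime, toNat_iInf_coe]
  refine measurable_sInf_nat
    (P := fun K ω => 1 ≤ K ∧ p.Stops (y ω) ε (p.inner Q (y ω) (α ω) (z ω) K)) fun K => ?_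
  have h1 : Measurable fun ω => p.stopVal (y ω) (p.inner Q (y ω) (α ω) (z ω) K) :=
    measurable_pair_comp (hp.measurable_stopVal hk hm hn) hy
      (hp.measurable_inner hk hQ hy hα K fun j _ => hz j)
  have h2 : {ω | 1 ≤ K ∧ p.Stops (y ω) ε (p.inner Q (y ω) (α ω) (z ω) K)}
      = {_ω | 1 ≤ K} ∩ {ω | p.stopVal (y ω) (p.inner Q (y ω) (α ω) (z ω) K) ≤ ε} := by
    ext ω
    exact and_congr_right fun _ =>
      hp.stops_iff hk hm hn _ _ (hp.inv_inner hm hn ha0 ha _ (hF ω) _ _).feas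
  rw [h2]
  exact (MeasurableSet.const _).inter (measurableSet_le h1 measurable_const)

theorem Regular.measurable_outer (hp : p.Regular) (hk : 0 ≤ p.kap) (hm : 0 < m) (hn : 0 < n)
    (ha0 : 0 ≤ p.theta * m) (ha : p.theta * m ≤ 1)
    (hb : ∀ i τ, BddBelow (Set.range (p.φ i τ)))
    (hQ : Measurable fun z : S × E d => Q z.1 z.2)
    {z : Ω → ℕ → ℕ → Fin n → Fin m × S} (k : ℕ)
    (hz : ∀ l ≤ k, ∀ j, Measurable fun ω => z ω l j) :
    (Measurable fun ω => (p.outer Q (z ω) k).x) ∧ (Measurable fun ω => (p.outer Q (z ω) k).y)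
      ∧ Measurable fun ω => (p.outer Q (z ω) k).α := by
  induction k with
  | zero => exact ⟨measurable_const, measurable_const, measurable_const⟩
  | succ k ih =>
    obtain ⟨hx, hy, hα⟩ := ih fun l hl => hz l (by omega)
    have hT := hp.measurable_toNat_stopTime hk hm hn ha0 ha hQ hy hα
      (fun ω => hp.feas_outer hm hn ha0 ha hb (z ω) k) (p.eps (k + 1)) (hz (k + 1) le_rfl)
    have hin : Measurable fun w : ℕ × Ω => p.inner Q (p.outer Q (z w.2) k).y
        (p.outer Q (z w.2) k).α (z w.2 (k + 1)) w.1 :=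
      measurable_from_prod_countable_right fun K =>
        hp.measurable_inner hk hQ hy hα K fun j _ => hz (k + 1) le_rfl j
    have hs := measurable_pair_comp (f := fun K ω => p.inner Q (p.outer Q (z ω) k).y
        (p.outer Q (z ω) k).α (z ω (k + 1)) K) hin hT measurable_id
    have hx' := measurable_pair_comp
      (f := fun y (s : InnerState d t m n) => p.primal y s.u) (hp.measurable_primal_state hk) hy hs
    have hα' := (measurable_innerState_iff.1 hs).1
    exact ⟨hx', hx'.add ((hx'.sub hx).const_smul (p.beta k)), hα'⟩

end Outer

section Expectation

variable {S : Type*} [MeasurableSpace S] {ν : Measure S} [IsProbabilityMeasure ν]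
  {Q : S → E d → E d} {Ω : Type*} [mΩ : MeasurableSpace Ω] {μ : Measure Ω} [IsProbabilityMeasure μ]
  {ζ : ℕ × ℕ × Fin n → Ω → Fin m × S}

theorem Regular.lintegral_traj_succ_le (hp : p.Regular) (hk : 0 ≤ p.kap) (hm : 0 < m)
    (hn : 0 < n) (h0 : 0 < p.del) (h1 : p.del < 1) (ht0 : 0 < p.theta) (ht : p.theta ≤ p.theta0)
    (hb : ∀ i τ, BddBelow (Set.range (p.φ i τ))) (hQ : IsContractionCompressor ν Q p.del)
    (hζ : ∀ j, Measurable (ζ j)) (hind : iIndepFun ζ μ)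
    (hlaw : ∀ j, μ.map (ζ j) = (uniformOn (Set.univ : Set (Fin m))).prod ν) (k K : ℕ) :
    ∫⁻ ω, p.Φ (p.traj Q ζ k (K + 1) ω).1 (p.traj Q ζ k (K + 1) ω).2 ∂μ
      ≤ ENNReal.ofReal (1 - min p.theta (p.del / 4))
        * ∫⁻ ω, p.Φ (p.traj Q ζ k K ω).1 (p.traj Q ζ k K ω).2 ∂μ := by
  have ha0 : 0 ≤ p.theta * m := by positivity
  have ha := p.theta_mul_m_le_one hm hp.gam_pos (hp.lamK_pos hk) h0 ht0 ht
  -- The state before the step is measurable with respect to the samples indexed by J, the step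
  -- itself uses those in J', and disjoint blocks of an independent family are independent.
  set J : Set (ℕ × ℕ × Fin n) := {j | j.1 ≤ k ∨ (j.1 = k + 1 ∧ j.2.1 < K)} with hJ
  set J' : Set (ℕ × ℕ × Fin n) := {j | j.1 = k + 1 ∧ j.2.1 = K} with hJ'
  set mi : ℕ × ℕ × Fin n → MeasurableSpace Ω := fun j => MeasurableSpace.comap (ζ j) inferInstance
    with hmi
  have hdisj : Disjoint J J' := by
    rw [Set.disjoint_left]
    rintro j (h2 | ⟨h2, h3⟩) ⟨h4, h5⟩ <;> omega
  have hle : ∀ j, mi j ≤ mΩ := fun j => (hζ j).comap_le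
  have hI : Indep (⨆ j ∈ J, mi j) (⨆ j ∈ J', mi j) μ :=
    indep_iSup_of_disjoint hle hind hdisj
  have hmeas : ∀ {A : Set (ℕ × ℕ × Fin n)} {j}, j ∈ A → Measurable[⨆ j ∈ A, mi j] (ζ j) :=
    fun {A j} hj => measurable_iff_comap_le.2 (le_iSup₂ (f := fun j (_ : j ∈ A) => mi j) j hj)
  set Z : Ω → Fin n → Fin m × S := fun ω τ => ζ (k + 1, K, τ) ω with hZ
  have hZm : Measurable[⨆ j ∈ J', mi j] Z :=
    @measurable_pi_lambda _ _ _ (⨆ j ∈ J', mi j) _ _ fun τ => hmeas (A := J') ⟨rfl, rfl⟩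
  have hXm : Measurable[⨆ j ∈ J, mi j] (p.traj Q ζ k K) := by
    obtain ⟨-, hy, hα⟩ := hp.measurable_outer (mΩ := ⨆ j ∈ J, mi j) hk hm hn ha0 ha hb
      hQ.measurable (z := fun ω k' K' τ => ζ (k', K', τ) ω) k fun l hl j =>
        @measurable_pi_lambda _ _ _ (⨆ j ∈ J, mi j) _ _ fun τ => hmeas (A := J) (Or.inl hl)
    have hin := hp.measurable_inner (mΩ := ⨆ j ∈ J, mi j) hk hQ.measurable hy hα
      (z := fun ω K' τ => ζ (k + 1, K', τ) ω) K fun j hj =>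
        @measurable_pi_lambda _ _ _ (⨆ j ∈ J, mi j) _ _ fun τ => hmeas (A := J) (Or.inr ⟨rfl, hj⟩)
    exact hy.prodMk hin
  have hXm' : Measurable (p.traj Q ζ k K) := hXm.mono (iSup₂_le fun j _ => hle j) le_rfl
  have hZm' : Measurable Z := hZm.mono (iSup₂_le fun j _ => hle j) le_rfl
  have hXZ : IndepFun (p.traj Q ζ k K) Z μ :=
    indep_of_indep_of_le_left (indep_of_indep_of_le_right hI hZm.comap_le) hXm.comap_le
  have hZlaw : μ.map Z = Measure.pi fun _ => (uniformOn (Set.univ : Set (Fin m))).prod ν := by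
    have hsub : iIndepFun (fun τ => ζ (k + 1, K, τ)) μ :=
      hind.precomp (g := fun τ : Fin n => (k + 1, K, τ)) fun a b h => by simpa using h
    rw [hZ, (iIndepFun_iff_map_fun_eq_pi_map fun τ => (hζ _).aemeasurable).1 hsub]
    simp_rw [hlaw]
  have hF : Measurable fun w : (E d × InnerState d t m n) × (Fin n → Fin m × S) =>
      p.Φ w.1.1 (p.innerStep Q w.1.1 w.2 w.1.2) :=
    measurable_pair_comp (hp.measurable_Φ hk hm hn) (measurable_fst.comp measurable_fst)
      (hp.measurable_innerStep hk hQ.measurable)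
  have hstep := lintegral_le_of_indepFun hXm' hZm' hXZ
    (F := fun w z => p.Φ w.1 (p.innerStep Q w.1 z w.2)) hF
    (G := fun ω => ENNReal.ofReal (1 - min p.theta (p.del / 4))
      * p.Φ (p.traj Q ζ k K ω).1 (p.traj Q ζ k K ω).2) fun ω => by
      rw [hZlaw]
      exact hp.lintegral_innerStep_le hk hm hn h0 h1 ht0 ht hQ _
        (hp.inv_traj hm hn ha0 ha hb k K ω)
  have hΦm : Measurable fun ω => p.Φ (p.traj Q ζ k K ω).1 (p.traj Q ζ k K ω).2 :=
    (hp.measurable_Φ hk hm hn).comp hXm'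
  rw [lintegral_const_mul _ hΦm] at hstep
  exact hstep

theorem Regular.lintegral_traj_le (hp : p.Regular) (hk : 0 ≤ p.kap) (hm : 0 < m)
    (hn : 0 < n) (h0 : 0 < p.del) (h1 : p.del < 1) (ht0 : 0 < p.theta) (ht : p.theta ≤ p.theta0)
    (hb : ∀ i τ, BddBelow (Set.range (p.φ i τ))) (hQ : IsContractionCompressor ν Q p.del)
    (hζ : ∀ j, Measurable (ζ j)) (hind : iIndepFun ζ μ)
    (hlaw : ∀ j, μ.map (ζ j) = (uniformOn (Set.univ : Set (Fin m))).prod ν) (k K : ℕ) :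
    ∫⁻ ω, p.Φ (p.traj Q ζ k K ω).1 (p.traj Q ζ k K ω).2 ∂μ
      ≤ ENNReal.ofReal (1 - min p.theta (p.del / 4)) ^ K
        * ∫⁻ ω, p.Φ (p.traj Q ζ k 0 ω).1 (p.traj Q ζ k 0 ω).2 ∂μ := by
  induction K with
  | zero => simp
  | succ K ih =>
    refine (hp.lintegral_traj_succ_le hk hm hn h0 h1 ht0 ht hb hQ hζ hind hlaw k K).trans ?_
    rw [pow_succ', mul_assoc]
    gcongr

theorem Regular.measurable_traj (hp : p.Regular) (hk : 0 ≤ p.kap) (hm : 0 < m)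
    (hn : 0 < n) (ha0 : 0 ≤ p.theta * m) (ha : p.theta * m ≤ 1)
    (hb : ∀ i τ, BddBelow (Set.range (p.φ i τ)))
    (hQ : Measurable fun z : S × E d => Q z.1 z.2) (hζ : ∀ j, Measurable (ζ j)) (k K : ℕ) :
    Measurable (p.traj Q ζ k K) := by
  obtain ⟨-, hy, hα⟩ := hp.measurable_outer hk hm hn ha0 ha hb
    hQ (z := fun ω k' K' τ => ζ (k', K', τ) ω) k fun l hl j =>
      measurable_pi_lambda _ fun τ => hζ _
  exact hy.prodMk (hp.measurable_inner hk hQ hy hα K fun j hj =>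
    measurable_pi_lambda _ fun τ => hζ _)

/-- Expected number of inner iterations, from the contraction of the Lyapunov function. -/
theorem Regular.lintegral_T_le (hp : p.Regular) (hk : 0 ≤ p.kap) (hm : 0 < m)
    (hn : 0 < n) (h0 : 0 < p.del) (h1 : p.del < 1) (ht0 : 0 < p.theta) (ht : p.theta ≤ p.theta0)
    (hb : ∀ i τ, BddBelow (Set.range (p.φ i τ))) (hQ : IsContractionCompressor ν Q p.del)
    (hζ : ∀ j, Measurable (ζ j)) (hind : iIndepFun ζ μ)
    (hlaw : ∀ j, μ.map (ζ j) = (uniformOn (Set.univ : Set (Fin m))).prod ν) (k : ℕ)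
    {w M : ℝ} (hw : 0 < w) (hwM : 1 ≤ w * M) (hε : 0 < p.eps (k + 1))
    (hstopVal : ∀ (y : E d) (s : InnerState d t m n), p.Inv s → ENNReal.ofReal (p.stopVal y s)
      ≤ ENNReal.ofReal w * p.Φ y s)
    (hinit : ∀ᵐ ω ∂μ, p.Φ (p.traj Q ζ k 0 ω).1 (p.traj Q ζ k 0 ω).2
      ≤ ENNReal.ofReal (M * p.eps (k + 1))) :
    ∫⁻ ω, ((p.T Q (fun k' K τ => ζ (k', K, τ) ω) (k + 1) : ℕ∞) : ℝ≥0∞) ∂μ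
      ≤ ENNReal.ofReal ((Real.log (w * M) + 3) / min p.theta (p.del / 4)) := by
  classical
  have ha0 : 0 ≤ p.theta * m := by positivity
  have ha := p.theta_mul_m_le_one hm hp.gam_pos (hp.lamK_pos hk) h0 ht0 ht
  set η := min p.theta (p.del / 4) with hη
  set ε := p.eps (k + 1) with hεd
  have hη0 : 0 < η := lt_min ht0 (by positivity)
  have hη1 : η ≤ 1 := (min_le_right _ _).trans (by linarith)
  obtain ⟨K0, hK1, hK2, hK3⟩ := exists_pow_le hη0 hη1 hwM
  have hM : 0 < M := pos_of_mul_pos_right (by linarith) hw.le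
  -- Pointwise Markov: if the loop does not stop at K then ε < `stopVal` ≤ wΦ, so the indicator is
  -- at most (w/ε)Φ.
  have hpt : ∀ ω, ((p.T Q (fun k' K τ => ζ (k', K, τ) ω) (k + 1) : ℕ∞) : ℝ≥0∞)
      ≤ K0 + ∑' j, ENNReal.ofReal (w / ε)
        * p.Φ (p.traj Q ζ k (K0 + j) ω).1 (p.traj Q ζ k (K0 + j) ω).2 := by
    intro ω
    refine (toENNReal_iInf_le (fun K => p.Stops (p.traj Q ζ k K ω).1 ε (p.traj Q ζ k K ω).2)
      hK1).trans ?_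
    gcongr with j
    split_ifs with hs
    · exact zero_le
    · have hinv := hp.inv_traj (Q := Q) (ζ := ζ) hm hn ha0 ha hb k (K0 + j) ω
      rw [hp.stops_iff hk hm hn _ _ hinv.feas, not_le] at hs
      have h2 := (ENNReal.ofReal_le_ofReal hs.le).trans (hstopVal _ _ hinv)
      rw [ENNReal.ofReal_div_of_pos hε, div_eq_mul_inv, mul_assoc, mul_comm _⁻¹, ← mul_assoc,
        ← div_eq_mul_inv]
      rwa [ENNReal.le_div_iff_mul_le (Or.inl (by simpa using hε)) (Or.inl ENNReal.ofReal_ne_top),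
        one_mul]
  have hΦm : ∀ K, Measurable fun ω => p.Φ (p.traj Q ζ k K ω).1 (p.traj Q ζ k K ω).2 := fun K =>
    (hp.measurable_Φ hk hm hn).comp
      (hp.measurable_traj hk hm hn ha0 ha hb hQ.measurable hζ k K)
  have hE0 : ∫⁻ ω, p.Φ (p.traj Q ζ k 0 ω).1 (p.traj Q ζ k 0 ω).2 ∂μ
      ≤ ENNReal.ofReal (M * ε) := by
    refine (lintegral_mono_ae hinit).trans ?_
    simp
  have hEj : ∀ j, ∫⁻ ω, ENNReal.ofReal (w / ε)
        * p.Φ (p.traj Q ζ k (K0 + j) ω).1 (p.traj Q ζ k (K0 + j) ω).2 ∂μ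
      ≤ ENNReal.ofReal (1 - η) ^ j := by
    intro j
    rw [lintegral_const_mul _ (hΦm _)]
    have h2 := hp.lintegral_traj_le hk hm hn h0 h1 ht0 ht hb hQ hζ hind hlaw k (K0 + j)
    calc _ ≤ ENNReal.ofReal (w / ε)
          * (ENNReal.ofReal (1 - η) ^ (K0 + j) * ENNReal.ofReal (M * ε)) := by
          gcongr
          exact h2.trans (mul_le_mul_right hE0 _)
      _ = ENNReal.ofReal (w * M * (1 - η) ^ K0) * ENNReal.ofReal (1 - η) ^ j := by
          have h3 : 0 ≤ 1 - η := by linarith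
          rw [← ENNReal.ofReal_pow h3, ← ENNReal.ofReal_pow h3, ← ENNReal.ofReal_mul (by positivity),
            ← ENNReal.ofReal_mul (by positivity), ← ENNReal.ofReal_mul (by positivity), pow_add]
          congr 1
          field_simp
      _ ≤ 1 * ENNReal.ofReal (1 - η) ^ j := by
          gcongr
          exact ENNReal.ofReal_le_one.2 hK2
      _ = _ := one_mul _
  calc _ ≤ ∫⁻ ω, (K0 + ∑' j, ENNReal.ofReal (w / ε)
        * p.Φ (p.traj Q ζ k (K0 + j) ω).1 (p.traj Q ζ k (K0 + j) ω).2) ∂μ := lintegral_mono hpt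
    _ = K0 + ∑' j, ∫⁻ ω, ENNReal.ofReal (w / ε)
        * p.Φ (p.traj Q ζ k (K0 + j) ω).1 (p.traj Q ζ k (K0 + j) ω).2 ∂μ := by
        rw [lintegral_add_left measurable_const, lintegral_const, measure_univ, mul_one,
          lintegral_tsum fun j => ((hΦm _).const_mul _).aemeasurable]
    _ ≤ K0 + ENNReal.ofReal (1 / η) := by
        gcongr
        rw [← tsum_ofReal_geometric hη0 hη1]
        exact ENNReal.tsum_le_tsum hEj
    _ ≤ _ := by
        rw [← ENNReal.ofReal_natCast, ← ENNReal.ofReal_add (by positivity) (by positivity)]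
        refine ENNReal.ofReal_le_ofReal ?_
        have : (Real.log (w * M) + 3) / η = (Real.log (w * M) + 2) / η + 1 / η := by ring
        linarith

end Expectation

end

end Setup

end ECCatalyst

/-! ### Inexact accelerated proximal point: potential and rate -/

namespace ECCatalyst

theorem strongConvexOn_add_sq {d : ℕ} {f : E d → ℝ} {μ κ : ℝ} (hf : StrongConvexOn Set.univ μ f)
    (y : E d) : StrongConvexOn Set.univ (μ + κ) fun x => f x + κ / 2 * ‖x - y‖ ^ 2 := by
  refine ⟨convex_univ, fun x _ z _ a b ha hb hab => ?_⟩
  have h := hf.2 (Set.mem_univ x) (Set.mem_univ z) ha hb hab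
  simp only [smul_eq_mul] at h ⊢
  rw [norm_segment_sq x z y hab]
  linarith

/-- Completing the square gives s' ≤ bs + (1 + √2)e; 3 is a rounding. -/
theorem le_add_three_mul_of_sq_le {b s s' e : ℝ} (hb : 0 ≤ b) (hs : 0 ≤ s) (he : 0 ≤ e)
    (h : s' ^ 2 ≤ b ^ 2 * s ^ 2 + e ^ 2 + 2 * e * s') : s' ≤ b * s + 3 * e := by
  by_contra! h1
  have h2 : 0 ≤ b * s := mul_nonneg hb hs
  nlinarith

theorem sq_sub_two_mul_le {U e W : ℝ} (h : U - e ≤ W) (hU : 0 ≤ U) (he : 0 ≤ e) :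
    U ^ 2 - 2 * e * U ≤ W ^ 2 := by
  rcases le_total e U with h1 | h1
  · have := pow_le_pow_left₀ (sub_nonneg.2 h1) h 2
    linarith [sq_nonneg e]
  · have := mul_nonneg hU (sub_nonneg.2 h1)
    linarith [sq_nonneg W, mul_nonneg hU he]

/-- The extrapolation bound of accelerated methods. -/
theorem catalyst_extrapolation_le {d : ℕ} {l κ a : ℝ} (hl : 0 < l) (ha : 0 < a) (ha1 : a ≤ 1)
    (hal : a ^ 2 * (l + κ) = l) {xs x y v : E d} (hy : (1 + a) • y = x + a • v) :
    κ * ‖(1 - a) • x + a • xs - y‖ ^ 2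
      ≤ l * (1 - a) * (a * ‖xs - x‖ ^ 2 + ‖xs - v‖ ^ 2) := by
  have h1 : (1 + a) • ((1 - a) • x + a • xs - y) = a • (a • (xs - x) + (xs - v)) := by
    rw [smul_sub, hy]
    module
  have h2 : (1 + a) ^ 2 * ‖(1 - a) • x + a • xs - y‖ ^ 2
      = a ^ 2 * ‖a • (xs - x) + (xs - v)‖ ^ 2 := by
    rw [← mul_pow, ← mul_pow, ← norm_smul_of_nonneg ha.le, ← norm_smul_of_nonneg (by linarith), h1]
  have h3 : ‖a • (xs - x) + (xs - v)‖ ≤ a * ‖xs - x‖ + ‖xs - v‖ := by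
    refine (norm_add_le _ _).trans ?_
    rw [norm_smul, Real.norm_eq_abs, abs_of_pos ha]
  set P := ‖xs - x‖
  set W := ‖xs - v‖
  set Z := ‖(1 - a) • x + a • xs - y‖ ^ 2
  have h4 : ‖a • (xs - x) + (xs - v)‖ ^ 2 ≤ (1 + a) * (a * P ^ 2 + W ^ 2) := by
    refine (pow_le_pow_left₀ (norm_nonneg _) h3 2).trans ?_
    nlinarith [mul_nonneg ha.le (sq_nonneg (P - W))]
  -- This is a²(l + κ) = l rearranged; it supplies the factor l(1 - a) of the bound.
  have hκ : κ * a ^ 2 = l * ((1 - a) * (1 + a)) := by linarith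
  have h5 : κ * a ^ 2 * ‖a • (xs - x) + (xs - v)‖ ^ 2
      ≤ l * ((1 - a) * (1 + a)) * ((1 + a) * (a * P ^ 2 + W ^ 2)) := by
    rw [hκ]
    refine mul_le_mul_of_nonneg_left h4 (mul_nonneg hl.le (mul_nonneg ?_ ?_)) <;> linarith
  have h6 : (1 + a) ^ 2 * (κ * Z) ≤ (1 + a) ^ 2 * (l * (1 - a) * (a * P ^ 2 + W ^ 2)) := by
    calc _ = κ * (a ^ 2 * ‖a • (xs - x) + (xs - v)‖ ^ 2) := by rw [← h2]; ring
      _ ≤ _ := by linarith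
  exact le_of_mul_le_mul_left h6 (by positivity)

/-- One inexact accelerated proximal step. -/
theorem catalyst_step {d : ℕ} {f : E d → ℝ} {l κ a ε : ℝ} (hf : StrongConvexOn Set.univ l f)
    (hl : 0 < l) (hκ : 0 ≤ κ) (ha : 0 < a) (ha1 : a ≤ 1) (hal : a ^ 2 * (l + κ) = l)
    {xs x y v x' v' : E d} (hy : (1 + a) • y = x + a • v)
    (hv' : a • v' = x' - (1 - a) • x)
    (hx' : ∀ z, f x' + κ / 2 * ‖x' - y‖ ^ 2 ≤ f z + κ / 2 * ‖z - y‖ ^ 2 + ε) :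
    f x' - f xs + l / 2 * ‖xs - v'‖ ^ 2
      ≤ (1 - a) * (f x - f xs + l / 2 * ‖xs - v‖ ^ 2) + ε
        + 2 * Real.sqrt ε * (Real.sqrt (l / 2) * ‖xs - v'‖) := by
  have hG := strongConvexOn_add_sq (κ := κ) hf y
  obtain ⟨xh, hxh⟩ := strongConvexOn_exists_min (by linarith) hG
  -- The comparison point of accelerated methods. Its distance to x' is a‖xs - v'‖, and a²(l + κ) =
  -- l turns the growth of the subproblem at z into the new potential term.
  set z := (1 - a) • x + a • xs with hz
  have h1 := strongConvexOn_growth hG hxh z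
  have h2 := strongConvexOn_growth hG hxh x'
  have h3 := hx' xh
  have h4 := strongConvexOn_le hf x xs ha.le ha1
  have h5 := catalyst_extrapolation_le hl ha ha1 hal (xs := xs) hy
  rw [← hz] at h4 h5
  have h6 : ‖z - x'‖ = a * ‖xs - v'‖ := by
    rw [← norm_smul_of_nonneg ha.le, smul_sub, hv', hz]
    congr 1
    module
  have h7 : ‖z - x'‖ ≤ ‖z - xh‖ + ‖x' - xh‖ := by
    rw [norm_sub_rev x' xh]; exact norm_sub_le_norm_sub_add_norm_sub _ _ _
  set c := Real.sqrt ((l + κ) / 2) with hc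
  have hc2 : c ^ 2 = (l + κ) / 2 := Real.sq_sqrt (by positivity)
  have hc0 : 0 ≤ c := Real.sqrt_nonneg _
  have h8 : c * ‖z - x'‖ = Real.sqrt (l / 2) * ‖xs - v'‖ := by
    rw [h6, hc, ← mul_assoc]
    congr 1
    have h9 : l / 2 = a ^ 2 * ((l + κ) / 2) := by linarith
    rw [h9, Real.sqrt_mul (by positivity), Real.sqrt_sq ha.le, mul_comm]
  have h9 : c * ‖x' - xh‖ ≤ Real.sqrt ε := by
    refine Real.le_sqrt_of_sq_le ?_
    rw [mul_pow, hc2]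
    linarith
  set U := Real.sqrt (l / 2) * ‖xs - v'‖ with hU
  have hU2 : U ^ 2 = l / 2 * ‖xs - v'‖ ^ 2 := by rw [hU, mul_pow, Real.sq_sqrt (by positivity)]
  have hU0 : 0 ≤ U := by positivity
  have h10 : U - Real.sqrt ε ≤ c * ‖z - xh‖ := by
    have := mul_le_mul_of_nonneg_left h7 hc0
    rw [mul_add, h8] at this
    linarith
  -- Replacing the exact minimiser xh by x' costs √ε in the scaled norm; the ε² -type remainder is
  -- dropped by keeping only the linear loss.
  have h11 : U ^ 2 - 2 * Real.sqrt ε * U ≤ (l + κ) / 2 * ‖z - xh‖ ^ 2 := by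
    rw [← hc2, ← mul_pow]
    exact sq_sub_two_mul_le h10 hU0 (Real.sqrt_nonneg _)
  have h12 : 0 ≤ κ / 2 * ‖x' - y‖ ^ 2 := by positivity
  rw [norm_sub_rev x xs] at h4
  rw [← hU2]
  linarith

/-- The rate of the potential under errors decreasing like `(1 - ρ) ^ k`. -/
theorem catalyst_rate_real {a ρ Δ : ℝ} (ha : 0 < a) (ha1 : a ≤ 1) (hρ : ρ < a) :
    Real.sqrt (1 - a) * (2 * Real.sqrt 2 * (1 + 1 / (a - ρ)) * Real.sqrt Δ)
        + Real.sqrt 2 * Real.sqrt Δ * Real.sqrt (1 - ρ)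
      ≤ 2 * Real.sqrt 2 * (1 + 1 / (a - ρ)) * Real.sqrt Δ * Real.sqrt (1 - ρ) := by
  have h1 : Real.sqrt (1 - a) ^ 2 = 1 - a := Real.sq_sqrt (by linarith)
  have h2 : Real.sqrt (1 - ρ) ^ 2 = 1 - ρ := Real.sq_sqrt (by linarith)
  set b := Real.sqrt (1 - a)
  set r := Real.sqrt (1 - ρ)
  set L := 1 + 1 / (a - ρ) with hL
  have hr : 0 < r := Real.sqrt_pos.2 (by linarith)
  have hb : 0 ≤ b := Real.sqrt_nonneg _
  have hbr : b ≤ r := Real.sqrt_le_sqrt (by linarith)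
  have hLa : L * (a - ρ) = a - ρ + 1 := by
    rw [hL, add_mul, one_mul, one_div, inv_mul_cancel₀ (by linarith)]
  have hL0 : 0 < L := by
    have : 0 < 1 / (a - ρ) := one_div_pos.2 (by linarith)
    linarith
  -- From (r - b)(r + b) = a - ρ and b ≤ r, one gets 2Lr(r - b) ≥ L(a - ρ) = 1 + a - ρ ≥ r². The
  -- summand 1 + in L provides the a - ρ needed here for every ρ < a, including negative ρ.
  have h3 : r ≤ 2 * L * (r - b) := by
    have h4 : r * r ≤ 2 * L * (r - b) * r := by
      have h5 : L * ((r - b) * (r + b)) ≤ L * ((r - b) * (2 * r)) :=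
        mul_le_mul_of_nonneg_left (mul_le_mul_of_nonneg_left (by linarith) (by linarith)) hL0.le
      have h6 : (r - b) * (r + b) = a - ρ := by ring_nf; linarith
      rw [h6, hLa] at h5
      linarith
    exact le_of_mul_le_mul_right h4 hr
  have h4 : 0 ≤ Real.sqrt 2 * Real.sqrt Δ := by positivity
  linarith [mul_le_mul_of_nonneg_left h3 h4]

/-- The prox-centre y is a convex combination of x and v, and both are close to the minimiser when
the potential is small. -/
theorem norm_sub_sq_le_of_potential {d : ℕ} {l a S : ℝ} (hl : 0 < l) (ha : 0 < a)
    {xs x y v : E d} (hy : (1 + a) • y = x + a • v)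
    (hS : l / 2 * ‖xs - x‖ ^ 2 + l / 2 * ‖xs - v‖ ^ 2 ≤ S) : ‖y - xs‖ ^ 2 ≤ 2 / l * S := by
  have h1 : (1 + a) • (y - xs) = (x - xs) + a • (v - xs) := by
    rw [smul_sub, hy]; module
  have h2 : (1 + a) * ‖y - xs‖ ≤ ‖xs - x‖ + a * ‖xs - v‖ := by
    have := norm_add_le (x - xs) (a • (v - xs))
    rw [← h1, norm_smul, norm_smul, Real.norm_eq_abs, Real.norm_eq_abs, abs_of_pos ha,
      abs_of_pos (by linarith), norm_sub_rev x, norm_sub_rev v] at this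
    exact this
  have h3 : ‖y - xs‖ ^ 2 ≤ ‖xs - x‖ ^ 2 + ‖xs - v‖ ^ 2 := by
    have h4 := pow_le_pow_left₀ (by positivity) h2 2
    have h5 : (‖xs - x‖ + a * ‖xs - v‖) ^ 2 ≤ (1 + a) ^ 2 * (‖xs - x‖ ^ 2 + ‖xs - v‖ ^ 2) := by
      nlinarith [mul_nonneg ha.le (sq_nonneg (‖xs - x‖ - ‖xs - v‖)), mul_nonneg ha.le
        (sq_nonneg ‖xs - x‖), mul_nonneg ha.le (sq_nonneg ‖xs - v‖), sq_nonneg ‖xs - v‖,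
        mul_nonneg (mul_nonneg ha.le ha.le) (sq_nonneg ‖xs - x‖)]
    rw [mul_pow] at h4
    exact le_of_mul_le_mul_left (h4.trans h5) (by positivity)
  calc _ ≤ _ := h3
    _ = 2 / l * (l / 2 * ‖xs - x‖ ^ 2 + l / 2 * ‖xs - v‖ ^ 2) := by field_simp
    _ ≤ _ := mul_le_mul_of_nonneg_left hS (by positivity)

/-- The starting value √q is a fixed point of the recursion, so the extrapolation parameter is
constant. -/
theorem catAlpha_eq {q : ℝ} (hq : 0 ≤ q) (k : ℕ) : catAlpha q k = Real.sqrt q := by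
  induction k with
  | zero => rfl
  | succ k ih =>
    rw [catAlpha, ih, Real.sq_sqrt hq, sub_self, zero_add, zero_pow two_ne_zero, zero_add,
      Real.sqrt_mul (by norm_num), show (4 : ℝ) = 2 ^ 2 by norm_num, Real.sqrt_sq (by norm_num)]
    ring

end ECCatalyst

namespace ECCatalyst

namespace Setup

noncomputable section

variable {d t m n : ℕ} {p : Setup d t m n}

theorem Regular.q_pos (hp : p.Regular) (hk : 0 ≤ p.kap) : 0 < p.q :=
  div_pos hp.lam_pos (hp.lamK_pos hk)

theorem Regular.q_le_one (hp : p.Regular) (hk : 0 ≤ p.kap) : p.q ≤ 1 :=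
  (div_le_one (hp.lamK_pos hk)).2 (le_add_of_nonneg_right hk)

theorem Regular.sqrt_q_sq_mul (hp : p.Regular) (hk : 0 ≤ p.kap) :
    Real.sqrt p.q ^ 2 * p.lamK = p.lam := by
  rw [Real.sq_sqrt (hp.q_pos hk).le, q, div_mul_cancel₀ _ (hp.lamK_pos hk).ne']

theorem Regular.beta_eq (hp : p.Regular) (hk : 0 ≤ p.kap) (k : ℕ) :
    p.beta k = (1 - Real.sqrt p.q) / (1 + Real.sqrt p.q) := by
  have hq := hp.q_pos hk
  have h1 := Real.sqrt_pos.2 hq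
  rw [beta, catAlpha_eq hq.le, catAlpha_eq hq.le]
  field_simp
  ring

theorem Regular.P_strong (hp : p.Regular) (hm : 0 < m) (hn : 0 < n) :
    StrongConvexOn Set.univ p.lam p.P := by
  have hN := p.N_pos hm hn
  refine ⟨convex_univ, fun x _ z _ a b ha hb hab => ?_⟩
  have h := hp.g_strong.2 (Set.mem_univ x) (Set.mem_univ z) ha hb hab
  have h2 : (1 / p.N) * ∑ τ, ∑ i, p.φ i τ (ContinuousLinearMap.adjoint (p.A i τ) (a • x + b • z))
      ≤ (1 / p.N) * ∑ τ, ∑ i, (a * p.φ i τ (ContinuousLinearMap.adjoint (p.A i τ) x)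
        + b * p.φ i τ (ContinuousLinearMap.adjoint (p.A i τ) z)) := by
    refine mul_le_mul_of_nonneg_left (Finset.sum_le_sum fun τ _ => Finset.sum_le_sum fun i _ => ?_)
      (by positivity)
    rw [map_add, map_smul, map_smul]
    exact (hp.φ_convex i τ).2 (Set.mem_univ _) (Set.mem_univ _) ha hb hab
  simp_rw [Finset.sum_add_distrib, ← Finset.mul_sum] at h2
  simp only [smul_eq_mul, P] at h ⊢
  linarith

theorem Regular.exists_P_eq_Pstar (hp : p.Regular) (hm : 0 < m) (hn : 0 < n) :
    ∃ xs, p.P xs = p.Pstar ∧ ∀ x, p.P xs ≤ p.P x := by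
  obtain ⟨xs, hxs⟩ := strongConvexOn_exists_min hp.lam_pos (hp.P_strong hm hn)
  exact ⟨xs, (le_ciInf hxs).antisymm (ciInf_le ⟨p.P xs, by rintro _ ⟨x, rfl⟩; exact hxs x⟩ xs), hxs⟩

section Outer

variable {S : Type*} {Q : S → E d → E d} {z : ℕ → ℕ → Fin n → Fin m × S}

theorem stops_of_stopTime_ne_top {y : E d} {α : DualVar t m n} {ε : ℝ}
    {z : ℕ → Fin n → Fin m × S} (h : p.stopTime Q y α ε z ≠ ⊤) :
    p.Stops y ε (p.inner Q y α z (p.stopTime Q y α ε z).toNat) := by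
  rw [stopTime] at h ⊢
  rw [toNat_iInf_coe]
  rcases Set.eq_empty_or_nonempty {K : ℕ | 1 ≤ K ∧ p.Stops y ε (p.inner Q y α z K)} with h1 | h1
  · rw [h1] at h
    simp at h
  · exact (Nat.sInf_mem h1).2

/-- The accuracy reached by an outer iteration whose inner loop stops. -/
theorem Regular.outer_accuracy (hp : p.Regular) (hk : 0 ≤ p.kap) (hm : 0 < m) (hn : 0 < n)
    (h0 : 0 < p.del) (ht0 : 0 < p.theta) (ha : p.theta * m ≤ 1)
    (hb : ∀ i τ, BddBelow (Set.range (p.φ i τ))) {k : ℕ} (hT : p.T Q z (k + 1) ≠ ⊤) :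
    p.Dstar (p.outer Q z k).y - p.Dr (p.outer Q z k).y (p.outer Q z (k + 1)).α
        ≤ p.eps (k + 1) / 2 ∧
      ∀ x, p.G (p.outer Q z k).y (p.outer Q z (k + 1)).x
        ≤ p.G (p.outer Q z k).y x + p.eps (k + 1) := by
  have hs := stops_of_stopTime_ne_top hT
  set o := p.outer Q z k with ho
  have hinv := hp.inv_inner hm hn (by positivity) ha o.y 
    (hp.feas_outer (Q := Q) hm hn (by positivity) ha hb z k) (z (k + 1)) (p.T Q z (k + 1)).toNat
    (Q := Q)
  set s := p.inner Q o.y o.α (z (k + 1)) (p.T Q z (k + 1)).toNat with hsd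
  have e1 : (p.outer Q z (k + 1)).α = s.α := rfl
  have e2 : (p.outer Q z (k + 1)).x = p.primal o.y s.u := rfl
  have h1 := (hp.stops_iff hk hm hn o.y (p.eps (k + 1)) hinv.feas).1 hs
  rw [e1, e2]
  have h2 := hp.Dr_le_Dstar hk hm hn o.y hinv.feas
  have h3 := hp.Gstar_le hk hm hn o.y (p.primal o.y s.u)
  have h4 : 0 ≤ p.errWeight * ∑ τ, ‖s.e τ‖ ^ 2 :=
    mul_nonneg (p.errWeight_nonneg h0 (hp.lamK_pos hk) ht0) (by positivity)
  -- This factor, rather than 1, is what yields a dual gap of at most ε/2 at the stop.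
  have h5 : 2 ≤ Real.sqrt (4 * n + p.del * m * n) := by
    refine Real.le_sqrt_of_sq_le ?_
    have : (1 : ℝ) ≤ n := Nat.one_le_cast.2 hn
    have : 0 ≤ p.del * m * n := by positivity
    linarith
  rw [stopVal] at h1
  have h6 : 2 * (p.Dstar o.y - p.Dr o.y s.α + p.errWeight * ∑ τ, ‖s.e τ‖ ^ 2)
      ≤ Real.sqrt (4 * n + p.del * m * n)
        * (p.Dstar o.y - p.Dr o.y s.α + p.errWeight * ∑ τ, ‖s.e τ‖ ^ 2) :=
    mul_le_mul_of_nonneg_right h5 (by linarith)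
  refine ⟨by linarith, fun x => ?_⟩
  have := hp.Gstar_le hk hm hn o.y x
  linarith

/-- The square root of the potential obeys √S' ≤ √(1-a) √S + 3√ε with ε decaying like (1-ρ0)^k and
ρ0 < a, so it decays at the slower rate √(1-ρ0). Finiteness of the earlier stopping times is
essential: an infinite one is read as 0 by `toNat`, and the output is then unrelated to the
accuracy. -/
theorem Regular.outer_potential (hp : p.Regular) (hk : 0 ≤ p.kap) (hm : 0 < m) (hn : 0 < n)
    (h0 : 0 < p.del) (ht0 : 0 < p.theta) (ha : p.theta * m ≤ 1)
    (hb : ∀ i τ, BddBelow (Set.range (p.φ i τ))) (hρ : p.rho0 < Real.sqrt p.q) {xs : E d}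
    (hxs : ∀ x, p.P xs ≤ p.P x) (hxs' : p.P xs = p.Pstar) {k : ℕ}
    (hT : ∀ j < k, p.T Q z (j + 1) ≠ ⊤) :
    ∃ v, (1 + Real.sqrt p.q) • (p.outer Q z k).y = (p.outer Q z k).x + Real.sqrt p.q • v ∧
      p.P (p.outer Q z k).x - p.P xs + p.lam / 2 * ‖xs - v‖ ^ 2
        ≤ (2 * Real.sqrt 2 * (1 + 1 / (Real.sqrt p.q - p.rho0)) * Real.sqrt (p.P p.x0 - p.Pstar)
          * Real.sqrt (1 - p.rho0) ^ k) ^ 2 := by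
  set a := Real.sqrt p.q with had
  have ha0 : 0 < a := Real.sqrt_pos.2 (hp.q_pos hk)
  have ha1 : a ≤ 1 := Real.sqrt_le_one.2 (hp.q_le_one hk)
  have haq : a ^ 2 * (p.lam + p.kap) = p.lam := hp.sqrt_q_sq_mul hk
  have hΔ : 0 ≤ p.P p.x0 - p.Pstar := by rw [← hxs']; linarith [hxs p.x0]
  have hΔ2 := Real.sq_sqrt hΔ
  have h22 := Real.sq_sqrt (x := 2) (by norm_num)
  have hρ1 : 0 < 1 - p.rho0 := by linarith
  have hρ2 := Real.sq_sqrt hρ1.le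
  have hrate := catalyst_rate_real (Δ := p.P p.x0 - p.Pstar) ha0 ha1 hρ
  have hL1 : 1 ≤ 1 + 1 / (a - p.rho0) := by
    have : 0 < 1 / (a - p.rho0) := one_div_pos.2 (by linarith)
    linarith
  have hlam := hp.lam_pos
  set L := 1 + 1 / (a - p.rho0) with hL
  set r := Real.sqrt (1 - p.rho0) with hr
  set D := Real.sqrt (p.P p.x0 - p.Pstar) with hD
  have hr0 : 0 ≤ r := Real.sqrt_nonneg _
  have hD0 : 0 ≤ D := Real.sqrt_nonneg _
  induction k with
  | zero =>
    refine ⟨p.x0, by rw [add_smul, one_smul]; rfl, ?_⟩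
    have h1 := strongConvexOn_growth (hp.P_strong hm hn) hxs p.x0
    rw [norm_sub_rev] at h1
    have h2 : (2 * Real.sqrt 2 * L * D * r ^ 0) ^ 2 = 8 * L ^ 2 * (p.P p.x0 - p.Pstar) := by
      rw [← hΔ2, pow_zero, mul_one, mul_pow, mul_pow, mul_pow, h22]; ring
    have h3 : 1 * (p.P p.x0 - p.Pstar) ≤ L ^ 2 * (p.P p.x0 - p.Pstar) :=
      mul_le_mul_of_nonneg_right (one_le_pow₀ hL1) hΔ
    rw [h2]
    change p.P p.x0 - p.P xs + _ ≤ _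
    linarith
  | succ k ih =>
    obtain ⟨v, hv, hS⟩ := ih fun j hj => hT j (by omega)
    have hG := (hp.outer_accuracy hk hm hn h0 ht0 ha hb (hT k (by omega))).2
    set o := p.outer Q z k with ho
    set x' := (p.outer Q z (k + 1)).x with hx'
    have hy' : (p.outer Q z (k + 1)).y = x' + p.beta k • (x' - o.x) := rfl
    set v' := a⁻¹ • (x' - (1 - a) • o.x) with hv'
    have hav' : a • v' = x' - (1 - a) • o.x := by rw [hv', smul_inv_smul₀ ha0.ne']
    -- The factor 2/9 in the accuracies makes 3√ε equal to √2 D r^(k+1), the inhomogeneous term of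
    -- `catalyst_rate_real`.
    have hε : p.eps (k + 1) = (Real.sqrt 2 / 3 * D * r ^ (k + 1)) ^ 2 := by
      rw [eps, ← hΔ2, mul_pow, mul_pow, div_pow, h22, ← pow_mul, mul_comm (k + 1), pow_mul, hρ2]
      ring
    have hstep := catalyst_step (hp.P_strong hm hn) hlam hk ha0 ha1 haq (xs := xs) hv hav' hG
    rw [hε, Real.sqrt_sq (by positivity)] at hstep
    set e := Real.sqrt 2 / 3 * D * r ^ (k + 1) with he
    refine ⟨v', ?_, ?_⟩
    · rw [hy', hav', hp.beta_eq hk, smul_add, smul_smul, mul_div_cancel₀ _ (by positivity)]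
      module
    · set S' := p.P x' - p.P xs + p.lam / 2 * ‖xs - v'‖ ^ 2 with hS'
      have hS0 : 0 ≤ S' := add_nonneg (sub_nonneg.2 (hxs x')) (by positivity)
      have hU : Real.sqrt (p.lam / 2) * ‖xs - v'‖ ≤ Real.sqrt S' := by
        refine Real.le_sqrt_of_sq_le ?_
        rw [mul_pow, Real.sq_sqrt (by positivity)]
        linarith [hxs x']
      have he0 : 0 ≤ e := by positivity
      have hc : Real.sqrt S' ≤ Real.sqrt (1 - a) * (2 * Real.sqrt 2 * L * D * r ^ k) + 3 * e := by
        refine le_add_three_mul_of_sq_le (Real.sqrt_nonneg _) (by positivity) he0 ?_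
        rw [Real.sq_sqrt hS0, Real.sq_sqrt (by linarith)]
        have h1 := mul_le_mul_of_nonneg_left hS (show 0 ≤ 1 - a by linarith)
        have h2 := mul_le_mul_of_nonneg_left hU (show 0 ≤ 2 * e by positivity)
        linarith
      rw [← Real.sqrt_le_left (by positivity)]
      refine hc.trans ?_
      have := mul_le_mul_of_nonneg_right hrate (pow_nonneg hr0 k)
      rw [he, pow_succ]
      linarith

theorem Regular.norm_outer_sub_le (hp : p.Regular) (hk : 0 ≤ p.kap) (hm : 0 < m) (hn : 0 < n)
    (h0 : 0 < p.del) (ht0 : 0 < p.theta) (ha : p.theta * m ≤ 1)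
    (hb : ∀ i τ, BddBelow (Set.range (p.φ i τ))) (hρ : p.rho0 < Real.sqrt p.q) {xs : E d}
    (hxs : ∀ x, p.P xs ≤ p.P x) (hxs' : p.P xs = p.Pstar) {k : ℕ}
    (hT : ∀ j < k, p.T Q z (j + 1) ≠ ⊤) :
    p.lam * ‖(p.outer Q z k).y - xs‖ ^ 2
      ≤ 16 * (1 + 1 / (Real.sqrt p.q - p.rho0)) ^ 2 * (p.P p.x0 - p.Pstar) * (1 - p.rho0) ^ k := by
  obtain ⟨v, hv, hS⟩ := hp.outer_potential hk hm hn h0 ht0 ha hb hρ hxs hxs' hT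
  have hlam := hp.lam_pos
  have ha0 : 0 < Real.sqrt p.q := Real.sqrt_pos.2 (hp.q_pos hk)
  have ha1 : Real.sqrt p.q ≤ 1 := Real.sqrt_le_one.2 (hp.q_le_one hk)
  have hΔ : 0 ≤ p.P p.x0 - p.Pstar := by rw [← hxs']; linarith [hxs p.x0]
  have h1 := strongConvexOn_growth (hp.P_strong hm hn) hxs (p.outer Q z k).x
  rw [norm_sub_rev] at h1
  have h3 : p.lam / 2 * ‖xs - (p.outer Q z k).x‖ ^ 2 ≤ p.P (p.outer Q z k).x - p.P xs := by
    linarith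
  have h2 := norm_sub_sq_le_of_potential hlam ha0 hv ((add_le_add h3 le_rfl).trans hS)
  rw [mul_pow, mul_pow, mul_pow, mul_pow, ← pow_mul, mul_comm k, pow_mul, Real.sq_sqrt hΔ,
    Real.sq_sqrt (by norm_num), Real.sq_sqrt (by linarith)] at h2
  calc _ ≤ _ := mul_le_mul_of_nonneg_left h2 hlam.le
    _ = _ := by field_simp; ring

end Outer

end

end Setup

end ECCatalyst

/-! ### Warm start and polynomial bounds in L -/

namespace ECCatalyst

/-- Each missing power of t = 1 - ρ0 costs a factor L. The worst term comes from the older centre: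
κ/l ≤ L, 16L² from the distance and L² from two powers of t, which explains L⁵. -/
theorem warm_start_real {L t Δ r κ l gap y0 y1 : ℝ} (hL : 2 ≤ L) (ht : 0 < t)
    (hLt : 1 ≤ L * t) (hΔ : 0 ≤ Δ) (hrL : r ≤ L) (hl : 0 < l) (hκ : 0 ≤ κ)
    (hκL : κ / l ≤ L) (j : ℕ) (hy1 : l * y1 ≤ 16 * L ^ 2 * Δ * t ^ (j + 1))
    (hy0 : l * y0 ≤ 16 * L ^ 2 * Δ * t ^ j)
    (hgap : gap ≤ (1 + 2 * r) * (2 / 9 * Δ * t ^ (j + 1) / 2) + κ * (y1 + y0)) :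
    gap ≤ 150 * L ^ 5 * (2 / 9 * Δ * t ^ (j + 1 + 1)) := by
  set X := Δ * t ^ (j + 1 + 1) with hX
  have hX0 : 0 ≤ X := by positivity
  have h1 : Δ * t ^ (j + 1) ≤ L * X := by
    have := mul_le_mul_of_nonneg_right hLt (show 0 ≤ Δ * t ^ (j + 1) by positivity)
    rw [hX, pow_succ t (j + 1)]
    linarith
  have h0 : Δ * t ^ j ≤ L ^ 2 * X := by
    have := mul_le_mul_of_nonneg_right hLt (show 0 ≤ Δ * t ^ j by positivity)
    have h2 := mul_le_mul_of_nonneg_left h1 (show 0 ≤ L by linarith)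
    rw [pow_succ t j] at h2
    linarith
  have h2 : κ * (y1 + y0) ≤ L * (16 * L ^ 2 * (L * X) + 16 * L ^ 2 * (L ^ 2 * X)) := by
    calc κ * (y1 + y0) = κ / l * (l * y1 + l * y0) := by field_simp
      _ ≤ κ / l * (16 * L ^ 2 * (L * X) + 16 * L ^ 2 * (L ^ 2 * X)) := by
          refine mul_le_mul_of_nonneg_left (add_le_add (hy1.trans ?_) (hy0.trans ?_)) (by positivity)
          · rw [mul_assoc]; exact mul_le_mul_of_nonneg_left h1 (by positivity)
          · rw [mul_assoc]; exact mul_le_mul_of_nonneg_left h0 (by positivity)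
      _ ≤ _ := mul_le_mul_of_nonneg_right hκL (by positivity)
  have h3 : (1 + 2 * r) * (2 / 9 * Δ * t ^ (j + 1) / 2) ≤ 3 * L * (1 / 9 * (L * X)) := by
    refine mul_le_mul (by linarith) (by linarith [show 0 ≤ Δ * t ^ (j + 1) by positivity])
      (by positivity) (by positivity)
  have hp2 : L ^ 2 * X ≤ L ^ 5 * X :=
    mul_le_mul_of_nonneg_right (pow_le_pow_right₀ (by linarith) (by norm_num)) hX0
  have hp4 : L ^ 4 * X ≤ L ^ 5 * X :=
    mul_le_mul_of_nonneg_right (pow_le_pow_right₀ (by linarith) (by norm_num)) hX0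
  have : 0 ≤ L ^ 5 * X := by positivity
  have e : 150 * L ^ 5 * (2 / 9 * Δ * t ^ (j + 1 + 1)) = 150 * (2 / 9) * (L ^ 5 * X) := by
    rw [hX]; ring
  rw [e]
  linarith

theorem inv_theta0_real_le {L N r δ m X1 X2 X3 b : ℝ} (hL : 2 ≤ L) (hr0 : 0 ≤ r)
    (hδ : 0 < δ) (hm : m ≤ N) (hN : N ≤ L) (hr : r ≤ L) (hδL : 1 / δ ≤ L)
    (h1 : X1 ≤ (N + 1) * r) (h2 : X2 ≤ 2 * (1 + 3 * N) * r * (1 / δ)) (hb0 : 0 ≤ b)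
    (hb : b ^ 2 ≤ 3 * N * r) (h3 : X3 ≤ 2 * b * (1 / δ)) : m + X1 + X2 + X3 ≤ 14 * L ^ 3 := by
  have hδ0 : 0 < 1 / δ := by positivity
  have hL0 : 0 < L := by linarith
  have g1 : (N + 1) * r ≤ (L + L) * L := mul_le_mul (by linarith) hr hr0 (by linarith)
  have g2 : 2 * (1 + 3 * N) * r * (1 / δ) ≤ 8 * L * L * L :=
    mul_le_mul (mul_le_mul (by linarith) hr hr0 (by linarith)) hδL hδ0.le (by positivity)
  have g3 : b ≤ 2 * L := by
    refine (sq_le_sq₀ hb0 (by positivity)).1 ?_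
    have : N * r ≤ L * L := mul_le_mul hN hr hr0 hL0.le
    nlinarith
  have g4 : 2 * b * (1 / δ) ≤ 2 * (2 * L) * L :=
    mul_le_mul (by linarith) hδL hδ0.le (by positivity)
  have e1 : L * L * 2 ≤ L * L * L := mul_le_mul_of_nonneg_left hL (by positivity)
  have e2 : L * 2 ≤ L * L := mul_le_mul_of_nonneg_left hL hL0.le
  have e3 : L ^ 3 = L * L * L := by ring
  rw [e3]
  linarith

theorem one_le_const {c L : ℝ} (hc : 0 < c) (hc1 : c ≤ 1) (hL : 2 ≤ L) :
    1 ≤ 60 * L ^ 4 / c * (150 * L ^ 5) := by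
  have h1 : 1 ≤ L := by linarith
  have h2 : 1 ≤ L ^ 4 := one_le_pow₀ h1
  have h3 : 1 ≤ L ^ 5 := one_le_pow₀ h1
  refine one_le_mul_of_one_le_of_one_le ?_ (by linarith)
  rw [le_div_iff₀ hc]
  linarith

theorem stop_const_le {c L s P : ℝ} (hc : 0 < c) (hc1 : c ≤ 1) (hL : 2 ≤ L) (hs : s ≤ 5 * L)
    (hP : P ≤ 3 * L * (1 + 7 * L ^ 3 / c)) : s + 2 * P ≤ 60 * L ^ 4 / c := by
  have h1 : L ≤ L ^ 4 := le_self_pow₀ (by linarith) (by norm_num)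
  have h2 : L ^ 4 ≤ L ^ 4 / c := by
    rw [le_div_iff₀ hc]
    exact mul_le_of_le_one_right (by positivity) hc1
  have e1 : 3 * L * (1 + 7 * L ^ 3 / c) = 3 * L + 21 * (L ^ 4 / c) := by ring
  have e2 : 60 * L ^ 4 / c = 60 * (L ^ 4 / c) := by ring
  rw [e2]
  linarith

/-- The product is 9000 L⁹/c. Since log L ≥ 1/2, the additive constants 3 and log(9000/c) become
multiples of log L, and 15 = 9 + 6. -/
theorem log_const_le {c L : ℝ} (hc : 0 < c) (hc1 : c ≤ 1) (hL : 2 ≤ L) :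
    Real.log (60 * L ^ 4 / c * (150 * L ^ 5)) + 3
      ≤ (15 + 2 * Real.log (9000 / c)) * Real.log L := by
  have h1 : 1 / 2 ≤ Real.log L := by
    have := Real.log_two_gt_d9
    have := Real.log_le_log (by norm_num) hL
    linarith
  have h2 : 0 ≤ Real.log (9000 / c) := by
    refine Real.log_nonneg ?_
    rw [le_div_iff₀ hc]
    linarith
  have e : 60 * L ^ 4 / c * (150 * L ^ 5) = 9000 / c * L ^ 9 := by field_simp; ring
  rw [e, Real.log_mul (by positivity) (by positivity), Real.log_pow]
  have := mul_le_mul_of_nonneg_left h1 h2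
  push_cast
  linarith

namespace Setup

noncomputable section

variable {d t m n : ℕ} {p : Setup d t m n}

theorem Regular.base_le_logArg (hp : p.Regular) (hk : 0 ≤ p.kap) (hm : 0 < m) (hn : 0 < n)
    (hb : ∀ i τ, BddBelow (Set.range (p.φ i τ))) (hP : p.Pstar < p.P p.x0) (k : ℕ) :
    2 + 1 / p.del + p.N + p.lamK / p.lam + p.R ^ 2 / (p.lamK * p.gam)
      + 1 / (Real.sqrt p.q - p.rho0) ≤ p.logArg k := by
  rw [logArg]
  refine le_add_of_nonneg_right ?_
  split_ifs
  · rw [hp.dualGap_eq hk hm hn _ (feas_zero hb), EReal.toReal_coe]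
    exact div_nonneg (sub_nonneg.2 (hp.Dr_le_Dstar hk hm hn _ (feas_zero hb))) (by linarith)
  · exact le_rfl

theorem Regular.logArg_bounds (hp : p.Regular) (hk : 0 ≤ p.kap) (hm : 0 < m) (hn : 0 < n)
    (hb : ∀ i τ, BddBelow (Set.range (p.φ i τ))) (hP : p.Pstar < p.P p.x0)
    (h0 : 0 < p.del) (hρ : p.rho0 < Real.sqrt p.q) (k : ℕ) :
    2 ≤ p.logArg k ∧ 1 / p.del ≤ p.logArg k ∧ p.N ≤ p.logArg k ∧ p.lamK / p.lam ≤ p.logArg k ∧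
      p.R ^ 2 / (p.lamK * p.gam) ≤ p.logArg k ∧
      1 + 1 / (Real.sqrt p.q - p.rho0) ≤ p.logArg k := by
  have h := hp.base_le_logArg hk hm hn hb hP k
  have h1 := p.N_pos hm hn
  have h2 : 0 < 1 / p.del := by positivity
  have h3 := div_pos (hp.lamK_pos hk) hp.lam_pos
  have h4 : 0 ≤ p.R ^ 2 / (p.lamK * p.gam) :=
    div_nonneg (sq_nonneg _) (mul_pos (hp.lamK_pos hk) hp.gam_pos).le
  have h5 : 0 < 1 / (Real.sqrt p.q - p.rho0) := one_div_pos.2 (by linarith)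
  refine ⟨?_, ?_, ?_, ?_, ?_, ?_⟩ <;> linarith

/-- The inherited dual point was good for the previous centre and the centre has moved little. For k
= 0 there is no previous loop; the initial gap is then part of `logArg 1` by definition. -/
theorem Regular.warm_start (hp : p.Regular) (hk : 0 ≤ p.kap) (hm : 0 < m) (hn : 0 < n)
    (h0 : 0 < p.del) (ht0 : 0 < p.theta) (ha : p.theta * m ≤ 1)
    (hb : ∀ i τ, BddBelow (Set.range (p.φ i τ))) (hρ : p.rho0 < Real.sqrt p.q)
    (hP : p.Pstar < p.P p.x0) {S : Type*} {Q : S → E d → E d} {z : ℕ → ℕ → Fin n → Fin m × S}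
    {k : ℕ} (hT : ∀ j < k, p.T Q z (j + 1) ≠ ⊤) :
    p.Dstar (p.outer Q z k).y - p.Dr (p.outer Q z k).y (p.outer Q z k).α
      ≤ 150 * p.logArg (k + 1) ^ 5 * p.eps (k + 1) := by
  obtain ⟨hL, -, -, hκ, hr, hq⟩ := hp.logArg_bounds hk hm hn hb hP h0 hρ (k + 1)
  have ha1 : Real.sqrt p.q ≤ 1 := Real.sqrt_le_one.2 (hp.q_le_one hk)
  have ht : 0 < 1 - p.rho0 := by linarith
  have hlam := hp.lam_pos
  have hq0 : 0 < 1 / (Real.sqrt p.q - p.rho0) := one_div_pos.2 (by linarith)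
  -- As √q ≤ 1, 1 - ρ0 ≥ √q - ρ0, whose inverse is a summand of `logArg`.
  have hLt : 1 ≤ p.logArg (k + 1) * (1 - p.rho0) := by
    calc (1 : ℝ) = 1 / (Real.sqrt p.q - p.rho0) * (Real.sqrt p.q - p.rho0) := by
          rw [one_div, inv_mul_cancel₀ (by linarith)]
      _ ≤ _ := mul_le_mul (by linarith) (by linarith) (by linarith) (by linarith)
  have hΔ : 0 ≤ p.P p.x0 - p.Pstar := by linarith
  cases k with
  | zero =>
    have h1 : (p.dualGap p.x0 fun _ _ => 0).toReal / (p.P p.x0 - p.Pstar) ≤ p.logArg 1 := by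
      have hN := p.N_pos hm hn
      have h3 := div_pos (hp.lamK_pos hk) hlam
      have h4 : 0 ≤ p.R ^ 2 / (p.lamK * p.gam) :=
        div_nonneg (sq_nonneg _) (mul_pos (hp.lamK_pos hk) hp.gam_pos).le
      have h2 : 0 < 1 / p.del := by positivity
      rw [logArg, if_pos rfl]
      linarith
    rw [hp.dualGap_eq hk hm hn _ (feas_zero hb), EReal.toReal_coe, div_le_iff₀ (by linarith)] at h1
    rw [zero_add] at hL hLt ⊢
    change p.Dstar p.x0 - p.Dr p.x0 (fun _ _ => 0) ≤ _
    refine h1.trans ?_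
    rw [eps, pow_one]
    set L := p.logArg 1
    set Δ := p.P p.x0 - p.Pstar
    have e1 : L * Δ * 1 ≤ L * Δ * (L * (1 - p.rho0)) := mul_le_mul_of_nonneg_left hLt (by positivity)
    have e2 : L ^ 2 * (Δ * (1 - p.rho0)) ≤ L ^ 5 * (Δ * (1 - p.rho0)) :=
      mul_le_mul_of_nonneg_right (pow_le_pow_right₀ (by linarith) (by norm_num)) (by positivity)
    have e3 : 0 ≤ L ^ 5 * (Δ * (1 - p.rho0)) := by positivity
    linarith
  | succ j =>
    obtain ⟨xs, hxs', hxs⟩ := hp.exists_P_eq_Pstar hm hn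
    have hy1 := hp.norm_outer_sub_le hk hm hn h0 ht0 ha hb hρ hxs hxs' hT
    have hy0 := hp.norm_outer_sub_le hk hm hn h0 ht0 ha hb hρ hxs hxs' (k := j) fun i hi =>
      hT i (by omega)
    have hacc := (hp.outer_accuracy hk hm hn h0 ht0 ha hb (hT j (by omega))).1
    have hF := hp.feas_outer (Q := Q) hm hn (by positivity) ha hb z (j + 1)
    set o := p.outer Q z j
    set o' := p.outer Q z (j + 1)
    have hmove := hp.dual_gap_move hk hm hn o.y o'.y o'.α
    have hG := hp.G_sub_Dr_le hk hm hn o.y (p.v o'.α) hF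
    rw [sub_self, norm_zero, zero_pow two_ne_zero, mul_zero, add_zero, mul_div_assoc] at hG
    have hr0 : 0 ≤ p.R ^ 2 / (p.lamK * p.gam) :=
      div_nonneg (sq_nonneg _) (mul_pos (hp.lamK_pos hk) hp.gam_pos).le
    have hLsq : (1 + 1 / (Real.sqrt p.q - p.rho0)) ^ 2 ≤ p.logArg (j + 1 + 1) ^ 2 :=
      pow_le_pow_left₀ (by positivity) hq 2
    have hsum : ‖o'.y - o.y‖ ^ 2 ≤ 2 * (‖o'.y - xs‖ ^ 2 + ‖o.y - xs‖ ^ 2) := by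
      have h1 : ‖o'.y - o.y‖ ≤ ‖o'.y - xs‖ + ‖o.y - xs‖ := by
        rw [norm_sub_rev o.y xs]; exact norm_sub_le_norm_sub_add_norm_sub _ _ _
      have h2 := pow_le_pow_left₀ (norm_nonneg _) h1 2
      linarith [sq_nonneg (‖o'.y - xs‖ - ‖o.y - xs‖)]
    refine warm_start_real (κ := p.kap) (l := p.lam) (y0 := ‖o.y - xs‖ ^ 2) (y1 := ‖o'.y - xs‖ ^ 2)
      (r := p.R ^ 2 / (p.lamK * p.gam)) hL ht hLt hΔ hr hlam hk
      (le_trans ?_ hκ) j (hy1.trans ?_) (hy0.trans ?_) ?_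
    · exact div_le_div_of_nonneg_right (le_add_of_nonneg_left hlam.le) hlam.le
    · rw [mul_assoc (16 * _), mul_assoc (16 * _)]
      exact mul_le_mul_of_nonneg_right (by linarith) (by positivity)
    · rw [mul_assoc (16 * _), mul_assoc (16 * _)]
      exact mul_le_mul_of_nonneg_right (by linarith) (by positivity)
    · have h1 := mul_le_mul_of_nonneg_left hacc
        (show 0 ≤ 1 + 2 * (p.R ^ 2 / (p.lamK * p.gam)) by positivity)
      have h2 := mul_le_mul_of_nonneg_left hsum (show 0 ≤ p.kap / 2 by positivity)
      rw [eps] at h1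
      linarith

/-- The stopping quantity is controlled by the Lyapunov function. -/
theorem Regular.stopVal_le (hp : p.Regular) (hk : 0 ≤ p.kap) (hm : 0 < m) (hn : 0 < n)
    (h0 : 0 < p.del) (ht0 : 0 < p.theta) (y : E d) {s : InnerState d t m n} (hs : p.Inv s) :
    p.stopVal y s ≤ (Real.sqrt (4 * n + p.del * m * n)
        + 2 * (1 + 2 * (p.R ^ 2 / (p.lamK * p.gam))) * (1 + p.del / (2 * p.theta)))
      * (p.Dstar y - p.Dr y s.α + p.errWeight * ∑ τ, ‖s.e τ‖ ^ 2) := by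
  have hl := hp.lamK_pos hk
  have hg := hp.gam_pos
  have hn' : (0 : ℝ) < n := Nat.cast_pos.2 hn
  have h1 := hp.G_sub_Dr_le hk hm hn y s.u hs.feas
  have h2 := hs.norm_sq_le hn
  have h3 := hp.Dr_le_Dstar hk hm hn y hs.feas
  have h4 := hp.Dstar_le_Gstar hk hm hn y
  have hρ := p.ρ_nonneg h0 hl
  rw [mul_div_assoc] at h1
  set err := ∑ τ, ‖s.e τ‖ ^ 2
  have herr : 0 ≤ err := by positivity
  set gap := p.Dstar y - p.Dr y s.α with hgap
  have hgap0 : 0 ≤ gap := sub_nonneg.2 h3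
  set r := p.R ^ 2 / (p.lamK * p.gam)
  have hr0 : 0 ≤ r := by positivity
  -- Only the θ(λ+κ) part of the error weight is used; the ρ part is dropped.
  have h5 : p.lamK * ‖p.v s.α - s.u‖ ^ 2 ≤ p.del / (2 * p.theta) * (p.errWeight * err) := by
    calc _ ≤ p.lamK * (1 / n * err) := mul_le_mul_of_nonneg_left h2 hl.le
      _ = p.del / (2 * p.theta) * (2 * (p.theta * p.lamK) / (p.del * n) * err) := by field_simp
      _ ≤ _ := by
        rw [errWeight]
        refine mul_le_mul_of_nonneg_left (mul_le_mul_of_nonneg_right ?_ herr) (by positivity)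
        exact div_le_div_of_nonneg_right (by linarith) (by positivity)
  have hE : 0 ≤ p.errWeight * err := mul_nonneg (p.errWeight_nonneg h0 hl ht0) herr
  have hδθ : 0 ≤ p.del / (2 * p.theta) := by positivity
  have h6 : gap + p.lamK * ‖p.v s.α - s.u‖ ^ 2
      ≤ (1 + p.del / (2 * p.theta)) * (gap + p.errWeight * err) := by
    linarith [mul_nonneg hδθ hgap0]
  have h7 := mul_le_mul_of_nonneg_left h6 (show 0 ≤ 1 + 2 * r by positivity)
  rw [stopVal]
  linarith

theorem Φ_eq_ofReal (h0 : 0 < p.del) (hl : 0 < p.lamK) (ht0 : 0 < p.theta) (y : E d)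
    {s : InnerState d t m n} (hs : 0 ≤ p.Dstar y - p.Dr y s.α) :
    p.Φ y s = ENNReal.ofReal (p.Dstar y - p.Dr y s.α + p.errWeight * ∑ τ, ‖s.e τ‖ ^ 2) := by
  have hw := p.errWeight_nonneg h0 hl ht0
  rw [Φ, ← ENNReal.ofReal_sum_of_nonneg fun _ _ => by positivity, ← ENNReal.ofReal_mul hw,
    ← ENNReal.ofReal_add hs (by positivity)]

/-- A crude polynomial bound suffices, as it is used only inside the logarithm. It needs every
constant expressed through N and R²/((λ+κ)γ), via R_m² ≤ N R². -/
theorem Regular.inv_theta0_le_logArg (hp : p.Regular) (hk : 0 ≤ p.kap) (hm : 0 < m) (hn : 0 < n)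
    (hb : ∀ i τ, BddBelow (Set.range (p.φ i τ))) (hP : p.Pstar < p.P p.x0)
    (h0 : 0 < p.del) (h1 : p.del < 1) (hρ : p.rho0 < Real.sqrt p.q) (k : ℕ) :
    1 / p.theta0 ≤ 14 * p.logArg k ^ 3 := by
  obtain ⟨hL, hδ, hN, -, hr, -⟩ := hp.logArg_bounds hk hm hn hb hP h0 hρ k
  have hl := mul_pos (hp.lamK_pos hk) hp.gam_pos
  have hN0 := p.N_pos hm hn
  have hn1 : (1 : ℝ) ≤ n := Nat.one_le_cast.2 hn
  have hm0 : (0 : ℝ) < m := Nat.cast_pos.2 hm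
  have hRm := p.Rm_sq_le hm hn
  have hB : p.B ^ 2 ≤ 3 * p.N * p.R ^ 2 := by
    have h2 := pow_le_pow_left₀ p.Rbar_nonneg (p.Rbar_le_Rm hm) 2
    have h3 : p.del * p.Rm ^ 2 ≤ 1 * p.Rm ^ 2 := mul_le_mul_of_nonneg_right h1.le (sq_nonneg _)
    have h4 : (1 - p.del) * (2 * p.Rbar ^ 2 + p.del * p.Rm ^ 2)
        ≤ 1 * (2 * p.Rbar ^ 2 + p.del * p.Rm ^ 2) :=
      mul_le_mul_of_nonneg_right (by linarith) (by positivity)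
    rw [p.B_sq h1 h0]
    linarith
  rw [theta0, one_div_one_div]
  set c := p.lamK * p.gam with hc
  have hsc := Real.sq_sqrt hl.le
  have hsc0 := Real.sqrt_pos.2 hl
  have hr0 : 0 ≤ p.R ^ 2 / c := by positivity
  refine inv_theta0_real_le (N := p.N) (r := p.R ^ 2 / c) (b := p.B / Real.sqrt c) hL hr0 h0
    ?_ hN hr hδ ?_ ?_ (div_nonneg p.B_nonneg hsc0.le) ?_ ?_
  · exact le_mul_of_one_le_right hm0.le hn1
  · rw [← mul_div_assoc]
    refine div_le_div_of_nonneg_right ?_ hl.le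
    have := div_le_self (sq_nonneg p.Rm) hn1
    linarith
  · have e : 2 * (1 + 3 * p.N) * (p.R ^ 2 / c) * (1 / p.del)
        = 2 * (1 + 3 * p.N) * p.R ^ 2 / (p.del * c) := by field_simp
    rw [e]
    refine div_le_div_of_nonneg_right ?_ (by positivity)
    linarith [sq_nonneg (p.R - p.B)]
  · rw [div_pow, hsc, ← mul_div_assoc]
    exact div_le_div_of_nonneg_right hB hl.le
  · refine le_of_eq ?_
    field_simp

/-- The sharp bound, which multiplies the logarithm. B is estimated twice: as a sum √(1-δ)(2R̄ + √δ
R_m) to match a₃, and as a single root to match b₃. -/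
theorem Regular.inv_theta0_le (hp : p.Regular) (hk : 0 ≤ p.kap)
    (h0 : 0 < p.del) (h1 : p.del < 1) :
    1 / p.theta0 ≤ 8 * (m + p.a₃ / p.lamK + p.b₃ / Real.sqrt p.lamK) := by
  have hl := hp.lamK_pos hk
  have hg := hp.gam_pos
  have hR := p.R_nonneg
  have hRb := p.Rbar_nonneg
  have hRm := p.Rm_nonneg
  have hsδ := Real.sqrt_pos.2 h0
  have hsδ2 := Real.sq_sqrt h0.le
  have hB1 : p.B ≤ Real.sqrt (1 - p.del) * (2 * p.Rbar + Real.sqrt p.del * p.Rm) := by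
    refine mul_le_mul_of_nonneg_left ?_ (Real.sqrt_nonneg _)
    refine Real.sqrt_le_iff.2 ⟨by positivity, ?_⟩
    have h2 : 0 ≤ p.Rbar * (Real.sqrt p.del * p.Rm) := by positivity
    have h3 : (Real.sqrt p.del * p.Rm) ^ 2 = p.del * p.Rm ^ 2 := by rw [mul_pow, hsδ2]
    linarith [sq_nonneg p.Rbar]
  have hB2 : p.B ≤ 2 * Real.sqrt ((1 - p.del) * (p.Rbar ^ 2 + p.del * p.Rm ^ 2)) := by
    rw [B, ← Real.sqrt_mul (by linarith)]
    refine Real.sqrt_le_iff.2 ⟨by positivity, ?_⟩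
    have h2 : 0 ≤ (1 - p.del) * (p.Rbar ^ 2 + p.del * p.Rm ^ 2) :=
      mul_nonneg (by linarith) (by positivity)
    have h3 : 0 ≤ (1 - p.del) * p.Rbar ^ 2 := mul_nonneg (by linarith) (by positivity)
    have h4 : 0 ≤ (1 - p.del) * (p.del * p.Rm ^ 2) := mul_nonneg (by linarith) (by positivity)
    rw [mul_pow, Real.sq_sqrt h2]
    linarith
  have hX2 : 4 * p.R * p.B / (p.del * (p.lamK * p.gam))
      ≤ 8 * ((Real.sqrt (1 - p.del) * p.R * p.Rbar / (p.del * p.gam)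
        + Real.sqrt (1 - p.del) * p.R * p.Rm / (Real.sqrt p.del * p.gam)) / p.lamK) := by
    have h2 : 0 ≤ Real.sqrt (1 - p.del) * p.R * p.Rm * Real.sqrt p.del := by positivity
    have h3 := mul_le_mul_of_nonneg_left hB1 hR
    have e0 : ∀ X, X / (Real.sqrt p.del * p.gam) = X * Real.sqrt p.del / (p.del * p.gam) := fun X => by
      rw [div_eq_div_iff (by positivity) (by positivity)]
      linear_combination (-X * p.gam) * hsδ2
    have e : 8 * ((Real.sqrt (1 - p.del) * p.R * p.Rbar / (p.del * p.gam)
        + Real.sqrt (1 - p.del) * p.R * p.Rm / (Real.sqrt p.del * p.gam)) / p.lamK)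
        = 8 * (Real.sqrt (1 - p.del) * p.R * p.Rbar
          + Real.sqrt (1 - p.del) * p.R * p.Rm * Real.sqrt p.del) / (p.del * (p.lamK * p.gam)) := by
      rw [e0]
      field_simp
    rw [e]
    refine div_le_div_of_nonneg_right ?_ (by positivity)
    linarith
  have hX3 : 2 * p.B / (p.del * Real.sqrt (p.lamK * p.gam)) ≤ 8 * (p.b₃ / Real.sqrt p.lamK) := by
    have hsl := Real.sqrt_pos.2 hl
    have hsg := Real.sqrt_pos.2 hg
    rw [b₃, Real.sqrt_div' _ hg.le, Real.sqrt_mul hl.le]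
    have e : 8 * (1 / p.del * (Real.sqrt ((1 - p.del) * (p.Rbar ^ 2 + p.del * p.Rm ^ 2))
        / Real.sqrt p.gam) / Real.sqrt p.lamK)
        = 8 * Real.sqrt ((1 - p.del) * (p.Rbar ^ 2 + p.del * p.Rm ^ 2))
          / (p.del * (Real.sqrt p.lamK * Real.sqrt p.gam)) := by field_simp
    rw [e]
    refine div_le_div_of_nonneg_right ?_ (by positivity)
    linarith [Real.sqrt_nonneg ((1 - p.del) * (p.Rbar ^ 2 + p.del * p.Rm ^ 2))]
  have hX1 : (p.Rm ^ 2 / n + p.R ^ 2) / (p.lamK * p.gam)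
      = (p.Rm ^ 2 / (n * p.gam) + p.R ^ 2 / p.gam) / p.lamK := by
    rw [← div_div _ (n : ℝ), ← add_div, div_div, mul_comm p.gam]
  have hX1' : 0 ≤ (p.Rm ^ 2 / (n * p.gam) + p.R ^ 2 / p.gam) / p.lamK := by positivity
  have hm0 : (0 : ℝ) ≤ m := Nat.cast_nonneg m
  have ha3 : p.a₃ / p.lamK = (p.Rm ^ 2 / (n * p.gam) + p.R ^ 2 / p.gam) / p.lamK
      + (Real.sqrt (1 - p.del) * p.R * p.Rbar / (p.del * p.gam)
        + Real.sqrt (1 - p.del) * p.R * p.Rm / (Real.sqrt p.del * p.gam)) / p.lamK := by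
    rw [a₃, ← add_div, add_assoc (p.Rm ^ 2 / (n * p.gam) + p.R ^ 2 / p.gam)]
  rw [theta0, one_div_one_div, ha3, hX1]
  linarith

end

end Setup

end ECCatalyst

/-! ### Induction over outer iterations and final assembly -/

namespace ECCatalyst

namespace Setup

noncomputable section

variable {d t m n : ℕ} {p : Setup d t m n}

theorem theta0_pos (hm : 0 < m) (h0 : 0 < p.del) (hl : 0 < p.lamK) (hg : 0 < p.gam) :
    0 < p.theta0 :=
  one_div_pos.2 (p.theta0_inv_pos hm h0 hl hg)

theorem inv_theta_le {c : ℝ} (hc : 0 < c) (h : 0 < p.theta0) (ht : c * p.theta0 ≤ p.theta) :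
    1 / p.theta ≤ 1 / c * (1 / p.theta0) := by
  rw [one_div_mul_one_div]
  exact one_div_le_one_div_of_le (by positivity) ht

theorem Regular.ofReal_stopVal_le (hp : p.Regular) (hk : 0 ≤ p.kap) (hm : 0 < m) (hn : 0 < n)
    (hb : ∀ i τ, BddBelow (Set.range (p.φ i τ))) (hP : p.Pstar < p.P p.x0)
    (h0 : 0 < p.del) (h1 : p.del < 1) (hρ : p.rho0 < Real.sqrt p.q) {c : ℝ} (hc : 0 < c)
    (hc1 : c ≤ 1) (ht : c * p.theta0 ≤ p.theta) (k : ℕ) (y : E d) {s : InnerState d t m n}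
    (hs : p.Inv s) :
    ENNReal.ofReal (p.stopVal y s) ≤ ENNReal.ofReal (60 * p.logArg k ^ 4 / c) * p.Φ y s := by
  have hl := hp.lamK_pos hk
  have hθ0 := theta0_pos hm h0 hl hp.gam_pos
  have ht0 : 0 < p.theta := lt_of_lt_of_le (by positivity) ht
  have hgap := sub_nonneg.2 (hp.Dr_le_Dstar hk hm hn y hs.feas)
  obtain ⟨hL, -, hN, -, hr, -⟩ := hp.logArg_bounds hk hm hn hb hP h0 hρ k
  have hX := hp.inv_theta0_le_logArg hk hm hn hb hP h0 h1 hρ k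
  have hθ := inv_theta_le hc hθ0 ht
  rw [Φ_eq_ofReal h0 hl ht0 y hgap, ← ENNReal.ofReal_mul (by positivity)]
  refine ENNReal.ofReal_le_ofReal ((hp.stopVal_le hk hm hn h0 ht0 y hs).trans ?_)
  have hE : 0 ≤ p.errWeight * ∑ τ, ‖s.e τ‖ ^ 2 :=
    mul_nonneg (p.errWeight_nonneg h0 hl ht0) (by positivity)
  refine mul_le_mul_of_nonneg_right ?_ (by linarith)
  set L := p.logArg k with hLd
  have hr0 : 0 ≤ p.R ^ 2 / (p.lamK * p.gam) :=
    div_nonneg (sq_nonneg _) (mul_pos hl hp.gam_pos).le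
  set r := p.R ^ 2 / (p.lamK * p.gam)
  have hm1 : (1 : ℝ) ≤ m := Nat.one_le_cast.2 hm
  have hn1 : (1 : ℝ) ≤ n := Nat.one_le_cast.2 hn
  have hN1 : 1 ≤ p.N := one_le_mul_of_one_le_of_one_le hm1 hn1
  have hsq : Real.sqrt (4 * n + p.del * m * n) ≤ 5 * L := by
    refine Real.sqrt_le_iff.2 ⟨by positivity, ?_⟩
    have e1 : 4 * (n : ℝ) ≤ 4 * p.N := by
      have := le_mul_of_one_le_left (Nat.cast_nonneg n) hm1
      rw [N]; linarith
    have e2 : p.del * m * n ≤ 1 * p.N := by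
      rw [mul_assoc]; exact mul_le_mul_of_nonneg_right h1.le (by positivity)
    nlinarith
  have hδθ : p.del / (2 * p.theta) ≤ 7 * L ^ 3 / c := by
    have e1 : p.del / (2 * p.theta) = p.del * (1 / p.theta) / 2 := by field_simp
    have e2 : p.del * (1 / p.theta) ≤ 1 * (1 / c * (14 * L ^ 3)) :=
      mul_le_mul h1.le (hθ.trans (mul_le_mul_of_nonneg_left hX (by positivity))) (by positivity)
        zero_le_one
    have e3 : 7 * L ^ 3 / c = 1 * (1 / c * (14 * L ^ 3)) / 2 := by ring
    rw [e1, e3]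
    linarith
  have hL0 : 0 < L := by linarith
  have hprod : (1 + 2 * r) * (1 + p.del / (2 * p.theta)) ≤ 3 * L * (1 + 7 * L ^ 3 / c) :=
    mul_le_mul (by linarith) (by linarith) (by positivity) (by positivity)
  rw [mul_assoc 2]
  exact stop_const_le hc hc1 hL hsq hprod

theorem Φ_innerInit (p : Setup d t m n) (h0 : 0 < p.del) (hl : 0 < p.lamK) (ht0 : 0 < p.theta)
    (y : E d) (α : DualVar t m n) (h : p.Dr y α ≤ p.Dstar y) :
    p.Φ y (p.innerInit α) = ENNReal.ofReal (p.Dstar y - p.Dr y α) := by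
  rw [Φ_eq_ofReal (s := p.innerInit α) h0 hl ht0 y (sub_nonneg.2 h)]
  simp [innerInit]

variable {S : Type*} [MeasurableSpace S] {ν : Measure S} [IsProbabilityMeasure ν]
  {Q : S → E d → E d} {Ω : Type*} [mΩ : MeasurableSpace Ω] {μ : Measure Ω}
  {ζ : ℕ × ℕ × Fin n → Ω → Fin m × S}

/-- A finite mean forbids the value ∞ on a set of positive measure. Only the event of never stopping
has to be measurable, and it is a countable intersection of conditions on `stopVal`. -/
theorem Regular.ae_T_ne_top (hp : p.Regular) (hk : 0 ≤ p.kap) (hm : 0 < m)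
    (hn : 0 < n) (ha0 : 0 ≤ p.theta * m) (ha : p.theta * m ≤ 1)
    (hb : ∀ i τ, BddBelow (Set.range (p.φ i τ)))
    (hQ : Measurable fun z : S × E d => Q z.1 z.2) (hζ : ∀ j, Measurable (ζ j)) (k : ℕ)
    (h : ∫⁻ ω, ((p.T Q (fun k' K τ => ζ (k', K, τ) ω) (k + 1) : ℕ∞) : ℝ≥0∞) ∂μ ≠ ⊤) :
    ∀ᵐ ω ∂μ, p.T Q (fun k' K τ => ζ (k', K, τ) ω) (k + 1) ≠ ⊤ := by
  set A : Set Ω := {ω | p.T Q (fun k' K τ => ζ (k', K, τ) ω) (k + 1) = ⊤} with hA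
  have hAm : MeasurableSet A := by
    have h1 : A = ⋂ K : ℕ, {ω | 1 ≤ K → p.eps (k + 1)
        < p.stopVal (p.traj Q ζ k K ω).1 (p.traj Q ζ k K ω).2} := by
      ext ω
      simp only [hA, T, stopTime, iInf_eq_top, Set.mem_iInter, Set.mem_ofPred_eq]
      refine forall_congr' fun K => ?_
      rw [← not_le, ← hp.stops_iff hk hm hn _ _ (hp.inv_traj (Q := Q) (ζ := ζ) hm hn ha0 ha hb k K ω).feas]
      simp only [ENat.natCast_ne_top, imp_false, not_and]
      rfl
    rw [h1]
    refine MeasurableSet.iInter fun K => ?_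
    by_cases hK : 1 ≤ K
    · simp only [hK, true_imp_iff]
      exact measurableSet_lt measurable_const
        (measurable_pair_comp (hp.measurable_stopVal hk hm hn)
          (hp.measurable_traj hk hm hn ha0 ha hb hQ hζ k K).fst
          (hp.measurable_traj hk hm hn ha0 ha hb hQ hζ k K).snd)
    · simp [hK]
  rw [ae_iff]
  have h2 : ∫⁻ ω, A.indicator (fun _ => (⊤ : ℝ≥0∞)) ω ∂μ ≤
      ∫⁻ ω, ((p.T Q (fun k' K τ => ζ (k', K, τ) ω) (k + 1) : ℕ∞) : ℝ≥0∞) ∂μ := by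
    refine lintegral_mono fun ω => ?_
    by_cases hω : ω ∈ A
    · have h3 : p.T Q (fun k' K τ => ζ (k', K, τ) ω) (k + 1) = ⊤ := hω
      rw [h3]
      simp
    · rw [Set.indicator_of_notMem hω]
      exact zero_le
  rw [lintegral_indicator_const hAm] at h2
  have h3 : μ A = 0 := by
    by_contra h4
    rw [ENNReal.top_mul h4] at h2
    exact h (top_le_iff.1 h2)
  simpa [hA] using h3

variable [IsProbabilityMeasure μ]

/-- Strong induction on k: the bounds for earlier loops make their stopping times almost surely
finite, which is the hypothesis of the warm start for the present loop. The bound does not degrade,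
since earlier ones enter only through finiteness. -/
theorem Regular.lintegral_T_le_log (hp : p.Regular) (hk : 0 ≤ p.kap) (hm : 0 < m)
    (hn : 0 < n) (h0 : 0 < p.del) (h1 : p.del < 1) {c : ℝ} (hc : 0 < c)
    (hc1 : c ≤ 1) (hct : c * p.theta0 ≤ p.theta) (ht : p.theta ≤ p.theta0)
    (hρ : p.rho0 < Real.sqrt p.q) (hP : p.Pstar < p.P p.x0)
    (hb : ∀ i τ, BddBelow (Set.range (p.φ i τ))) (hQ : IsContractionCompressor ν Q p.del)
    (hζ : ∀ j, Measurable (ζ j)) (hind : iIndepFun ζ μ)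
    (hlaw : ∀ j, μ.map (ζ j) = (uniformOn (Set.univ : Set (Fin m))).prod ν) (k : ℕ) :
    ∫⁻ ω, ((p.T Q (fun k' K τ => ζ (k', K, τ) ω) (k + 1) : ℕ∞) : ℝ≥0∞) ∂μ
      ≤ ENNReal.ofReal ((Real.log (60 * p.logArg (k + 1) ^ 4 / c * (150 * p.logArg (k + 1) ^ 5)) + 3)
        / min p.theta (p.del / 4)) := by
  have hl := hp.lamK_pos hk
  have hθ0 := theta0_pos hm h0 hl hp.gam_pos
  have ht0 : 0 < p.theta := lt_of_lt_of_le (by positivity) hct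
  have ha := p.theta_mul_m_le_one hm hp.gam_pos hl h0 ht0 ht
  induction k using Nat.strong_induction_on with
  | _ k ih =>
  have hL := (hp.logArg_bounds hk hm hn hb hP h0 hρ (k + 1)).1
  have hT : ∀ᵐ ω ∂μ, ∀ j < k, p.T Q (fun k' K τ => ζ (k', K, τ) ω) (j + 1) ≠ ⊤ := by
    rw [ae_all_iff]
    intro j
    by_cases hj : j < k
    · filter_upwards [hp.ae_T_ne_top hk hm hn (by positivity) ha hb hQ.measurable hζ j
        (ne_top_of_le_ne_top ENNReal.ofReal_ne_top (ih j hj))] with ω hω _ using hω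
    · exact .of_forall fun ω h => absurd h hj
  have hε : 0 < p.eps (k + 1) := by
    have ha1 : Real.sqrt p.q ≤ 1 := Real.sqrt_le_one.2 (hp.q_le_one hk)
    have h2 : 0 < 1 - p.rho0 := by linarith
    have h3 : 0 < p.P p.x0 - p.Pstar := by linarith
    rw [eps]
    positivity
  refine hp.lintegral_T_le hk hm hn h0 h1 ht0 ht hb hQ hζ hind hlaw k (by positivity) ?_ hε
    (fun y s hs => hp.ofReal_stopVal_le hk hm hn hb hP h0 h1 hρ hc hc1 hct (k + 1) y hs) ?_
  · exact one_le_const hc hc1 hL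
  · filter_upwards [hT] with ω hω
    have h5 := hp.warm_start hk hm hn h0 ht0 ha hb hρ hP hω
    have hF := hp.feas_outer (Q := Q) hm hn (by positivity) ha hb
      (fun k' K τ => ζ (k', K, τ) ω) k
    exact (p.Φ_innerInit h0 hl ht0 _ _ (hp.Dr_le_Dstar hk hm hn _ hF)).le.trans
      (ENNReal.ofReal_le_ofReal h5)

theorem Regular.inv_min_le (hp : p.Regular) (hk : 0 ≤ p.kap) (hm : 0 < m)
    (h0 : 0 < p.del) (h1 : p.del < 1) {c : ℝ} (hc : 0 < c)
    (hc1 : c ≤ 1) (hct : c * p.theta0 ≤ p.theta) :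
    1 / min p.theta (p.del / 4)
      ≤ 8 / c * (1 / p.del + m + p.a₃ / p.lamK + p.b₃ / Real.sqrt p.lamK) := by
  have hl := hp.lamK_pos hk
  have hθ0 := theta0_pos hm h0 hl hp.gam_pos
  have ht0 : 0 < p.theta := lt_of_lt_of_le (by positivity) hct
  have h2 := inv_theta_le hc hθ0 hct
  have h3 := hp.inv_theta0_le hk h0 h1
  have h4 : 1 / min p.theta (p.del / 4) ≤ 1 / p.theta + 4 / p.del := by
    have e1 : 0 < 1 / p.theta := by positivity
    have e2 : 4 / p.del = 1 / (p.del / 4) := by rw [one_div_div]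
    have e3 : 0 < 1 / (p.del / 4) := by positivity
    rw [e2]
    rcases min_choice p.theta (p.del / 4) with h | h <;> rw [h] <;> linarith
  have h5 : 1 / c * (1 / p.theta0)
      ≤ 1 / c * (8 * (m + p.a₃ / p.lamK + p.b₃ / Real.sqrt p.lamK)) :=
    mul_le_mul_of_nonneg_left h3 (by positivity)
  have h6 : 4 / p.del ≤ 8 / c * (1 / p.del) := by
    rw [div_eq_mul_one_div]
    refine mul_le_mul_of_nonneg_right ?_ (by positivity)
    rw [le_div_iff₀ hc]
    linarith
  calc _ ≤ _ := h4.trans (add_le_add (h2.trans h5) h6)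
    _ = _ := by ring

end

end Setup

end ECCatalyst

theorem mainTheorem7 :
    ∀ c : ℝ, 0 < c → c ≤ 1 → ∃ C : ℝ, 0 < C ∧
      ∀ (d t m n : ℕ), 0 < m → 0 < n →
      ∀ p : ECCatalyst.Setup d t m n, p.Regular →
        (∀ i τ, BddBelow (Set.range (p.φ i τ))) →
        0 ≤ p.kap → p.rho0 < Real.sqrt p.q → p.Pstar < p.P p.x0 →
        0 < p.del → p.del < 1 →
        c * p.theta0 ≤ p.theta → p.theta ≤ p.theta0 →
      ∀ (S : Type*) [MeasurableSpace S] (ν : Measure S) [IsProbabilityMeasure ν]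
        (Q : S → ECCatalyst.E d → ECCatalyst.E d),
        ECCatalyst.IsContractionCompressor ν Q p.del →
      ∀ (Ω : Type*) [MeasurableSpace Ω] (μ : Measure Ω) [IsProbabilityMeasure μ]
        (ζ : ℕ × ℕ × Fin n → Ω → Fin m × S),
        (∀ j, Measurable (ζ j)) → iIndepFun ζ μ →
        (∀ j, μ.map (ζ j) = (uniformOn (Set.univ : Set (Fin m))).prod ν) →
      ∀ k : ℕ, 1 ≤ k →
        ∫⁻ ω, ((p.T Q (fun k' K τ => ζ (k', K, τ) ω) k : ℕ∞) : ℝ≥0∞) ∂μ ≤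
          ENNReal.ofReal
            (C * (1 / p.del + m + p.a₃ / (p.lam + p.kap) + p.b₃ / Real.sqrt (p.lam + p.kap))
              * Real.log (p.logArg k)) := by
  intro c hc hc1
  have hlog : 0 ≤ Real.log (9000 / c) := by
    refine Real.log_nonneg ?_
    rw [le_div_iff₀ hc]
    linarith
  -- The factor 8/c comes from 1/min(θ, δ/4), the other from absorbing the constants into log L.
  refine ⟨8 / c * (15 + 2 * Real.log (9000 / c)), by positivity, ?_⟩
  intro d t m n hm hn p hp hb hk hρ hP h0 h1 hct ht S _ ν _ Q hQ Ω _ μ _ ζ hζ hind hlaw k hk1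
  obtain ⟨k, rfl⟩ : ∃ j, k = j + 1 := ⟨k - 1, by omega⟩
  refine (hp.lintegral_T_le_log hk hm hn h0 h1 hc hc1 hct ht hρ hP hb hQ hζ hind hlaw k).trans
    (ENNReal.ofReal_le_ofReal ?_)
  have hL := (hp.logArg_bounds hk hm hn hb hP h0 hρ (k + 1)).1
  have hθ0 := ECCatalyst.Setup.theta0_pos hm h0 (hp.lamK_pos hk) hp.gam_pos
  have ht0 : 0 < p.theta := lt_of_lt_of_le (by positivity) hct
  have h2 := ECCatalyst.log_const_le hc hc1 hL
  have h3 := hp.inv_min_le hk hm h0 h1 hc hc1 hct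
  have h4 : 0 ≤ Real.log (p.logArg (k + 1)) := Real.log_nonneg (by linarith)
  rw [div_eq_mul_one_div]
  refine (mul_le_mul h2 h3 (by positivity) (by positivity)).trans (le_of_eq ?_)
  rw [ECCatalyst.Setup.lamK]
  ring
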